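/- Let $p$ be a prime, $G=\mathrm{SL}_2(\mathbb{Q}_p)$, and let $k$ be a field of characteristic $p$. Let $X$ be the Bruhat--Tits tree of $G$, with vertex set $X^0$ (homothety classes of $\mathbb{Z}_p$-lattices in $\mathbb{Q}_p^2$) and edge set $X^1$; edges are identified with their sets of vertices. For $x\in X^0$ let $K_x\subset G$ be the maximal compact subgroup fixing $x$, i.e. the stabilizer of $x$; for $\tau\in X^1$ let $U_\tau$ be the maximal pro-$p$-subgroup of $G$ fixing $\tau$. A $G$-equivariant homological coefficient system $\mathcal{F}$ in $k$-modules on $X$ consists of $k$-modules $\mathcal{F}(\tau)$ for all simplices $\tau$ (vertices and edges), $k$-linear maps $r^\tau_x:\mathcal{F}(\tau)\to\mathcal{F}(x)$ for $x\in\tau\in X^1$, and $k$-linear maps $g_\tau:\mathcal{F}(\tau)\to\mathcal{F}(g\tau)$ for $g\in G$ and all simplices $\tau$, such that $g_{h\tau}\circ h_\tau=(gh)_\tau$, $1_\tau=\mathrm{id}$, and $r^{g\tau}_{gx}\circ g_\tau=g_x\circ r^\tau_x$. Let $\mathfrak{C}(k)$ be the category of those $\mathcal{F}$ for which (a) $U_\tau$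 acts trivially on $\mathcal{F}(\tau)$ for every $\tau\in X^1$; (b) for $z\in\tau\in X^1$ the map $r^\tau_z$ is injective with image $\mathcal{F}(z)^{U_\tau}$; (c) $\mathcal{F}(z)=\sum_{\tau\ni z}\mathrm{im}(r^\tau_z)$ for every $z\in X^0$. Let $B=NT$ be a Borel subgroup of $G$ with unipotent radical $N$ and split maximal torus $T$, and let $\sigma=\{x_+,x_-\}$ be an edge in the apartment corresponding to $T$, labelled such that $N_0:=K_{x_+}\cap N$ fixes $x_-$. Let $X_+$ be the maximal connected full subcomplex of $X$ which contains $x_+$ but not $x_-$; the group $N_0$ acts on $X_+$. Let $X_+^0$ and $X_+^1$ be its sets of vertices and edges, and let $H_0(X_+,\mathcal{F})$ be the cokernel of the map $$\bigoplus_{\tau\in X_+^1}\mathcal{F}(\tau)\longrightarrow\bigoplus_{x\in X_+^0}\mathcal{F}(x),\qquad \mathcal{F}(\tau)\ni y\mapsto\sum_{x\in\tau}r^\tau_x(y),$$ with the induced action of $N_0$. Theorem. For every $\mathcal{F}\in\mathfrak{C}(k)$ the natural map $$\mathcal{F}(\sigma)\xrightarrow{\ r^\sigma_{x_+}\ }\mathcal{F}(x_+)\longrightarrow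 H_0(X_+,\mathcal{F})$$ takes values in $H_0(X_+,\mathcal{F})^{N_0}$ and induces a bijection $\mathcal{F}(\sigma)\to H_0(X_+,\mathcal{F})^{N_0}$. -/

import Mathlib

open scoped Pointwise DirectSum

noncomputable section

namespace SL2Tree

/-! ### The group `SL₂(ℚ_p)` and its Bruhat-Tits tree -/

/-- The group `G = SL₂(ℚ_p)` (with the `p`-adic topology). -/
abbrev G (p : ℕ) [Fact p.Prime] : Type := Matrix.SpecialLinearGroup (Fin 2) ℚ_[p]

/-- The plane `ℚ_p²` on which `G` acts by matrix-vector multiplication. -/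
abbrev Plane (p : ℕ) [Fact p.Prime] : Type := Fin 2 → ℚ_[p]

instance instSMulCommG (p : ℕ) [Fact p.Prime] : SMulCommClass (G p) ℤ_[p] (Plane p) where
  smul_comm g a v := by
    rw [← algebraMap_smul ℚ_[p] a v, ← algebraMap_smul ℚ_[p] a (g • v)]
    exact smul_comm g _ v

/-- `ℤ_p`-lattices in `ℚ_p²`. -/
def Lat (p : ℕ) [Fact p.Prime] : Type :=
  {M : Submodule ℤ_[p] (Plane p) // Submodule.IsLattice ℚ_[p] M}

/-- Homothety of lattices. -/
instance homothety (p : ℕ) [Fact p.Prime] : Setoid (Lat p) where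
  r M M' := ∃ c : ℚ_[p]ˣ, M'.1 = c • M.1
  iseqv :=
    { refl := fun M => ⟨1, (one_smul _ _).symm⟩
      symm := by
        rintro M M' ⟨c, h⟩
        exact ⟨c⁻¹, by rw [h, inv_smul_smul]⟩
      trans := by
        rintro M M' M'' ⟨c, h⟩ ⟨d, h'⟩
        exact ⟨d * c, by rw [h', h, mul_smul]⟩ }

/-- The set `X⁰` of vertices of the Bruhat-Tits tree: homothety classes of lattices in `ℚ_p²`. -/
def Vertex (p : ℕ) [Fact p.Prime] : Type := Quotient (homothety p)

variable {p : ℕ} [Fact p.Prime]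

/-- The homothety class of a lattice. -/
def cls (M : Lat p) : Vertex p := Quotient.mk (homothety p) M

theorem isLattice_smul (g : G p) (M : Submodule ℤ_[p] (Plane p))
    (hM : Submodule.IsLattice ℚ_[p] M) : Submodule.IsLattice ℚ_[p] (g • M) where
  fg := hM.fg.map _
  span_eq_top := by
    have h : Submodule.span ℚ_[p] ((g • M : Submodule ℤ_[p] (Plane p)) : Set (Plane p))
        = g • Submodule.span ℚ_[p] (M : Set (Plane p)) := by
      rw [Submodule.coe_pointwise_smul, Submodule.smul_span]
    rw [h, hM.span_eq_top, eq_top_iff]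
    intro v _
    have := Submodule.smul_mem_pointwise_smul (g⁻¹ • v) g (⊤ : Submodule ℚ_[p] (Plane p)) trivial
    rwa [smul_inv_smul] at this

theorem smul_units_smul (g : G p) (c : ℚ_[p]ˣ) (M : Submodule ℤ_[p] (Plane p)) :
    g • (c • M) = c • (g • M) := by
  ext v
  constructor
  · rintro ⟨w, ⟨u, hu, rfl⟩, rfl⟩
    exact ⟨g • u, ⟨u, hu, rfl⟩, (smul_comm g (c : ℚ_[p]) u).symm⟩
  · rintro ⟨w, ⟨u, hu, rfl⟩, rfl⟩
    exact ⟨(c : ℚ_[p]) • u, ⟨u, hu, rfl⟩, smul_comm g (c : ℚ_[p]) u⟩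

/-- The action of `G` on the vertices: `g` sends the class of `M` to the class of `gM`. -/
instance : MulAction (G p) (Vertex p) where
  smul g := Quotient.map (sa := homothety p) (sb := homothety p)
    (fun M : Lat p => (⟨g • M.1, isLattice_smul g M.1 M.2⟩ : Lat p))
    (by
      rintro M M' ⟨c, h⟩
      refine ⟨c, ?_⟩
      change g • M'.1 = c • (g • M.1)
      rw [h, smul_units_smul])
  one_smul x := by
    refine Quotient.inductionOn x fun M => ?_
    exact congrArg cls (Subtype.ext (one_smul (G p) M.1))
  mul_smul g h x := by
    refine Quotient.inductionOn x fun M => ?_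
    exact congrArg cls (Subtype.ext (mul_smul g h M.1))

theorem smul_cls (g : G p) (M : Lat p) :
    g • cls M = cls ⟨g • M.1, isLattice_smul g M.1 M.2⟩ := rfl

/-- The prime `p` as a unit of `ℚ_p`. -/
def pUnit (p : ℕ) [hp : Fact p.Prime] : ℚ_[p]ˣ :=
  Units.mk0 (p : ℚ_[p]) (Nat.cast_ne_zero.mpr hp.out.ne_zero)

/-- Adjacency in the tree: there are representing lattices with `pM ⊊ M' ⊊ M`. -/
def Adjacent (x y : Vertex p) : Prop :=
  ∃ M M' : Lat p, cls M = x ∧ cls M' = y ∧ pUnit p • M.1 < M'.1 ∧ M'.1 < M.1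

theorem smul_mono (c : ℚ_[p]ˣ) {M M' : Submodule ℤ_[p] (Plane p)} (h : M ≤ M') :
    c • M ≤ c • M' := Submodule.map_mono h

theorem smul_lt (c : ℚ_[p]ˣ) {M M' : Submodule ℤ_[p] (Plane p)} (h : M < M') :
    c • M < c • M' := by
  refine lt_of_le_of_ne (smul_mono c h.le) fun he => h.ne ?_
  have := congrArg (fun N => c⁻¹ • N) he
  simpa only [inv_smul_smul] using this

theorem g_smul_lt (g : G p) {M M' : Submodule ℤ_[p] (Plane p)} (h : M < M') :
    g • M < g • M' := by
  refine lt_of_le_of_ne (Submodule.map_mono h.le) fun he => h.ne ?_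
  have := congrArg (fun N => g⁻¹ • N) he
  simpa only [inv_smul_smul] using this

theorem smul_le_of_norm_le_one (c : ℚ_[p]ˣ) (hc : ‖(c : ℚ_[p])‖ ≤ 1)
    (M : Submodule ℤ_[p] (Plane p)) : c • M ≤ M := by
  rintro v ⟨u, hu, rfl⟩
  exact M.smul_mem (⟨c, hc⟩ : ℤ_[p]) hu

theorem adjacent_symm {x y : Vertex p} (h : Adjacent x y) : Adjacent y x := by
  obtain ⟨M, M', rfl, rfl, h1, h2⟩ := h
  refine ⟨M', ⟨pUnit p • M.1, ?_⟩, rfl, ?_, smul_lt _ h2, h1⟩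
  · have := M.2
    infer_instance
  · exact (Quotient.sound (s := homothety p) ⟨pUnit p, rfl⟩ : cls M = _).symm

theorem not_adjacent_self (x : Vertex p) : ¬ Adjacent x x := by
  rintro ⟨M, M', h, h', h1, h2⟩
  obtain ⟨c, hc⟩ : ∃ c : ℚ_[p]ˣ, M'.1 = c • M.1 := Quotient.exact (s := homothety p) (h.trans h'.symm)
  rw [hc] at h1 h2
  rcases le_or_gt 1 ‖(c : ℚ_[p])‖ with hn | hn
  · have h3 : c⁻¹ • (c • M.1) ≤ c • M.1 := by
      refine smul_le_of_norm_le_one _ ?_ _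
      rw [Units.val_inv_eq_inv_val, norm_inv]
      exact inv_le_one_of_one_le₀ hn
    rw [inv_smul_smul] at h3
    exact absurd h2 (not_lt_of_ge h3)
  · have h3 : ((pUnit p)⁻¹ * c) • M.1 ≤ M.1 := by
      refine smul_le_of_norm_le_one _ ?_ _
      have hlt : ‖(c : ℚ_[p])‖ ≤ (p : ℝ) ^ (-1 : ℤ) := by
        have := (Padic.norm_le_pow_iff_norm_lt_pow_add_one (c : ℚ_[p]) (-1)).mpr (by simpa using hn)
        exact this
      rw [Units.val_mul, Units.val_inv_eq_inv_val, norm_mul, norm_inv]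
      have hp0 : (0 : ℝ) < p := Nat.cast_pos.mpr (Fact.out : p.Prime).pos
      have hpn : ‖((pUnit p : ℚ_[p]ˣ) : ℚ_[p])‖ = (p : ℝ)⁻¹ := Padic.norm_p
      rw [hpn, inv_inv]
      calc (p : ℝ) * ‖(c : ℚ_[p])‖ ≤ p * (p : ℝ) ^ (-1 : ℤ) := by gcongr
        _ = 1 := by rw [zpow_neg_one, mul_inv_cancel₀ hp0.ne']
    have h4 := smul_mono (pUnit p) h3
    rw [← mul_smul, mul_inv_cancel_left] at h4
    exact absurd h1 (not_lt_of_ge h4)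

variable (p) in
/-- The Bruhat-Tits tree `X` of `SL₂(ℚ_p)`, as a graph on `X⁰`. -/
def tree : SimpleGraph (Vertex p) where
  Adj := Adjacent
  symm := ⟨fun _ _ h => adjacent_symm h⟩
  loopless := ⟨not_adjacent_self⟩

variable (p) in
/-- The set `X¹` of edges; an edge is an unordered pair of adjacent vertices. -/
abbrev Edge : Type := (tree p).edgeSet

theorem adj_smul (g : G p) {x y : Vertex p} (h : (tree p).Adj x y) :
    (tree p).Adj (g • x) (g • y) := by
  obtain ⟨M, M', rfl, rfl, h1, h2⟩ := h
  refine ⟨_, _, (smul_cls g M).symm, (smul_cls g M').symm, ?_, g_smul_lt g h2⟩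
  change pUnit p • (g • M.1) < g • M'.1
  rw [← smul_units_smul]
  exact g_smul_lt g h1

/-- The action of `G` on the edges, through the vertices: `g{x, y} = {gx, gy}`. -/
instance : MulAction (G p) (Edge p) where
  smul g τ := ⟨Sym2.map (g • ·) τ.1, by
    obtain ⟨τ, h⟩ := τ
    induction τ using Sym2.ind with
    | _ x y => exact adj_smul g h⟩
  one_smul τ := by
    obtain ⟨τ, h⟩ := τ
    induction τ using Sym2.ind with
    | _ x y =>
      apply Subtype.ext
      change s((1 : G p) • x, (1 : G p) • y) = s(x, y)
      rw [one_smul, one_smul]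
  mul_smul g g' τ := by
    obtain ⟨τ, h⟩ := τ
    induction τ using Sym2.ind with
    | _ x y =>
      apply Subtype.ext
      change s((g * g') • x, (g * g') • y) = s(g • g' • x, g • g' • y)
      rw [mul_smul, mul_smul]

theorem coe_smul_edge (g : G p) (τ : Edge p) : (g • τ : Edge p).1 = Sym2.map (g • ·) τ.1 := rfl

theorem smul_mem_edge (g : G p) {x : Vertex p} {τ : Edge p} (h : x ∈ τ.1) :
    g • x ∈ (g • τ : Edge p).1 := Sym2.mem_map.mpr ⟨x, h, rfl⟩

/-! ### Subgroups of `SL₂(ℚ_p)` -/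

/-- `K_x`, the maximal compact subgroup of `G` fixing the vertex `x`, i.e. the stabilizer of `x`
(which is compact). -/
def K (x : Vertex p) : Subgroup (G p) := MulAction.stabilizer (G p) x

/-- A subgroup `H` of `G` is a pro-`p`-group: it is profinite, and its quotients by open normal
subgroups are `p`-groups. -/
def IsProP (H : Subgroup (G p)) : Prop :=
  CompactSpace H ∧ TotallyDisconnectedSpace H ∧ ∀ V : OpenNormalSubgroup H, IsPGroup p (H ⧸ V.toSubgroup)

/-- `U_τ`, the maximal pro-`p`-subgroup of `G` fixing the edge `τ` (a pro-`p`-Iwahori subgroup):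
the subgroup generated by all pro-`p`-subgroups of `G` which fix the vertices of `τ`. -/
def U (τ : Edge p) : Subgroup (G p) :=
  sSup {H : Subgroup (G p) | IsProP H ∧ ∀ x ∈ τ.1, H ≤ K x}

/-- The unipotent radical `N` of the Borel subgroup stabilizing the line through the first vector
of the basis `b`. In the basis `b` it consists of the upper triangular unipotent matrices. -/
def N (b : Module.Basis (Fin 2) ℚ_[p] (Plane p)) : Subgroup (G p) :=
  MulAction.stabilizer (G p) (b 0)

/-- The vertices of the apartment of the split maximal torus `T` which is diagonal in the basis
`b`: the classes of the lattices with a `ℤ_p`-basis consisting of multiples of the `b i`. -/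
def apartment (b : Module.Basis (Fin 2) ℚ_[p] (Plane p)) : Set (Vertex p) :=
  {x | ∃ (M : Lat p) (c : Fin 2 → ℚ_[p]ˣ), cls M = x ∧
    M.1 = Submodule.span ℤ_[p] (Set.range fun i => (c i : ℚ_[p]) • b i)}

/-- `N₀ = K_{x₊} ∩ N`. -/
def N0 (b : Module.Basis (Fin 2) ℚ_[p] (Plane p)) (xp : Vertex p) : Subgroup (G p) := K xp ⊓ N b

/-! ### The half tree -/

/-- The vertices of the half tree `X₊`, the maximal connected full subcomplex which contains `x₊`
but not `x₋`: those which can be joined to `x₊` by a path that avoids `x₋`. -/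
def halfTree (xp xm : Vertex p) : Set (Vertex p) :=
  {y | ∃ w : (tree p).Walk xp y, xm ∉ w.support}

theorem smul_mem_halfTree {xp xm : Vertex p} (g : G p) (hp : g • xp = xp) (hm : g • xm = xm)
    {y : Vertex p} (hy : y ∈ halfTree xp xm) : g • y ∈ halfTree xp xm := by
  obtain ⟨w, hw⟩ := hy
  let f : tree p →g tree p := ⟨fun x => g • x, fun h => adj_smul g h⟩
  refine ⟨(w.map f).copy hp rfl, ?_⟩
  rw [SimpleGraph.Walk.support_copy, SimpleGraph.Walk.support_map, List.mem_map]
  rintro ⟨z, hz, hzm⟩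
  have : z = xm := smul_left_cancel g (hzm.trans hm.symm)
  exact hw (this ▸ hz)

/-! ### Equivariant coefficient systems -/

universe u v

/-- A `G`-equivariant homological coefficient system in `k`-modules on the tree `X`.

The map `F(x) → F(gx)` (resp. `F(τ) → F(gτ)`) attached to `g ∈ G` is `actV g h` (resp.
`actE g h`); the target is written as `F(y)` for a simplex `y` with a proof `h` that it equals
`gx`. -/
structure CoeffSystem (p : ℕ) [Fact p.Prime] (k : Type u) [Field k] where
  /-- The modules at the vertices. -/
  onV : Vertex p → Type v
  /-- The modules at the edges. -/
  onE : Edge p → Type v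
  [addV : ∀ x, AddCommGroup (onV x)]
  [addE : ∀ τ, AddCommGroup (onE τ)]
  [modV : ∀ x, Module k (onV x)]
  [modE : ∀ τ, Module k (onE τ)]
  /-- The transition maps. -/
  r : ∀ (τ : Edge p) (x : Vertex p), x ∈ τ.1 → (onE τ →ₗ[k] onV x)
  /-- The action on the values at vertices. -/
  actV : ∀ (g : G p) {x y : Vertex p}, g • x = y → (onV x →ₗ[k] onV y)
  /-- The action on the values at edges. -/
  actE : ∀ (g : G p) {τ η : Edge p}, g • τ = η → (onE τ →ₗ[k] onE η)
  actV_mul : ∀ (g h : G p) {x y z : Vertex p} (hxy : h • x = y) (hyz : g • y = z)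
    (hxz : (g * h) • x = z) (v : onV x), actV g hyz (actV h hxy v) = actV (g * h) hxz v
  actE_mul : ∀ (g h : G p) {τ η ζ : Edge p} (h₁ : h • τ = η) (h₂ : g • η = ζ)
    (h₃ : (g * h) • τ = ζ) (v : onE τ), actE g h₂ (actE h h₁ v) = actE (g * h) h₃ v
  actV_one : ∀ {x : Vertex p} (h : (1 : G p) • x = x) (v : onV x), actV 1 h v = v
  actE_one : ∀ {τ : Edge p} (h : (1 : G p) • τ = τ) (v : onE τ), actE 1 h v = v
  r_act : ∀ (g : G p) {τ η : Edge p} {x y : Vertex p} (hτ : g • τ = η) (hx : g • x = y)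
    (hxτ : x ∈ τ.1) (hyη : y ∈ η.1) (v : onE τ),
    r η y hyη (actE g hτ v) = actV g hx (r τ x hxτ v)

namespace CoeffSystem

attribute [instance] addV addE modV modE

variable {k : Type u} [Field k] (F : CoeffSystem.{u, v} p k)

/-- The three conditions which define the category `𝔆(k)`. -/
structure InC : Prop where
  /-- (a) `U_τ` acts trivially on `F(τ)`. -/
  trivial_edge : ∀ (τ : Edge p) (g : G p), g ∈ U τ → ∀ (h : g • τ = τ) (v : F.onE τ),
    F.actE g h v = v
  /-- (b) `F(τ) → F(z)` is injective ... -/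
  injective : ∀ (τ : Edge p) (z : Vertex p) (h : z ∈ τ.1), Function.Injective (F.r τ z h)
  /-- ... with image `F(z)^{U_τ}`. -/
  range_eq : ∀ (τ : Edge p) (z : Vertex p) (h : z ∈ τ.1) (w : F.onV z),
    w ∈ LinearMap.range (F.r τ z h) ↔ ∀ g ∈ U τ, ∀ hg : g • z = z, F.actV g hg w = w
  /-- (c) `F(z)` is the sum of the images of the `F(τ)` with `z ∈ τ`. -/
  generated : ∀ z : Vertex p,
    ⨆ (τ : Edge p) (h : z ∈ τ.1), LinearMap.range (F.r τ z h) = ⊤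

/-! ### Chains and homology on a full subcomplex, given by its set `S` of vertices -/

/-- The edges of the full subcomplex with vertex set `S`. -/
abbrev EdgeIn (S : Set (Vertex p)) : Type := {τ : Edge p // ∀ x ∈ τ.1, x ∈ S}

/-- The `0`-chains `⨁_{x ∈ S} F(x)`. -/
abbrev C0 (S : Set (Vertex p)) : Type v := ⨁ x : S, F.onV x.1

/-- The `1`-chains `⨁_τ F(τ)`. -/
abbrev C1 (S : Set (Vertex p)) : Type v := ⨁ τ : EdgeIn S, F.onE τ.1

open Classical in
/-- The element `v ∈ F(x)`, regarded as a `0`-chain. -/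
def ofV (S : Set (Vertex p)) (x : S) : F.onV x.1 →ₗ[k] F.C0 S :=
  DirectSum.lof k S (fun x => F.onV x.1) x

open Classical in
/-- The differential, sending `y ∈ F(τ)` to `∑_{x ∈ τ} r^τ_x(y)`. -/
def boundary (S : Set (Vertex p)) : F.C1 S →ₗ[k] F.C0 S :=
  DirectSum.toModule k (EdgeIn S) (F.C0 S) fun τ =>
    ∑ x ∈ τ.1.1.toFinset.attach,
      F.ofV S ⟨x.1, τ.2 x.1 (Sym2.mem_toFinset.mp x.2)⟩ ∘ₗ
        F.r τ.1 x.1 (Sym2.mem_toFinset.mp x.2)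

/-- `H_0`, the cokernel of the differential. -/
abbrev H0 (S : Set (Vertex p)) : Type v := F.C0 S ⧸ LinearMap.range (F.boundary S)

/-- The natural map from the value at a vertex to `H_0`. -/
def toH0 (S : Set (Vertex p)) (x : S) : F.onV x.1 →ₗ[k] F.H0 S :=
  (LinearMap.range (F.boundary S)).mkQ ∘ₗ F.ofV S x

open Classical in
/-- An element `g` with `gS ⊆ S` acts on `0`-chains, sending `v ∈ F(x)` to `gv ∈ F(gx)`. -/
def actC0 (S : Set (Vertex p)) (g : G p) (hg : ∀ x ∈ S, g • x ∈ S) : F.C0 S →ₗ[k] F.C0 S :=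
  DirectSum.toModule k S (F.C0 S) fun x => F.ofV S ⟨g • x.1, hg x.1 x.2⟩ ∘ₗ F.actV g rfl

variable {F} {S : Set (Vertex p)}

@[simp]
theorem actC0_ofV (g : G p) (hg : ∀ x ∈ S, g • x ∈ S) (x : S) (v : F.onV x.1) :
    F.actC0 S g hg (F.ofV S x v) = F.ofV S ⟨g • x.1, hg x.1 x.2⟩ (F.actV g rfl v) := by
  classical
  simp only [actC0, ofV]
  rw [DirectSum.toModule_lof]
  rfl

theorem C0_hom_ext {M : Type*} [AddCommGroup M] [Module k M] {f f' : F.C0 S →ₗ[k] M}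
    (h : ∀ (x : S) (v : F.onV x.1), f (F.ofV S x v) = f' (F.ofV S x v)) : f = f' := by
  classical
  refine DirectSum.linearMap_ext k fun x => LinearMap.ext fun v => ?_
  have := h x v
  simpa [ofV] using this

theorem ofV_actV_congr (g : G p) (x : Vertex p) {y y' : Vertex p} (h : g • x = y)
    (h' : g • x = y') (hy : y ∈ S) (hy' : y' ∈ S) (v : F.onV x) :
    F.ofV S ⟨y, hy⟩ (F.actV g h v) = F.ofV S ⟨y', hy'⟩ (F.actV g h' v) := by
  subst h
  subst h'
  rfl

theorem actC0_one (hg : ∀ x ∈ S, (1 : G p) • x ∈ S) (c : F.C0 S) : F.actC0 S 1 hg c = c := by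
  suffices F.actC0 S 1 hg = LinearMap.id from LinearMap.congr_fun this c
  refine C0_hom_ext fun x v => ?_
  rw [actC0_ofV, ofV_actV_congr 1 x.1 rfl (one_smul _ _) _ x.2, F.actV_one]
  rfl

theorem actC0_mul (g h : G p) (hg : ∀ x ∈ S, g • x ∈ S) (hh : ∀ x ∈ S, h • x ∈ S)
    (hgh : ∀ x ∈ S, (g * h) • x ∈ S) (c : F.C0 S) :
    F.actC0 S (g * h) hgh c = F.actC0 S g hg (F.actC0 S h hh c) := by
  suffices F.actC0 S (g * h) hgh = F.actC0 S g hg ∘ₗ F.actC0 S h hh from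
    LinearMap.congr_fun this c
  refine C0_hom_ext fun x v => ?_
  rw [LinearMap.comp_apply, actC0_ofV, actC0_ofV, actC0_ofV,
    F.actV_mul g h rfl rfl (mul_smul g h x.1)]
  exact ofV_actV_congr _ _ _ _ _ _ v

theorem smul_edgeIn (g : G p) (hg : ∀ x ∈ S, g • x ∈ S) (τ : EdgeIn S) :
    ∀ x ∈ (g • τ.1 : Edge p).1, x ∈ S := by
  intro x hx
  obtain ⟨y, hy, rfl⟩ := Sym2.mem_map.mp hx
  exact hg y (τ.2 y hy)

open Classical in
theorem boundary_lof (τ : EdgeIn S) (v : F.onE τ.1) {x y : Vertex p} (hxy : τ.1.1 = s(x, y)) :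
    F.boundary S (DirectSum.lof k (EdgeIn S) (fun τ => F.onE τ.1) τ v) =
      F.ofV S ⟨x, τ.2 x (by rw [hxy]; exact Sym2.mem_mk_left x y)⟩
          (F.r τ.1 x (by rw [hxy]; exact Sym2.mem_mk_left x y) v) +
        F.ofV S ⟨y, τ.2 y (by rw [hxy]; exact Sym2.mem_mk_right x y)⟩
          (F.r τ.1 y (by rw [hxy]; exact Sym2.mem_mk_right x y) v) := by
  have hne : x ≠ y := by
    have h := τ.1.2
    rw [hxy] at h
    exact (tree p).ne_of_adj h
  have key : ∀ (s : Finset (Vertex p)) (hs : ∀ z ∈ s, z ∈ τ.1.1) (_ : s = {x, y}),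
      ∑ z ∈ s.attach, F.ofV S ⟨z.1, τ.2 z.1 (hs z.1 z.2)⟩ (F.r τ.1 z.1 (hs z.1 z.2) v) =
      F.ofV S ⟨x, τ.2 x (by rw [hxy]; exact Sym2.mem_mk_left x y)⟩
          (F.r τ.1 x (by rw [hxy]; exact Sym2.mem_mk_left x y) v) +
        F.ofV S ⟨y, τ.2 y (by rw [hxy]; exact Sym2.mem_mk_right x y)⟩
          (F.r τ.1 y (by rw [hxy]; exact Sym2.mem_mk_right x y) v) := by
    rintro s hs rfl
    rw [Finset.attach_insert, Finset.sum_insert (by simpa using fun h => hne h.symm),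
      Finset.sum_image (fun a _ c _ h => Subtype.ext (congrArg (fun z => z.1) h))]
    congr 1
    exact Finset.sum_eq_single_of_mem (⟨y, by simp⟩ : {z // z ∈ ({y} : Finset (Vertex p))})
      (Finset.mem_attach _ _)
      (fun z _ hz => absurd (Subtype.ext (Finset.mem_singleton.mp z.2)) hz)
  rw [boundary, DirectSum.toModule_lof, LinearMap.sum_apply]
  exact key τ.1.1.toFinset (fun z hz => Sym2.mem_toFinset.mp hz)
    (by rw [hxy, Sym2.toFinset_mk_eq])

theorem actC0_boundary (g : G p) (hg : ∀ x ∈ S, g • x ∈ S) :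
    LinearMap.range (F.boundary S) ≤
      (LinearMap.range (F.boundary S)).comap (F.actC0 S g hg) := by
  classical
  rintro _ ⟨c, rfl⟩
  induction c using DirectSum.induction_on with
  | zero => simp
  | add c d hc hd =>
    rw [map_add]
    exact Submodule.add_mem _ hc hd
  | of τ v =>
    obtain ⟨x, y, hxy⟩ : ∃ x y, τ.1.1 = s(x, y) := ⟨_, _, (Quot.out_eq τ.1.1).symm⟩
    have hx : x ∈ τ.1.1 := by rw [hxy]; exact Sym2.mem_mk_left x y
    have hy : y ∈ τ.1.1 := by rw [hxy]; exact Sym2.mem_mk_right x y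
    have hxy' : (g • τ.1 : Edge p).1 = s(g • x, g • y) := by
      rw [coe_smul_edge, hxy]; rfl
    refine ⟨DirectSum.lof k (EdgeIn S) (fun τ => F.onE τ.1) ⟨g • τ.1, smul_edgeIn g hg τ⟩
      (F.actE g rfl v), ?_⟩
    rw [boundary_lof _ _ hxy']
    have h2 := boundary_lof τ v hxy
    rw [DirectSum.lof_eq_of] at h2
    rw [h2, map_add, actC0_ofV, actC0_ofV, F.r_act g rfl rfl hx, F.r_act g rfl rfl hy]

variable (F) in
/-- The representation of a group `H` preserving `S` on `H_0`. -/
def repH0 (S : Set (Vertex p)) (H : Subgroup (G p)) (hH : ∀ g ∈ H, ∀ x ∈ S, g • x ∈ S) :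
    Representation k H (F.H0 S) where
  toFun g := Submodule.mapQ _ _ (F.actC0 S g.1 (hH g.1 g.2)) (actC0_boundary _ _)
  map_one' := by
    refine LinearMap.ext fun c => ?_
    obtain ⟨c, rfl⟩ := Submodule.mkQ_surjective _ c
    simp only [Submodule.mkQ_apply, Submodule.mapQ_apply]
    exact congrArg _ (actC0_one _ c)
  map_mul' g h := by
    refine LinearMap.ext fun c => ?_
    obtain ⟨c, rfl⟩ := Submodule.mkQ_surjective _ c
    simp only [Submodule.mkQ_apply, Submodule.mapQ_apply, Module.End.mul_apply]
    exact congrArg _ (actC0_mul _ _ _ _ _ c)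

/-! ### The half tree -/

variable (F)

theorem mem_halfTree {xp xm : Vertex p} (hadj : (tree p).Adj xp xm) : xp ∈ halfTree xp xm :=
  ⟨SimpleGraph.Walk.nil, by simpa using hadj.ne'⟩

/-- The natural map `F(σ) → F(x₊) → H_0(X₊, F)` for the edge `σ = {x₊, x₋}`. -/
def naturalMap {xp xm : Vertex p} (hadj : (tree p).Adj xp xm) :
    F.onE ⟨s(xp, xm), hadj⟩ →ₗ[k] F.H0 (halfTree xp xm) :=
  F.toH0 (halfTree xp xm) ⟨xp, mem_halfTree hadj⟩ ∘ₗ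
    F.r ⟨s(xp, xm), hadj⟩ xp (Sym2.mem_mk_left xp xm)

/-- The action of `N₀ = K_{x₊} ∩ N` on `H_0(X₊, F)`, if `N₀` also fixes `x₋`. -/
def repN0 (b : Module.Basis (Fin 2) ℚ_[p] (Plane p)) {xp xm : Vertex p}
    (hfix : ∀ g ∈ N0 b xp, g • xm = xm) :
    Representation k (N0 b xp) (F.H0 (halfTree xp xm)) :=
  F.repH0 (halfTree xp xm) (N0 b xp) fun g hg _ hx =>
    smul_mem_halfTree g (MulAction.mem_stabilizer_iff.mp hg.1) (hfix g hg) hx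

end CoeffSystem

end SL2Tree

end

namespace SL2Tree

/-! ### Polynomial interpolation over `𝔽_p` -/

section Interpolation

variable {p : ℕ} [Fact p.Prime] {V : Type*} [AddCommGroup V] [Module (ZMod p) V]

/-! Choose a frame (f₀, f₁), with f₀ on the line fixed by N, such that x₊ = [f₀, f₁]. Then x₋ is
forced to be [p⁻¹f₀, f₁], and X₊ is a rooted tree: its vertices of level n are the classes [pⁿf₀, f₁
+ t f₀] with t in ℤ_p modulo pⁿ. The element γ of N₀ with f₁ ↦ f₁ + f₀ permutes every level
cyclically. Along the ray x_n = [pⁿf₀, f₁] with edges e_n = {x_n, x_(n+1)}, the stabilizer in γ^ℤ of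
x_n is generated by γ^(pⁿ), that of e_n by γ^(pⁿ⁺¹) (`isCyclicTree`).

Injectivity: at the outer end of an outermost edge in the support of a 1-chain nothing cancels, so a
boundary concentrated at x₊ is zero (`IsTriangular.boundary_injective`).

Surjectivity (`IsTriangular.exists_of_invariant`): if z represents an invariant class, then γz - z =
∂c. Pass to γ-coinvariants level by level. The stabilizer of e_n acts trivially on F(e_n), so c has
a class in F(e_n) for every n. If F(e_n) embeds into the coinvariants of F(x_n) under γ^(pⁿ), these
classes vanish one after the other, starting at the root. Then ∂c = (γ - 1)∂d for some d, and z - ∂d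
is an invariant chain. The value of an invariant chain at an outermost x_(n+1) comes from F(e_n) by
condition (b), and subtracting the boundary of an orbit sum removes that level. What remains is a
fixed vector of F(x₊), which comes from F(σ), again by (b).

The remaining point is the embedding of F(e_n) into the coinvariants. By (a)-(c), F(x_n) is a
representation V of SL₂(𝔽_p) generated by the invariants V^Ū of the lower unipotent group Ū; F(e_n)
maps into V^Ū, and γ^(pⁿ) acts as the upper unipotent u = `upper 1`. The claim is that V^Ū and (u -
1)V meet only in 0 (`eq_zero_of_diff_mem_lowerInv`). Split V^Ū into torus weights -r and let T be
the Weyl element times the norm of the upper unipotent group. For 0 < r < p - 1, T² = 0 and every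
vector killed by T is a lowest weight vector of type Sym^r; in weight 0, T² = -T, and the two
eigenspaces consist of lowest weight vectors of types Sym⁰ and Sym^(p-1). Hence the span V' of
everything generated by lowest weight vectors, and also V/V', are direct sums of copies of Sym^r
with r < p. On Sym^r the operator u - 1 raises the index, so its image misses the lowest weight
line, and its kernel is the Weyl translate of that line. In V/V' this allows v to be moved into V'
without changing (u - 1)v; in V' it gives (u - 1)v = 0. -/

theorem sum_pow_zmod (m : ℕ) :
    ∑ c : ZMod p, c ^ m = if m ≠ 0 ∧ p - 1 ∣ m then -1 else 0 := by
  classical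
  rcases Nat.eq_zero_or_pos m with rfl | hm
  · simp
  have h := FiniteField.sum_pow_units (ZMod p) m
  have h2 : ∑ c : ZMod p, c ^ m = ∑ x : (ZMod p)ˣ, ((x : ZMod p) ^ m) := by
    rw [← Fintype.sum_subtype_add_sum_subtype (fun c : ZMod p => c ≠ 0)]
    rw [Finset.sum_eq_zero (s := Finset.univ (α := {c : ZMod p // ¬ c ≠ 0})) (fun c _ => by
      have : c.1 = 0 := not_not.mp c.2
      rw [this, zero_pow hm.ne']), add_zero]
    exact (Fintype.sum_equiv unitsEquivNeZero _ _ (fun x => rfl)).symm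
  rw [h2, h, ZMod.card]
  simp [hm.ne']

/-- The `i`-th coefficient of the polynomial of degree less than `p` that interpolates `f`. -/
def coef (i : ℕ) (f : ZMod p → V) : V :=
  (if i = 0 then ∑ c, f c else 0) - ∑ c, c ^ (p - 1 - i) • f c

/-- The indicator function of c is a ↦ 1 - (a - c)^(p-1), and (a - c)^(p-1) = ∑ a^i c^(p-1-i) in
characteristic p because (a - c)^p = a^p - c^p. `coef` collects the powers of a. -/
theorem sum_coef (f : ZMod p → V) (a : ZMod p) :
    ∑ i ∈ Finset.range p, a ^ i • coef i f = f a := by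
  have hp := (Fact.out : p.Prime).two_le
  have h1 : ∀ c : ZMod p, ∑ i ∈ Finset.range p, a ^ i * c ^ (p - 1 - i) = if c = a then 0 else 1 := by
    intro c
    split_ifs with h
    · subst h
      rw [Finset.sum_congr rfl (g := fun _ => c ^ (p - 1))]
      · simp
      · intro i hi
        rw [← pow_add]
        congr 1
        have := Finset.mem_range.mp hi
        omega
    · have h2 := (Commute.all a c).geom_sum₂_mul p
      rw [ZMod.pow_card, ZMod.pow_card] at h2
      exact mul_right_cancel₀ (sub_ne_zero.mpr (Ne.symm h)) (by rw [h2, one_mul])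
  simp only [coef, smul_sub, Finset.sum_sub_distrib, Finset.smul_sum, smul_smul]
  rw [Finset.sum_comm]
  simp only [← Finset.sum_smul, h1]
  rw [Finset.sum_eq_single_of_mem 0 (Finset.mem_range.mpr (by omega))
    (fun i _ hi => by simp [hi])]
  simp only [pow_zero, one_smul, if_true, ite_smul, zero_smul]
  rw [← Finset.sum_sub_distrib, Finset.sum_eq_single_of_mem a (Finset.mem_univ a)
    (fun c _ hc => by simp [hc])]
  simp

/-- Power sums over 𝔽_p give uniqueness. The exponent p - 1 - i + j detects j = i, but for i = 0
also j = p - 1; the extra sum in `coef 0` cancels that second term. -/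
theorem coef_eq {f : ZMod p → V} {v : ℕ → V}
    (h : ∀ a, f a = ∑ j ∈ Finset.range p, a ^ j • v j) {i : ℕ} (hi : i < p) :
    coef i f = v i := by
  have hp := (Fact.out : p.Prime).two_le
  have h1 : ∀ m, ∑ c : ZMod p, c ^ m • f c =
      ∑ j ∈ Finset.range p, (if m + j ≠ 0 ∧ p - 1 ∣ m + j then (-1 : ZMod p) else 0) • v j := by
    intro m
    simp only [h, Finset.smul_sum, smul_smul, ← pow_add]
    rw [Finset.sum_comm]
    simp only [← Finset.sum_smul, sum_pow_zmod]
  have h0 : ∑ c : ZMod p, f c = - v (p - 1) := by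
    have := h1 0
    simp only [pow_zero, one_smul, zero_add] at this
    rw [this, Finset.sum_eq_single_of_mem (p - 1) (Finset.mem_range.mpr (by omega))]
    · simp; omega
    · intro j hj hne
      rw [if_neg, zero_smul]
      rintro ⟨hj0, hd⟩
      have := Nat.le_of_dvd (Nat.pos_of_ne_zero hj0) hd
      have := Finset.mem_range.mp hj
      omega
  rw [coef, h1, h0]
  have key : ∀ j < p, (p - 1 - i + j ≠ 0 ∧ p - 1 ∣ p - 1 - i + j) ↔ (j = i ∨ (i = 0 ∧ j = p - 1)) := by
    intro j hj
    constructor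
    · rintro ⟨hne, d, hd⟩
      have hd0 : d ≠ 0 := by rintro rfl; omega
      rcases Nat.lt_or_ge d 2 with hd2 | hd2
      · have : d = 1 := by omega
        subst this; omega
      · have : (p - 1) * 2 ≤ (p - 1) * d := Nat.mul_le_mul_left _ hd2
        omega
    · rintro (rfl | ⟨rfl, rfl⟩)
      · exact ⟨by omega, by rw [Nat.sub_add_cancel (by omega)]⟩
      · exact ⟨by omega, ⟨2, by omega⟩⟩
  rw [Finset.sum_congr rfl (g := fun j => (if j = i then -v j else 0) +
    (if j = p - 1 then (if i = 0 then -v j else 0) else 0))]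
  · rw [Finset.sum_add_distrib, Finset.sum_ite_eq', Finset.sum_ite_eq',
      if_pos (Finset.mem_range.mpr hi), if_pos (Finset.mem_range.mpr (by omega))]
    split_ifs <;> simp
  · intro j hj
    have hj' := Finset.mem_range.mp hj
    rw [if_congr (key j hj') rfl rfl]
    by_cases h1 : j = i
    · subst h1
      by_cases h2 : j = p - 1
      · have : j ≠ 0 := by omega
        rw [h2] at this
        simp [h2]
        intro h; omega
      · simp [h2]
    · by_cases h2 : j = p - 1 <;> by_cases h3 : i = 0 <;> simp [h1, h2, h3]
      all_goals omega

theorem eq_of_sum_pow {v v' : ℕ → V}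
    (h : ∀ a : ZMod p, ∑ j ∈ Finset.range p, a ^ j • v j = ∑ j ∈ Finset.range p, a ^ j • v' j)
    {i : ℕ} (hi : i < p) : v i = v' i := by
  rw [← coef_eq (f := fun a : ZMod p => ∑ j ∈ Finset.range p, a ^ j • v j) (fun _ => rfl) hi]
  exact coef_eq h hi

theorem coef_apply (i : ℕ) (θ : ZMod p → Module.End (ZMod p) V) (w : V) :
    coef i θ w = coef i (fun a => θ a w) := by
  simp only [coef, LinearMap.sub_apply, LinearMap.sum_apply, LinearMap.smul_apply]
  split_ifs <;> simp [LinearMap.sum_apply]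

end Interpolation

/-! ### Elements of `SL₂` -/

section Elements

variable {R : Type*} [CommRing R]

/-- Upper triangular unipotent matrices. -/
def upper (a : R) : Matrix.SpecialLinearGroup (Fin 2) R := ⟨!![1, a; 0, 1], by simp⟩

/-- Lower triangular unipotent matrices. -/
def lower (b : R) : Matrix.SpecialLinearGroup (Fin 2) R := ⟨!![1, 0; b, 1], by simp⟩

/-- Diagonal matrices. -/
def torus (x : Rˣ) : Matrix.SpecialLinearGroup (Fin 2) R :=
  ⟨!![(x : R), 0; 0, ((x⁻¹ : Rˣ) : R)], by simp⟩

variable (R) in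
/-- A representative of the nontrivial Weyl group element. -/
def weyl : Matrix.SpecialLinearGroup (Fin 2) R := ⟨!![0, 1; -1, 0], by simp⟩

theorem sl_ext {A B : Matrix.SpecialLinearGroup (Fin 2) R} (h00 : A 0 0 = B 0 0)
    (h01 : A 0 1 = B 0 1) (h10 : A 1 0 = B 1 0) (h11 : A 1 1 = B 1 1) : A = B := by
  ext i j
  fin_cases i <;> fin_cases j <;> assumption

theorem sl_mul_apply (A B : Matrix.SpecialLinearGroup (Fin 2) R) (i j : Fin 2) :
    (A * B) i j = A i 0 * B 0 j + A i 1 * B 1 j := by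
  rw [Matrix.SpecialLinearGroup.coe_mul, Matrix.mul_apply, Fin.sum_univ_two]

section Entries

@[simp] theorem upper_00 (a : R) : upper a 0 0 = 1 := rfl
@[simp] theorem upper_01 (a : R) : upper a 0 1 = a := rfl
@[simp] theorem upper_10 (a : R) : upper a 1 0 = 0 := rfl
@[simp] theorem upper_11 (a : R) : upper a 1 1 = 1 := rfl
@[simp] theorem lower_00 (a : R) : lower a 0 0 = 1 := rfl
@[simp] theorem lower_01 (a : R) : lower a 0 1 = 0 := rfl
@[simp] theorem lower_10 (a : R) : lower a 1 0 = a := rfl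
@[simp] theorem lower_11 (a : R) : lower a 1 1 = 1 := rfl
@[simp] theorem torus_00 (x : Rˣ) : torus x 0 0 = (x : R) := rfl
@[simp] theorem torus_01 (x : Rˣ) : torus x 0 1 = 0 := rfl
@[simp] theorem torus_10 (x : Rˣ) : torus x 1 0 = 0 := rfl
@[simp] theorem torus_11 (x : Rˣ) : torus x 1 1 = ((x⁻¹ : Rˣ) : R) := rfl
@[simp] theorem weyl_00 : weyl R 0 0 = 0 := rfl
@[simp] theorem weyl_01 : weyl R 0 1 = 1 := rfl
@[simp] theorem weyl_10 : weyl R 1 0 = -1 := rfl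
@[simp] theorem weyl_11 : weyl R 1 1 = 0 := rfl

end Entries

theorem upper_mul (a b : R) : upper a * upper b = upper (a + b) := by
  apply sl_ext <;> simp [sl_mul_apply, add_comm]

theorem upper_zero : upper (0 : R) = 1 := by
  apply sl_ext <;> simp

theorem lower_zero : lower (0 : R) = 1 := by
  apply sl_ext <;> simp

theorem lower_mul (a b : R) : lower a * lower b = lower (a + b) := by
  apply sl_ext <;> simp [sl_mul_apply]

theorem torus_mul (x y : Rˣ) : torus x * torus y = torus (x * y) := by
  apply sl_ext <;> simp [sl_mul_apply, mul_comm]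

theorem torus_one : torus (1 : Rˣ) = 1 := by
  apply sl_ext <;> simp

theorem torus_mul_upper (x : Rˣ) (a : R) :
    torus x * upper a = upper (x * x * a) * torus x := by
  apply sl_ext <;> simp [sl_mul_apply]
  linear_combination (-(x * a)) * x.mul_inv

theorem torus_mul_lower (x : Rˣ) (b : R) :
    torus x * lower (x * x * b) = lower b * torus x := by
  apply sl_ext <;> simp [sl_mul_apply]
  rw [mul_assoc, Units.inv_mul_cancel_left, mul_comm]

theorem weyl_mul_lower (b : R) : weyl R * lower b = upper (-b) * weyl R := by
  apply sl_ext <;> simp [sl_mul_apply]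

theorem weyl_mul_upper (a : R) : weyl R * upper a = lower (-a) * weyl R := by
  apply sl_ext <;> simp [sl_mul_apply]

theorem weyl_mul_torus (x : Rˣ) : weyl R * torus x = torus x⁻¹ * weyl R := by
  apply sl_ext <;> simp [sl_mul_apply]

theorem weyl_mul_upper_unit (a : Rˣ) :
    weyl R * upper (a : R) =
      upper ((-a⁻¹ : Rˣ) : R) * torus (-a⁻¹) * lower ((a⁻¹ : Rˣ) : R) := by
  apply sl_ext <;> simp [sl_mul_apply]

theorem lower_mul_upper_unit (a b : R) (d : Rˣ) (hd : (d : R) = 1 + a * b) :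
    lower b * upper a =
      upper (a * (d⁻¹ : Rˣ)) * torus d⁻¹ * lower (b * (d⁻¹ : Rˣ)) := by
  have h1 : a * b = d - 1 := by rw [hd]; ring
  have h2 : (d : R) * ((d⁻¹ : Rˣ) : R) = 1 := d.mul_inv
  apply sl_ext <;> simp [sl_mul_apply]
  · linear_combination ((d⁻¹ : Rˣ) : R) * (-h1) - h2
  · linear_combination (-b) * h2
  · linear_combination -hd

/-- The case 1 + ab = 0 which `lower_mul_upper_unit` leaves out: the product falls outside the open
cell (upper)(torus)(lower). -/
theorem lower_mul_upper_of_eq (a : Rˣ) :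
    lower ((-a⁻¹ : Rˣ) : R) * upper (a : R) =
      weyl R * torus a⁻¹ * lower ((a⁻¹ : Rˣ) : R) := by
  apply sl_ext <;> simp [sl_mul_apply]

end Elements
end SL2Tree

namespace SL2Tree

/-! ### Representations of `SL₂(𝔽_p)` generated by unipotent invariants -/

section Finite

variable {p : ℕ} [Fact p.Prime] {V : Type*} [AddCommGroup V] [Module (ZMod p) V]
variable (ρ : Representation (ZMod p) (Matrix.SpecialLinearGroup (Fin 2) (ZMod p)) V)

/-- The divided powers of the logarithm of the upper triangular unipotent group. -/
def opE (i : ℕ) : Module.End (ZMod p) V := coef i fun a => ρ (upper a)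

/-- The divided powers of the logarithm of the lower triangular unipotent group. -/
def opF (i : ℕ) : Module.End (ZMod p) V := coef i fun a => ρ (lower a)

theorem rho_upper (a : ZMod p) (w : V) :
    ρ (upper a) w = ∑ i ∈ Finset.range p, a ^ i • opE ρ i w := by
  rw [← sum_coef (fun a => ρ (upper a)) a, LinearMap.sum_apply]
  rfl

theorem rho_mul (g h : Matrix.SpecialLinearGroup (Fin 2) (ZMod p)) (w : V) :
    ρ g (ρ h w) = ρ (g * h) w := by rw [map_mul]; rfl

theorem opE_zero (w : V) : opE ρ 0 w = w := by
  have h := rho_upper ρ 0 w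
  rw [upper_zero, map_one, Finset.sum_eq_single_of_mem 0
    (Finset.mem_range.mpr (Fact.out : p.Prime).pos) (fun i _ hi => by simp [hi])] at h
  simpa using h.symm

theorem sum_range_shift {M : Type*} [AddCommMonoid M] (n m : ℕ) (g : ℕ → M)
    (hg : ∀ i < n, n ≤ i + m → g i = 0) :
    ∑ i ∈ Finset.range n, g i = ∑ j ∈ Finset.range n, if m ≤ j then g (j - m) else 0 := by
  rw [← Finset.sum_filter, ← Finset.sum_filter_of_ne (p := fun i => i + m < n)
    (fun i h' hi => not_le.mp fun h => hi (hg i (Finset.mem_range.mp h') h))]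
  refine Finset.sum_nbij' (fun i => i + m) (fun j => j - m) ?_ ?_ ?_ ?_ ?_
  all_goals
    intro i hi
    simp only [Finset.mem_filter, Finset.mem_range] at hi ⊢
  · omega
  · omega
  · omega
  · omega
  · rw [Nat.add_sub_cancel]

/-- Compare the coefficients of a^i in the identity for upper(b) upper(a) = upper(a + b). Terms with
j < i vanish, so `ρ (upper b) - 1` strictly raises the index. -/
theorem rho_upper_opE (b : ZMod p) {i : ℕ} (hi : i < p) (w : V) :
    ρ (upper b) (opE ρ i w) =
      ∑ j ∈ Finset.range p, ((j.choose i : ZMod p) * b ^ (j - i)) • opE ρ j w := by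
  refine eq_of_sum_pow (v := fun i => ρ (upper b) (opE ρ i w))
    (v' := fun i => ∑ j ∈ Finset.range p, ((j.choose i : ZMod p) * b ^ (j - i)) • opE ρ j w)
    (fun a => ?_) hi
  have h1 : ρ (upper b) (ρ (upper a) w) = ρ (upper (a + b)) w := by
    rw [rho_mul, upper_mul, add_comm]
  rw [rho_upper ρ a, rho_upper ρ (a + b), map_sum] at h1
  simp only [map_smul] at h1
  rw [h1]
  simp only [Finset.smul_sum, smul_smul]
  rw [Finset.sum_comm]
  refine Finset.sum_congr rfl fun j hj => ?_
  rw [← Finset.sum_smul]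
  congr 1
  rw [add_pow]
  have hj' := Finset.mem_range.mp hj
  rw [Finset.sum_subset (Finset.range_subset_range.mpr (show j + 1 ≤ p by omega))]
  · exact Finset.sum_congr rfl fun i _ => by ring
  · intro i _ hi
    rw [Nat.choose_eq_zero_of_lt (by simpa using hi)]
    simp

/-- The vectors which are fixed by the lower triangular unipotent group. -/
def lowerInv : Submodule (ZMod p) V where
  carrier := {w | ∀ b, ρ (lower b) w = w}
  add_mem' hv hw b := by rw [map_add, hv b, hw b]
  zero_mem' b := map_zero _
  smul_mem' c w hw b := by rw [map_smul, hw b]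

/-- The vectors in `lowerInv ρ` of weight `-r` under the diagonal torus. -/
def weightSpace (r : ℕ) : Submodule (ZMod p) V where
  carrier := {w | w ∈ lowerInv ρ ∧ ∀ x : (ZMod p)ˣ, ρ (torus x) w = ((x⁻¹ : (ZMod p)ˣ) : ZMod p) ^ r • w}
  add_mem' hv hw := ⟨add_mem hv.1 hw.1, fun x => by rw [map_add, hv.2 x, hw.2 x, smul_add]⟩
  zero_mem' := ⟨zero_mem _, fun x => by rw [map_zero, smul_zero]⟩
  smul_mem' c w hw := ⟨Submodule.smul_mem _ c hw.1, fun x => by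
    rw [map_smul, hw.2 x, smul_comm]⟩

/-- The vectors which generate a quotient of a multiple of the `r`-th symmetric power of the
standard representation, as a lowest weight vector. -/
def lowest (r : ℕ) : Submodule (ZMod p) V where
  carrier := {w | w ∈ weightSpace ρ r ∧ (∀ i, r < i → i < p → opE ρ i w = 0) ∧
    ρ (weyl _) w = opE ρ r w}
  add_mem' hv hw := ⟨add_mem hv.1 hw.1, fun i h h' => by
    rw [map_add, hv.2.1 i h h', hw.2.1 i h h', add_zero], by
    rw [map_add, map_add, hv.2.2, hw.2.2]⟩
  zero_mem' := ⟨zero_mem _, fun i _ _ => map_zero _, by rw [map_zero, map_zero]⟩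
  smul_mem' c w hw := ⟨Submodule.smul_mem _ c hw.1, fun i h h' => by
    rw [map_smul, hw.2.1 i h h', smul_zero], by
    rw [map_smul, map_smul, hw.2.2]⟩

variable {ρ}

/-- The formula that holds in Sym^r. For d = 1 + ab ≠ 0 it follows from the decomposition in the
open cell, for d = 0 from the Weyl condition in `lowest`. The truncated exponent r - i does no harm,
since the i-th term is zero for i > r. -/
theorem rho_lower_upper_of_lowest {r : ℕ} (hr : r < p) {w : V} (hw : w ∈ lowest ρ r)
    (a b : ZMod p) :
    ρ (lower b) (ρ (upper a) w) =
      ∑ i ∈ Finset.range p, (a ^ i * (1 + a * b) ^ (r - i)) • opE ρ i w := by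
  obtain ⟨⟨hl, ht⟩, hE, hs⟩ := hw
  rw [rho_mul]
  by_cases hd : 1 + a * b = 0
  · have ha : a ≠ 0 := by rintro rfl; simp at hd
    have hb : b = ((-(Units.mk0 a ha)⁻¹ : (ZMod p)ˣ) : ZMod p) := by
      simp only [Units.val_neg, Units.val_inv_eq_inv_val, Units.val_mk0]
      field_simp
      linear_combination hd
    have h1 := lower_mul_upper_of_eq (Units.mk0 a ha)
    rw [← hb, Units.val_mk0] at h1
    rw [h1, map_mul, map_mul, Module.End.mul_apply, Module.End.mul_apply, hl, ht, map_smul, hs,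
      Finset.sum_eq_single_of_mem r (Finset.mem_range.mpr hr)]
    · simp
    · intro i hi hir
      rcases lt_or_gt_of_ne hir with h | h
      · rw [hd, zero_pow (by omega), mul_zero, zero_smul]
      · rw [hE i h (Finset.mem_range.mp hi), smul_zero]
  · have h1 := lower_mul_upper_unit a b (Units.mk0 _ hd) (Units.val_mk0 _)
    rw [h1, map_mul, map_mul, Module.End.mul_apply, Module.End.mul_apply, hl, ht, map_smul,
      rho_upper, Finset.smul_sum]
    refine Finset.sum_congr rfl fun i hi => ?_
    rw [smul_smul]
    rcases le_or_gt i r with h | h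
    · congr 1
      simp only [inv_inv, Units.val_mk0, Units.val_inv_eq_inv_val]
      rw [mul_pow, inv_pow, mul_left_comm]
      congr 1
      rw [← div_eq_mul_inv, pow_sub₀ _ hd h, div_eq_mul_inv]
    · rw [hE i h (Finset.mem_range.mp hi), smul_zero, smul_zero]

/-- Expand (1 + ab)^(r-i) and compare the coefficients of a^j in the previous formula; the index
shift i = j - m is what `sum_range_shift` provides. -/
theorem rho_lower_opE_of_lowest {r : ℕ} (hr : r < p) {w : V} (hw : w ∈ lowest ρ r)
    (b : ZMod p) {j : ℕ} (hj : j < p) :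
    ρ (lower b) (opE ρ j w) = ∑ m ∈ Finset.range p,
      b ^ m • (if m ≤ j then ((r - (j - m)).choose m : ZMod p) • opE ρ (j - m) w else 0) := by
  refine eq_of_sum_pow (v := fun j => ρ (lower b) (opE ρ j w))
    (v' := fun j => ∑ m ∈ Finset.range p,
      b ^ m • (if m ≤ j then ((r - (j - m)).choose m : ZMod p) • opE ρ (j - m) w else 0))
    (fun a => ?_) hj
  have h1 := rho_lower_upper_of_lowest hr hw a b
  rw [rho_upper, map_sum] at h1
  simp only [map_smul] at h1
  rw [h1]
  simp only [Finset.smul_sum]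
  rw [Finset.sum_comm (s := Finset.range p) (t := Finset.range p)]
  have h2 : ∀ m ∈ Finset.range p, ∑ i ∈ Finset.range p,
      a ^ i • b ^ m • (if m ≤ i then ((r - (i - m)).choose m : ZMod p) • opE ρ (i - m) w else 0)
      = ∑ i ∈ Finset.range p, (a ^ (i + m) * b ^ m * ((r - i).choose m : ZMod p)) • opE ρ i w := by
    intro m _
    rw [sum_range_shift p m
      (fun i => (a ^ (i + m) * b ^ m * ((r - i).choose m : ZMod p)) • opE ρ i w)]
    · refine Finset.sum_congr rfl fun i _ => ?_
      split_ifs with h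
      · rw [smul_smul, smul_smul, Nat.sub_add_cancel h, mul_assoc]
      · rw [smul_zero, smul_zero]
    · intro i hi hm
      rw [Nat.choose_eq_zero_of_lt (by omega)]
      simp
  rw [Finset.sum_congr rfl h2, Finset.sum_comm]
  refine Finset.sum_congr rfl fun i hi => ?_
  rw [← Finset.sum_smul]
  by_cases hir : r < i
  · rw [hw.2.1 i hir (Finset.mem_range.mp hi), smul_zero, smul_zero]
  congr 1
  rw [add_comm (1 : ZMod p), add_pow, Finset.mul_sum]
  rw [Finset.sum_subset (Finset.range_subset_range.mpr (show r - i + 1 ≤ p by omega))]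
  · refine Finset.sum_congr rfl fun m _ => ?_
    rw [pow_add, mul_pow]
    ring
  · intro m _ hm
    rw [Nat.choose_eq_zero_of_lt (by simpa using hm)]
    simp

end Finite
end SL2Tree

namespace SL2Tree

/-! ### Lowest weight vectors of the various types generate a direct sum of symmetric powers -/

section FiniteIndependence

variable {p : ℕ} [Fact p.Prime] {V : Type*} [AddCommGroup V] [Module (ZMod p) V]
variable {ρ : Representation (ZMod p) (Matrix.SpecialLinearGroup (Fin 2) (ZMod p)) V}

theorem opF_opE {r : ℕ} (hr : r < p) {w : V} (hw : w ∈ lowest ρ r) {i j : ℕ} (hi : i < p)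
    (hj : j < p) : opF ρ i (opE ρ j w) =
      if i ≤ j then ((r - (j - i)).choose i : ZMod p) • opE ρ (j - i) w else 0 := by
  rw [opF, coef_apply]
  exact coef_eq (fun b => rho_lower_opE_of_lowest hr hw b hj) hi

theorem opF_lowerInv {w : V} (hw : w ∈ lowerInv ρ) {i : ℕ} (hi : i < p) (h0 : i ≠ 0) :
    opF ρ i w = 0 := by
  rw [opF, coef_apply]
  refine (coef_eq (v := fun j => if j = 0 then w else 0) (fun b => ?_) hi).trans (if_neg h0)
  rw [Finset.sum_eq_single_of_mem 0 (Finset.mem_range.mpr (Fact.out : p.Prime).pos)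
    (fun i _ hi => by simp [hi]), hw b]
  simp

variable (ρ) in
/-- Minus the projection onto the weight `-r`. -/
def negWeightProj (r : ℕ) : Module.End (ZMod p) V :=
  ∑ x : (ZMod p)ˣ, (x : ZMod p) ^ r • ρ (torus x)

theorem negWeightProj_apply {r r' : ℕ} (hr' : r' ≤ p - 1) {w : V}
    (hw : w ∈ weightSpace ρ r') :
    negWeightProj ρ r w = if p - 1 ∣ r + (p - 1 - r') then -w else 0 := by
  have h : ∀ x : (ZMod p)ˣ, (x : ZMod p) ^ r • ρ (torus x) w =
      ((x ^ (r + (p - 1 - r')) : (ZMod p)ˣ) : ZMod p) • w := by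
    intro x
    rw [hw.2, smul_smul]
    congr 1
    rw [pow_add, Units.val_mul, Units.val_pow_eq_pow_val, Units.val_pow_eq_pow_val]
    congr 1
    rw [Units.val_inv_eq_inv_val, inv_pow, pow_sub₀ _ x.ne_zero hr',
      ZMod.pow_card_sub_one_eq_one x.ne_zero, one_mul]
  have h2 := FiniteField.sum_pow_units (ZMod p) (r + (p - 1 - r'))
  rw [ZMod.card] at h2
  rw [negWeightProj, LinearMap.sum_apply]
  simp only [LinearMap.smul_apply, h]
  simp only [Units.val_pow_eq_pow_val]
  rw [← Finset.sum_smul, h2]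
  split_ifs <;> simp

/-- The types 0 and p - 1 have the same torus weight; the Weyl element separates them, since it
would send w to `opE ρ (p - 1) w`, which is 0 in type 0. -/
theorem lowest_inter {w : V} (h : w ∈ lowest ρ 0) (h' : w ∈ lowest ρ (p - 1)) : w = 0 := by
  have hp := (Fact.out : p.Prime).two_le
  have h1 := h'.2.2
  rw [h.2.1 (p - 1) (by omega) (by omega)] at h1
  have h2 : ρ ((weyl (ZMod p))⁻¹) (ρ (weyl _) w) = w := by
    rw [rho_mul, inv_mul_cancel, map_one]; rfl
  rw [← h2, h1, map_zero]

/-- Torus weights only depend on r modulo p - 1. They isolate every 0 < r < p - 1 and leave the pair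
0, p - 1 to `lowest_inter`. -/
theorem lowest_independent {c : ℕ → V} (hc : ∀ r, c r ∈ lowest ρ r)
    (h : ∑ r ∈ Finset.range p, c r = 0) {r : ℕ} (hr : r < p) : c r = 0 := by
  have hp := (Fact.out : p.Prime).two_le
  have key : ∀ s, 0 < s → s < p - 1 → c s = 0 := by
    intro s h0 hs
    have h1 := congrArg (negWeightProj ρ s) h
    rw [map_sum, map_zero, Finset.sum_eq_single_of_mem s (Finset.mem_range.mpr (by omega))] at h1
    · rw [negWeightProj_apply (by omega) (hc s).1, if_pos ⟨1, by omega⟩] at h1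
      exact neg_eq_zero.mp h1
    · intro t ht hts
      have ht' := Finset.mem_range.mp ht
      rw [negWeightProj_apply (by omega) (hc t).1, if_neg]
      rintro ⟨d, hd⟩
      rcases Nat.lt_or_ge d 2 with h2 | h2
      · interval_cases d <;> omega
      · have : (p - 1) * 2 ≤ (p - 1) * d := Nat.mul_le_mul_left _ h2
        omega
  have h2 : c 0 + c (p - 1) = 0 := by
    rw [← h, ← Finset.sum_subset (s₁ := {0, p - 1})]
    · rw [Finset.sum_pair (by omega)]
    · intro i hi
      simp only [Finset.mem_insert, Finset.mem_singleton] at hi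
      exact Finset.mem_range.mpr (by omega)
    · intro i hi hi'
      simp only [Finset.mem_insert, Finset.mem_singleton, not_or] at hi'
      have := Finset.mem_range.mp hi
      exact key i (by omega) (by omega)
  have h3 : c 0 = 0 := lowest_inter (hc 0) (by
    rw [eq_neg_of_add_eq_zero_left h2]; exact neg_mem (hc _))
  rcases Nat.eq_zero_or_pos r with rfl | h0
  · exact h3
  rcases Nat.lt_or_ge r (p - 1) with h4 | h4
  · exact key r h0 h4
  · rw [h3, zero_add] at h2
    rwa [show r = p - 1 by omega]

theorem choose_ne_zero_zmod {r i : ℕ} (hr : r < p) (hi : i ≤ r) : (r.choose i : ZMod p) ≠ 0 := by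
  intro h
  rw [ZMod.natCast_eq_zero_iff] at h
  have h1 : p ∣ r.factorial := by
    rw [← Nat.choose_mul_factorial_mul_factorial hi]
    exact (h.mul_right _).mul_right _
  exact absurd ((Nat.Prime.dvd_factorial Fact.out).mp h1) (not_le.mpr hr)

variable (ρ) in
/-- The vector with a given family of coordinates. -/
def expand (w : ℕ → ℕ → V) : V :=
  ∑ r ∈ Finset.range p, ∑ i ∈ Finset.range p, opE ρ i (w i r)

theorem expand_add (w w' : ℕ → ℕ → V) :
    expand ρ (fun i r => w i r + w' i r) = expand ρ w + expand ρ w' := by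
  simp only [expand, map_add, Finset.sum_add_distrib]

theorem expand_sub (w w' : ℕ → ℕ → V) :
    expand ρ (fun i r => w i r - w' i r) = expand ρ w - expand ρ w' := by
  simp only [expand, map_sub, Finset.sum_sub_distrib]

theorem expand_smul (c : ZMod p) (w : ℕ → ℕ → V) :
    expand ρ (fun i r => c • w i r) = c • expand ρ w := by
  simp only [expand, map_smul, Finset.smul_sum]

theorem expand_single {i r : ℕ} (hi : i < p) (hr : r < p) (w : V) :
    expand ρ (fun j s => if j = i ∧ s = r then w else 0) = opE ρ i w := by
  rw [expand, Finset.sum_eq_single_of_mem r (Finset.mem_range.mpr hr)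
    (fun s _ hs => Finset.sum_eq_zero fun j _ => by simp [hs]),
    Finset.sum_eq_single_of_mem i (Finset.mem_range.mpr hi) (fun j _ hj => by simp [hj])]
  simp

/-- The operator `opF ρ i` kills the terms of index below i and multiplies the lowest weight vector
by a binomial coefficient on those of index i, so it reads off the top coordinates. -/
theorem opF_expand {w : ℕ → ℕ → V} (hw : ∀ i r, w i r ∈ lowest ρ r) {i : ℕ} (hi : i < p)
    (hmax : ∀ j r, i < j → r < p → j < p → w j r = 0) :
    opF ρ i (expand ρ w) = ∑ r ∈ Finset.range p, (r.choose i : ZMod p) • w i r := by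
  rw [expand, map_sum]
  refine Finset.sum_congr rfl fun r hr => ?_
  rw [map_sum, Finset.sum_eq_single_of_mem i (Finset.mem_range.mpr hi)]
  · rw [opF_opE (Finset.mem_range.mp hr) (hw i r) hi hi, if_pos le_rfl, Nat.sub_self, Nat.sub_zero,
      opE_zero]
  · intro j hj hji
    rcases lt_or_gt_of_ne hji with h | h
    · rw [opF_opE (Finset.mem_range.mp hr) (hw j r) hi (Finset.mem_range.mp hj),
        if_neg (not_le.mpr h)]
    · rw [hmax j r h (Finset.mem_range.mp hr) (Finset.mem_range.mp hj), map_zero, map_zero]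

/-- Descending induction on i, top coordinates first; r choose i is nonzero modulo p because r < p.
With n = 0 this is uniqueness of coordinates, with n = 1 it describes the invariants of the lower
unipotent group. -/
theorem eq_zero_of_opF_expand {w : ℕ → ℕ → V} (hw : ∀ i r, w i r ∈ lowest ρ r)
    (hlow : ∀ i r, r < i → w i r = 0) {n : ℕ}
    (h : ∀ i, n ≤ i → i < p → opF ρ i (expand ρ w) = 0) {i r : ℕ} (hn : n ≤ i) (hi : i < p)
    (hr : r < p) : w i r = 0 := by
  induction hk : p - i using Nat.strong_induction_on generalizing i r with
  | _ k ih =>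
    have h1 := h i hn hi
    rw [opF_expand hw hi (fun j s hij hs hj => ih (p - j) (by omega) (by omega) hj hs rfl)] at h1
    have h2 := lowest_independent
      (fun r => Submodule.smul_mem _ ((r.choose i : ZMod p)) (hw i r)) h1 hr
    rcases Nat.lt_or_ge r i with h3 | h3
    · exact hlow i r h3
    · exact (smul_eq_zero.mp h2).resolve_left (choose_ne_zero_zmod hr h3)

theorem expand_injective {w : ℕ → ℕ → V} (hw : ∀ i r, w i r ∈ lowest ρ r)
    (hlow : ∀ i r, r < i → w i r = 0) (h : expand ρ w = 0) {i r : ℕ} (hi : i < p)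
    (hr : r < p) : w i r = 0 :=
  eq_zero_of_opF_expand hw hlow (n := 0) (fun i _ _ => by rw [h, map_zero]) (Nat.zero_le _) hi hr

variable (ρ) in
/-- The submodule generated by lowest weight vectors in the given spaces. -/
def expandSpan (C : ℕ → Submodule (ZMod p) V) : Submodule (ZMod p) V where
  carrier := {x | ∃ w : ℕ → ℕ → V, (∀ i r, w i r ∈ C r) ∧ (∀ i r, r < i → w i r = 0) ∧
    expand ρ w = x}
  add_mem' := by
    rintro _ _ ⟨w, h1, h2, rfl⟩ ⟨w', h1', h2', rfl⟩
    exact ⟨fun i r => w i r + w' i r, fun i r => add_mem (h1 i r) (h1' i r),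
      fun i r h => by simp only [h2 i r h, h2' i r h, add_zero], expand_add w w'⟩
  zero_mem' := ⟨fun _ _ => 0, fun _ _ => zero_mem _, fun _ _ _ => rfl, by simp [expand]⟩
  smul_mem' := by
    rintro c _ ⟨w, h1, h2, rfl⟩
    exact ⟨fun i r => c • w i r, fun i r => Submodule.smul_mem _ c (h1 i r),
      fun i r h => by simp only [h2 i r h, smul_zero], expand_smul c w⟩

variable {C : ℕ → Submodule (ZMod p) V}

theorem opE_mem_expandSpan (hC : ∀ r, C r ≤ lowest ρ r) {i r : ℕ} (hi : i < p) (hr : r < p)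
    {w : V} (hw : w ∈ C r) : opE ρ i w ∈ expandSpan ρ C := by
  rcases Nat.lt_or_ge r i with h | h
  · rw [(hC r hw).2.1 i h hi]
    exact zero_mem _
  · refine ⟨_, fun j s => ?_, fun j s hjs => ?_, expand_single hi hr w⟩
    · split_ifs with h1
      · rw [h1.2]; exact hw
      · exact zero_mem _
    · rw [if_neg]
      rintro ⟨rfl, rfl⟩
      omega

theorem expandSpan_induction (P : Submodule (ZMod p) V)
    (h : ∀ i r w, i < p → r < p → w ∈ C r → opE ρ i w ∈ P) : expandSpan ρ C ≤ P := by
  rintro _ ⟨w, h1, -, rfl⟩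
  exact sum_mem fun r hr => sum_mem fun i hi =>
    h i r _ (Finset.mem_range.mp hi) (Finset.mem_range.mp hr) (h1 i r)

/-- A matrix with nonzero lower left entry is upper·lower·upper. Otherwise multiplication by `lower
1` first makes this entry nonzero. -/
theorem sl2_eq (g : Matrix.SpecialLinearGroup (Fin 2) (ZMod p)) :
    ∃ a b c d : ZMod p, g = lower a * (upper b * (lower c * upper d)) := by
  have key : ∀ g : Matrix.SpecialLinearGroup (Fin 2) (ZMod p), g 1 0 ≠ 0 →
      ∃ b c d : ZMod p, g = upper b * (lower c * upper d) := by
    intro g hg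
    have hdet := g.det_coe
    rw [Matrix.det_fin_two] at hdet
    refine ⟨(g 0 0 - 1) / g 1 0, g 1 0, (g 1 1 - 1) / g 1 0, ?_⟩
    apply sl_ext <;> simp [sl_mul_apply] <;> field_simp
    · ring
    · linear_combination -hdet
    · ring
  by_cases hg : g 1 0 = 0
  · obtain ⟨b, c, d, h⟩ := key (lower 1 * g) (by
      have hdet := g.det_coe
      rw [Matrix.det_fin_two, hg] at hdet
      simp only [sl_mul_apply, lower_10, lower_11, hg]
      intro h
      simp at h
      simp [h] at hdet)
    refine ⟨-1, b, c, d, ?_⟩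
    rw [← h, ← mul_assoc, lower_mul, neg_add_cancel, lower_zero, one_mul]
  · obtain ⟨b, c, d, h⟩ := key g hg
    exact ⟨0, b, c, d, by rw [lower_zero, one_mul]; exact h⟩

theorem expandSpan_stable (hC : ∀ r, C r ≤ lowest ρ r)
    (g : Matrix.SpecialLinearGroup (Fin 2) (ZMod p)) :
    expandSpan ρ C ≤ (expandSpan ρ C).comap (ρ g) := by
  have hu : ∀ a, expandSpan ρ C ≤ (expandSpan ρ C).comap (ρ (upper a)) := fun a =>
    expandSpan_induction _ fun i r w hi hr hw => by
      rw [Submodule.mem_comap, rho_upper_opE ρ a hi]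
      exact sum_mem fun j hj => Submodule.smul_mem _ _
        (opE_mem_expandSpan hC (Finset.mem_range.mp hj) hr hw)
  have hl : ∀ a, expandSpan ρ C ≤ (expandSpan ρ C).comap (ρ (lower a)) := fun a =>
    expandSpan_induction _ fun i r w hi hr hw => by
      rw [Submodule.mem_comap, rho_lower_opE_of_lowest hr (hC r hw) a hi]
      refine sum_mem fun j hj => Submodule.smul_mem _ _ ?_
      split_ifs
      · exact Submodule.smul_mem _ _ (opE_mem_expandSpan hC (by omega) hr hw)
      · exact zero_mem _
  obtain ⟨a, b, c, d, rfl⟩ := sl2_eq g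
  intro x hx
  rw [Submodule.mem_comap, ← rho_mul, ← rho_mul, ← rho_mul]
  exact hl a (hu b (hl c (hu d hx)))

/-- On a sum of symmetric powers, `ρ (upper 1) - 1` raises the index, so its image has no component
of index 0 and y vanishes. Its kernel is spanned by the vectors of top index i = r, which are Weyl
translates of lowest weight vectors. -/
theorem expand_of_diff (hC : ∀ r, C r ≤ lowest ρ r) {w : ℕ → ℕ → V}
    (hw : ∀ i r, w i r ∈ C r) (hlow : ∀ i r, r < i → w i r = 0) {y : ℕ → V}
    (hy : ∀ r, y r ∈ C r)
    (h : ρ (upper 1) (expand ρ w) - expand ρ w = ∑ r ∈ Finset.range p, y r) :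
    (∀ r < p, y r = 0) ∧ expand ρ w = ρ (weyl _) (∑ r ∈ Finset.range p, w r r) := by
  have hp := (Fact.out : p.Prime).two_le
  -- The coordinates of the translate by `upper 1`, cut off at j ≤ r; the omitted ones multiply zero
  -- vectors, and uniqueness of coordinates needs the cut.
  let w1 : ℕ → ℕ → V := fun j r =>
    if j ≤ r then ∑ i ∈ Finset.range p, (j.choose i : ZMod p) • w i r else 0
  let w2 : ℕ → ℕ → V := fun j r => if j = 0 then y r else 0
  have e1 : ρ (upper 1) (expand ρ w) = expand ρ w1 := by
    rw [expand, expand, map_sum]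
    refine Finset.sum_congr rfl fun r hr => ?_
    rw [map_sum, Finset.sum_congr rfl (fun i hi => rho_upper_opE ρ 1 (Finset.mem_range.mp hi) _),
      Finset.sum_comm]
    refine Finset.sum_congr rfl fun j hj => ?_
    simp only [w1]
    split_ifs with hjr
    · rw [map_sum]
      simp
    · rw [map_zero]
      refine Finset.sum_eq_zero fun i hi => ?_
      rw [(hC r (hw i r)).2.1 j (not_le.mp hjr) (Finset.mem_range.mp hj), smul_zero]
  have e2 : ∑ r ∈ Finset.range p, y r = expand ρ w2 := by
    rw [expand]
    refine Finset.sum_congr rfl fun r hr => ?_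
    rw [Finset.sum_eq_single_of_mem 0 (Finset.mem_range.mpr (by omega))
      (fun i _ hi => by simp [w2, hi])]
    simp [w2, opE_zero]
  rw [e1, e2, ← sub_eq_zero, ← expand_sub, ← expand_sub] at h
  have hsum : ∀ j r : ℕ, ∑ i ∈ Finset.range p, (j.choose i : ZMod p) • w i r ∈ C r := fun j r =>
    sum_mem fun i _ => Submodule.smul_mem _ _ (hw i r)
  have key : ∀ j < p, ∀ r < p, w1 j r - w j r - w2 j r = 0 := fun j hj r hr =>
    expand_injective (ρ := ρ) (w := fun j r => w1 j r - w j r - w2 j r)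
      (fun i r => hC r (sub_mem (sub_mem (by
        simp only [w1]; split_ifs; exacts [hsum i r, zero_mem _]) (hw i r)) (by
        simp only [w2]; split_ifs; exacts [hy r, zero_mem _])))
      (fun i r hri => by
        have : i ≠ 0 := by omega
        simp [w1, w2, hlow i r hri, not_le.mpr hri, this]) h hj hr
  refine ⟨fun r hr => ?_, ?_⟩
  · have h0 := key 0 (by omega) r hr
    simp only [w1, w2, Nat.zero_le, if_true] at h0
    rw [Finset.sum_eq_single_of_mem 0 (Finset.mem_range.mpr (by omega))
      (fun i _ hi => by rw [Nat.choose_eq_zero_of_lt (Nat.pos_of_ne_zero hi)]; simp)] at h0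
    simpa using h0
  -- Once the coordinates below i vanish, the component of index i + 1 of the difference is (i + 1)
  -- times `w i r`, and i + 1 ≤ r < p is invertible.
  · have hz : ∀ i r, r < p → i < r → w i r = 0 := by
      intro i
      induction i using Nat.strong_induction_on with
      | _ i ih =>
        intro r hr hir
        have h0 := key (i + 1) (by omega) r hr
        simp only [w1, w2, if_pos (show i + 1 ≤ r from hir), Nat.succ_ne_zero, if_false,
          sub_zero] at h0
        rw [← Finset.sum_subset (s₁ := {i, i + 1})] at h0
        · rw [Finset.sum_pair (by omega), Nat.choose_succ_self_right, Nat.choose_self,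
            Nat.cast_one, one_smul, add_sub_cancel_right] at h0
          refine (smul_eq_zero.mp h0).resolve_left ?_
          intro hd
          rw [ZMod.natCast_eq_zero_iff] at hd
          exact absurd (Nat.le_of_dvd (by omega) hd) (by omega)
        · intro j hj
          simp only [Finset.mem_insert, Finset.mem_singleton] at hj
          exact Finset.mem_range.mpr (by omega)
        · intro j _ hj
          simp only [Finset.mem_insert, Finset.mem_singleton, not_or] at hj
          rcases Nat.lt_or_ge j i with h1 | h1
          · rw [ih j h1 r hr (by omega), smul_zero]
          · rw [Nat.choose_eq_zero_of_lt (by omega), Nat.cast_zero, zero_smul]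
    rw [expand, map_sum]
    refine Finset.sum_congr rfl fun r hr => ?_
    have hr' := Finset.mem_range.mp hr
    rw [Finset.sum_eq_single_of_mem r hr, (hC r (hw r r)).2.2]
    intro i _ hir
    rcases lt_or_gt_of_ne hir with h1 | h1
    · rw [hz i r hr' h1, map_zero]
    · rw [hlow i r h1, map_zero]

end FiniteIndependence
end SL2Tree

namespace SL2Tree

/-! ### The Hecke operator and the two-step filtration by symmetric powers -/

section FiniteMain

variable {p : ℕ} [Fact p.Prime] {V : Type*} [AddCommGroup V] [Module (ZMod p) V]
variable (ρ : Representation (ZMod p) (Matrix.SpecialLinearGroup (Fin 2) (ZMod p)) V)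

theorem sum_zmod_eq {M : Type*} [AddCommMonoid M] (g : ZMod p → M) :
    ∑ c, g c = g 0 + ∑ x : (ZMod p)ˣ, g x := by
  rw [← Finset.add_sum_erase _ _ (Finset.mem_univ (0 : ZMod p))]
  congr 1
  refine (Finset.sum_bij' (fun (x : (ZMod p)ˣ) _ => (x : ZMod p))
    (fun c hc => Units.mk0 c (Finset.ne_of_mem_erase hc)) ?_ ?_ ?_ ?_ ?_).symm
  · exact fun x _ => Finset.mem_erase.mpr ⟨x.ne_zero, Finset.mem_univ _⟩
  · exact fun _ _ => Finset.mem_univ _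
  · exact fun x _ => Units.ext rfl
  · exact fun _ _ => rfl
  · exact fun _ _ => rfl

/-- The norm of the upper triangular unipotent group. -/
def upperNorm : Module.End (ZMod p) V := ∑ a : ZMod p, ρ (upper a)

/-- The Hecke operator attached to the Weyl element. -/
def hecke : Module.End (ZMod p) V := ρ (weyl _) * upperNorm ρ

theorem hecke_apply (w : V) : hecke ρ w = ρ (weyl _) (upperNorm ρ w) := rfl

theorem upperNorm_apply (w : V) : upperNorm ρ w = ∑ a : ZMod p, ρ (upper a) w := by
  rw [upperNorm, LinearMap.sum_apply]

theorem upper_upperNorm (b : ZMod p) (w : V) : ρ (upper b) (upperNorm ρ w) = upperNorm ρ w := by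
  rw [upperNorm_apply, map_sum]
  simp only [rho_mul, upper_mul]
  exact Fintype.sum_equiv (Equiv.addLeft b) _ _ fun a => rfl

theorem upperNorm_upper (b : ZMod p) (w : V) : upperNorm ρ (ρ (upper b) w) = upperNorm ρ w := by
  simp only [upperNorm_apply, rho_mul, upper_mul]
  exact Fintype.sum_equiv (Equiv.addRight b) _ _ fun a => rfl

theorem upperNorm_of_fixed {w : V} (hw : ∀ a, ρ (upper a) w = w) : upperNorm ρ w = 0 := by
  rw [upperNorm_apply]
  simp only [hw]
  rw [Finset.sum_const, Finset.card_univ, ZMod.card, ← Nat.cast_smul_eq_nsmul (ZMod p),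
    CharP.cast_eq_zero, zero_smul]

theorem weyl_injective {w : V} (h : ρ (weyl (ZMod p)) w = 0) : w = 0 := by
  have h2 : ρ ((weyl (ZMod p))⁻¹) (ρ (weyl _) w) = w := by
    rw [rho_mul, inv_mul_cancel, map_one]; rfl
  rw [← h2, h, map_zero]

theorem upper_weyl {w : V} (hw : w ∈ lowerInv ρ) (a : ZMod p) :
    ρ (upper a) (ρ (weyl _) w) = ρ (weyl _) w := by
  have := weyl_mul_lower (-a)
  rw [neg_neg] at this
  rw [rho_mul, ← this, ← rho_mul, hw]

theorem lower_weyl {w : V} (hw : ∀ a, ρ (upper a) w = w) : ρ (weyl _) w ∈ lowerInv ρ := by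
  intro a
  have := weyl_mul_upper (-a)
  rw [neg_neg] at this
  rw [rho_mul, ← this, ← rho_mul, hw]

theorem hecke_mem_lowerInv (w : V) : hecke ρ w ∈ lowerInv ρ :=
  lower_weyl ρ fun a => upper_upperNorm ρ a w

variable {ρ}

/-- The torus normalizes the upper unipotent group, so the norm keeps the torus character, and the
Weyl element inverts it: x^r = x^(-(p-1-r)). -/
theorem hecke_mem_weightSpace {r : ℕ} (hr : r ≤ p - 1) {w : V} (hw : w ∈ weightSpace ρ r) :
    hecke ρ w ∈ weightSpace ρ (p - 1 - r) := by
  refine ⟨hecke_mem_lowerInv ρ w, fun x => ?_⟩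
  have h1 : ρ (torus x⁻¹) (upperNorm ρ w) = ((x : ZMod p)) ^ r • upperNorm ρ w := by
    have h2 := hw.2 x⁻¹
    rw [inv_inv] at h2
    rw [← map_smul, ← h2, upperNorm_apply, upperNorm_apply, map_sum]
    simp only [rho_mul, torus_mul_upper]
    exact Fintype.sum_equiv (Units.mulLeft (x⁻¹ * x⁻¹)) _ _ fun a => by
      simp only [Units.mulLeft_apply, Units.val_mul]
  have h3 := weyl_mul_torus (x⁻¹)
  rw [inv_inv] at h3
  rw [hecke_apply, rho_mul, ← h3, ← rho_mul, h1, map_smul]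
  congr 1
  rw [Units.val_inv_eq_inv_val, inv_pow, pow_sub₀ _ x.ne_zero hr,
    ZMod.pow_card_sub_one_eq_one x.ne_zero, one_mul, inv_inv]

/-- For a ≠ 0 the Bruhat decomposition of weyl·upper(a) has upper and torus parts given by x = -1/a;
the sum is reindexed by this x. -/
theorem hecke_eq {r : ℕ} {w : V} (hw : w ∈ weightSpace ρ r) :
    hecke ρ w = ρ (weyl _) w +
      ∑ x : (ZMod p)ˣ, ((x⁻¹ : (ZMod p)ˣ) : ZMod p) ^ r • ρ (upper (x : ZMod p)) w := by
  rw [hecke_apply, upperNorm_apply, sum_zmod_eq, map_add, upper_zero, map_one, map_sum]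
  congr 1
  refine Fintype.sum_equiv ((Equiv.inv _).trans (Equiv.neg _)) _ _ fun x => ?_
  rw [rho_mul, weyl_mul_upper_unit, map_mul, map_mul, Module.End.mul_apply, Module.End.mul_apply,
    hw.1, hw.2, map_smul]
  rfl

/-- The interpolation formula has exactly these weights x^(p-1-r). The bounds on r exclude the extra
sum in `coef 0` and a contribution of c = 0 in `coef (p - 1)`. -/
theorem sum_inv_pow_smul_upper {r : ℕ} (h0 : 0 < r) (hr : r < p - 1) (w : V) :
    ∑ x : (ZMod p)ˣ, ((x⁻¹ : (ZMod p)ˣ) : ZMod p) ^ r • ρ (upper (x : ZMod p)) w =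
      -opE ρ r w := by
  rw [opE, coef_apply, coef, if_neg h0.ne', zero_sub, neg_neg, sum_zmod_eq, zero_pow (by omega),
    zero_smul, zero_add]
  refine Finset.sum_congr rfl fun x _ => ?_
  congr 1
  rw [Units.val_inv_eq_inv_val, inv_pow, pow_sub₀ _ x.ne_zero hr.le,
    ZMod.pow_card_sub_one_eq_one x.ne_zero, one_mul]

theorem opE_of_fixed {w : V} (hw : ∀ a, ρ (upper a) w = w) {i : ℕ} (hi : i < p) (h0 : i ≠ 0) :
    opE ρ i w = 0 := by
  rw [opE, coef_apply]
  refine (coef_eq (v := fun j => if j = 0 then w else 0) (fun b => ?_) hi).trans (if_neg h0)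
  rw [Finset.sum_eq_single_of_mem 0 (Finset.mem_range.mpr (Fact.out : p.Prime).pos)
    (fun i _ hi => by simp [hi]), hw b]
  simp

/-- By the two preceding formulas, vanishing of the Hecke operator says `ρ (weyl _) w = opE ρ r w`.
The left side is fixed by the upper unipotent group; expanding its action on the right side kills
all `opE ρ i w` with i > r, as i choose r is nonzero modulo p. -/
theorem mem_lowest_of_hecke_eq_zero {r : ℕ} (h0 : 0 < r) (hr : r < p - 1) {w : V}
    (hw : w ∈ weightSpace ρ r) (h : hecke ρ w = 0) : w ∈ lowest ρ r := by
  have h1 := hecke_eq hw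
  rw [sum_inv_pow_smul_upper h0 hr, h, eq_comm, ← sub_eq_add_neg, sub_eq_zero] at h1
  refine ⟨hw, fun i hri hi => ?_, h1⟩
  have h2 : ∀ b : ZMod p, ∑ m ∈ Finset.range p, b ^ m • (if m + r < p then
      ((m + r).choose r : ZMod p) • opE ρ (m + r) w else 0) =
      ∑ m ∈ Finset.range p, b ^ m • (if m = 0 then opE ρ r w else 0) := by
    intro b
    have h3 := rho_upper_opE ρ b (show r < p by omega) w
    rw [← h1, upper_weyl ρ hw.1, h1] at h3
    rw [sum_range_shift p r _ (fun i _ hi => by rw [if_neg (by omega), smul_zero]),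
      Finset.sum_eq_single_of_mem (f := fun m => b ^ m • (if m = 0 then opE ρ r w else 0)) 0
        (Finset.mem_range.mpr (by omega)) (fun i _ hi => by simp [hi])]
    rw [if_pos rfl, pow_zero, one_smul, h3]
    refine Finset.sum_congr rfl fun j hj => ?_
    split_ifs with h4 h5
    · rw [smul_smul, mul_comm, Nat.sub_add_cancel h4]
    · have := Finset.mem_range.mp hj
      omega
    · rw [Nat.choose_eq_zero_of_lt (by omega)]; simp
  have h3 := eq_of_sum_pow h2 (i := i - r) (by omega)
  rw [if_pos (by omega), if_neg (by omega), Nat.sub_add_cancel hri.le] at h3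
  exact (smul_eq_zero.mp h3).resolve_left (choose_ne_zero_zmod hi hri.le)

/-- The square of the Hecke operator is zero here: the norm kills the fixed vector `ρ (weyl _) w`,
absorbs every `upper x`, and the sum of x^(-r) over units vanishes since p - 1 does not divide r. -/
theorem hecke_mem_lowest {r : ℕ} (h0 : 0 < r) (hr : r < p - 1) {w : V}
    (hw : w ∈ weightSpace ρ r) : hecke ρ w ∈ lowest ρ (p - 1 - r) := by
  refine mem_lowest_of_hecke_eq_zero (by omega) (by omega) (hecke_mem_weightSpace hr.le hw) ?_
  have h1 : ∑ x : (ZMod p)ˣ, ((x⁻¹ : (ZMod p)ˣ) : ZMod p) ^ r = 0 := by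
    have h2 := FiniteField.sum_pow_units (ZMod p) r
    rw [ZMod.card, if_neg (fun hd => absurd (Nat.le_of_dvd h0 hd) (by omega))] at h2
    rw [← h2]
    exact Fintype.sum_equiv (Equiv.inv _) _ _ fun x => rfl
  rw [hecke_apply, hecke_eq hw, map_add, upperNorm_of_fixed ρ (upper_weyl ρ hw.1), zero_add,
    map_sum]
  simp only [map_smul, upperNorm_upper]
  rw [← Finset.sum_smul, h1, zero_smul, map_zero]

theorem hecke_eq_of_weight_zero {w : V} (hw : w ∈ weightSpace ρ 0) :
    hecke ρ w = ρ (weyl _) w + (upperNorm ρ w - w) := by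
  rw [hecke_eq hw, upperNorm_apply, sum_zmod_eq, upper_zero, map_one]
  simp only [pow_zero, one_smul, Module.End.one_apply]
  abel

/-- Here the norm of w vanishes, so `hecke_eq_of_weight_zero` gives that w equals its Weyl translate
and is therefore fixed by the upper unipotent group too. -/
theorem mem_lowest_zero {w : V} (hw : w ∈ weightSpace ρ 0) (h : hecke ρ w = 0) :
    w ∈ lowest ρ 0 := by
  have h1 := weyl_injective ρ h
  rw [hecke_eq_of_weight_zero hw, h1, zero_sub, ← sub_eq_add_neg, sub_eq_zero] at h
  refine ⟨hw, fun i h0 hi => opE_of_fixed (fun a => ?_) hi h0.ne', by rw [opE_zero, h]⟩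
  conv_lhs => rw [← h]
  rw [upper_weyl ρ hw.1, h]

/-- The eigenvalue -1 says that the Weyl element acts as minus the norm, and minus the norm is `opE
ρ (p - 1)`. -/
theorem mem_lowest_top {w : V} (hw : w ∈ weightSpace ρ 0) (h : hecke ρ w = -w) :
    w ∈ lowest ρ (p - 1) := by
  have hp := (Fact.out : p.Prime).two_le
  refine ⟨⟨hw.1, fun x => ?_⟩, fun i h0 hi => by omega, ?_⟩
  · rw [hw.2, pow_zero, ZMod.pow_card_sub_one_eq_one (Units.ne_zero _)]
  · rw [hecke_eq_of_weight_zero hw] at h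
    rw [opE, coef_apply, coef, if_neg (by omega), zero_sub, Nat.sub_self]
    simp only [pow_zero, one_smul]
    rw [← upperNorm_apply]
    rw [← add_sub_assoc, sub_eq_iff_eq_add, neg_add_cancel] at h
    exact eq_neg_of_add_eq_zero_left h

/-- On weight 0 the Hecke operator T satisfies T² = -T, so w = (w + Tw) - Tw splits w into
eigenvectors for 0 and -1, of types 0 and p - 1. -/
theorem weightSpace_zero_le : weightSpace ρ 0 ≤ expandSpan ρ (lowest ρ) := by
  have hp := (Fact.out : p.Prime).two_le
  intro w hw
  have h1 : hecke ρ w ∈ weightSpace ρ 0 := by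
    have h := hecke_mem_weightSpace (Nat.zero_le _) hw
    refine ⟨h.1, fun x => ?_⟩
    rw [h.2, pow_zero, Nat.sub_zero, ZMod.pow_card_sub_one_eq_one (Units.ne_zero _)]
  have h2 : hecke ρ (hecke ρ w) = -hecke ρ w := by
    conv_lhs => rw [hecke_apply, hecke_eq_of_weight_zero hw]
    rw [map_add, map_sub, upperNorm_of_fixed ρ (upper_weyl ρ hw.1),
      upperNorm_of_fixed ρ (fun a => upper_upperNorm ρ a w), zero_add, zero_sub, map_neg]
    rfl
  have h3 := mem_lowest_zero (add_mem hw h1) (by rw [map_add, h2, add_neg_cancel])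
  have h4 := mem_lowest_top h1 h2
  have h5 := sub_mem (opE_mem_expandSpan (fun _ => le_rfl) (i := 0) (by omega) (by omega) h3)
    (opE_mem_expandSpan (fun _ => le_rfl) (i := 0) (by omega) (by omega) h4)
  rw [opE_zero, opE_zero, add_sub_cancel_right] at h5
  exact h5

/-- Orthogonality of characters of the torus, whose order p - 1 equals -1 in 𝔽_p; this is the reason
for the sign. Weights matter only modulo p - 1, so the value r = p - 1 is not listed. -/
theorem exists_weight_decomposition {w : V} (hw : w ∈ lowerInv ρ) :
    ∃ c : ℕ → V, (∀ r, c r ∈ weightSpace ρ r) ∧ w = ∑ r ∈ Finset.range (p - 1), c r := by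
  have hp := (Fact.out : p.Prime).two_le
  refine ⟨fun r => -negWeightProj ρ r w, fun r => neg_mem ⟨fun b => ?_, fun y => ?_⟩, ?_⟩
  · rw [negWeightProj, LinearMap.sum_apply, map_sum]
    refine Finset.sum_congr rfl fun x _ => ?_
    rw [LinearMap.smul_apply, map_smul, rho_mul, ← torus_mul_lower, ← rho_mul, hw]
  · rw [negWeightProj, LinearMap.sum_apply, map_sum, Finset.smul_sum]
    refine Fintype.sum_equiv (Equiv.mulLeft y) _ _ fun x => ?_
    rw [LinearMap.smul_apply, LinearMap.smul_apply, map_smul, rho_mul, torus_mul, smul_smul,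
      Equiv.coe_mulLeft, Units.val_mul, mul_pow, ← mul_assoc, ← mul_pow, Units.inv_mul, one_pow,
      one_mul]
  · simp only [negWeightProj, LinearMap.sum_apply, LinearMap.smul_apply]
    rw [Finset.sum_neg_distrib, Finset.sum_comm]
    simp only [← Finset.sum_smul]
    rw [Finset.sum_eq_single_of_mem 1 (Finset.mem_univ _)]
    · simp [torus_one, Nat.cast_sub (show 1 ≤ p by omega)]
    · intro x _ hx
      have h1 : (x : ZMod p) - 1 ≠ 0 := sub_ne_zero.mpr fun h => hx (Units.ext h)
      have h2 := geom_sum_mul (x : ZMod p) (p - 1)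
      rw [ZMod.pow_card_sub_one_eq_one x.ne_zero, sub_self] at h2
      rw [(mul_eq_zero.mp h2).resolve_right h1, zero_smul]

/-- The operators `opF ρ i` with i ≥ 1 kill x, which forces all coordinates of index at least 1 to
vanish. -/
theorem exists_lowest_decomposition {x : V} (hx : x ∈ expandSpan ρ (lowest ρ))
    (hl : x ∈ lowerInv ρ) :
    ∃ c : ℕ → V, (∀ r, c r ∈ lowest ρ r) ∧ x = ∑ r ∈ Finset.range p, c r := by
  obtain ⟨w, h1, h2, rfl⟩ := hx
  have hp := (Fact.out : p.Prime).two_le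
  refine ⟨w 0, h1 0, ?_⟩
  rw [expand]
  refine Finset.sum_congr rfl fun r hr => ?_
  rw [Finset.sum_eq_single_of_mem 0 (Finset.mem_range.mpr (by omega)), opE_zero]
  intro i hi h0
  rw [eq_zero_of_opF_expand h1 h2 (n := 1) (fun i h hi => opF_lowerInv hl hi (by omega))
    (by omega) (Finset.mem_range.mp hi) (Finset.mem_range.mp hr), map_zero]

theorem eq_zero_of_diff_of_mem_expandSpan {v : V} (hv : v ∈ expandSpan ρ (lowest ρ))
    (h : ρ (upper 1) v - v ∈ lowerInv ρ) : ρ (upper 1) v - v = 0 := by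
  obtain ⟨c, hc, h1⟩ := exists_lowest_decomposition
    (sub_mem (expandSpan_stable (fun _ => le_rfl) _ hv) hv) h
  obtain ⟨w, hw, hlow, rfl⟩ := hv
  have h2 := (expand_of_diff (fun _ => le_rfl) hw hlow hc h1).1
  rw [h1]
  exact Finset.sum_eq_zero fun r hr => h2 r (Finset.mem_range.mp hr)

/-- In a representation of `SL₂(𝔽_p)` in characteristic `p` which is generated by the invariants
of the lower triangular unipotent group, these invariants embed into the coinvariants of the upper
triangular unipotent group. -/
theorem eq_zero_of_diff_mem_lowerInv
    (hgen : ∀ P : Submodule (ZMod p) V, (∀ g, P ≤ P.comap (ρ g)) → lowerInv ρ ≤ P → P = ⊤)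
    {v : V} (h : ρ (upper 1) v - v ∈ lowerInv ρ) : ρ (upper 1) v - v = 0 := by
  have hp := (Fact.out : p.Prime).two_le
  set V' := expandSpan ρ (lowest ρ) with hV'
  have hst := expandSpan_stable (ρ := ρ) (C := lowest ρ) (fun _ => le_rfl)
  let σ := ρ.quotient V' hst
  have hσ : ∀ g x, σ g (V'.mkQ x) = V'.mkQ (ρ g x) := fun g x => rfl
  have hweight : ∀ r x, x ∈ weightSpace ρ r → V'.mkQ x ∈ weightSpace σ r := fun r x hx =>
    ⟨fun b => by rw [hσ, hx.1], fun y => by rw [hσ, hx.2, map_smul]⟩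
  have hhecke : ∀ x, hecke σ (V'.mkQ x) = V'.mkQ (hecke ρ x) := by
    intro x
    rw [hecke_apply, hecke_apply, upperNorm_apply, upperNorm_apply]
    simp only [hσ, ← map_sum]
  -- Weight 0 is left out because it already lies in V'. The remaining images are of lowest weight:
  -- the Hecke operator sends them into V', hence to 0 in the quotient.
  let C : ℕ → Submodule (ZMod p) (V ⧸ V') := fun r =>
    if 0 < r ∧ r < p - 1 then (weightSpace ρ r).map V'.mkQ else ⊥
  have hC : ∀ r, C r ≤ lowest σ r := by
    intro r
    simp only [C]
    split_ifs with hr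
    · rintro _ ⟨x, hx, rfl⟩
      refine mem_lowest_of_hecke_eq_zero hr.1 hr.2 (hweight r x hx) ?_
      rw [hhecke, Submodule.mkQ_apply, Submodule.Quotient.mk_eq_zero]
      have h1 := opE_mem_expandSpan (ρ := ρ) (C := lowest ρ) (fun _ => le_rfl) (i := 0)
        (r := p - 1 - r) (by omega) (by omega) (hecke_mem_lowest hr.1 hr.2 hx)
      rwa [opE_zero] at h1
    · exact bot_le
  have hdec : ∀ x ∈ lowerInv ρ, ∃ c : ℕ → V ⧸ V', (∀ r, c r ∈ C r) ∧
      V'.mkQ x = ∑ r ∈ Finset.range p, c r := by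
    intro x hx
    obtain ⟨c, hc, h1⟩ := exists_weight_decomposition hx
    refine ⟨fun r => if 0 < r ∧ r < p - 1 then V'.mkQ (c r) else 0, fun r => ?_, ?_⟩
    · simp only [C]
      split_ifs
      · exact ⟨c r, hc r, rfl⟩
      · exact zero_mem _
    · rw [h1, map_sum, ← Finset.sum_subset (Finset.range_subset_range.mpr (show p - 1 ≤ p by omega))]
      · refine Finset.sum_congr rfl fun r hr => ?_
        split_ifs with h2
        · rfl
        · have := Finset.mem_range.mp hr
          have h0 : r = 0 := by omega
          subst h0
          rw [Submodule.mkQ_apply, Submodule.Quotient.mk_eq_zero]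
          exact weightSpace_zero_le (hc 0)
      · intro r _ hr
        rw [if_neg]
        rintro ⟨_, h2⟩
        exact hr (Finset.mem_range.mpr h2)
  have hlift : ∀ r, ∀ x ∈ C r, ∃ y ∈ lowerInv ρ, V'.mkQ y = x := by
    intro r x hx
    simp only [C] at hx
    split_ifs at hx
    · obtain ⟨y, hy, rfl⟩ := hx
      exact ⟨y, hy.1, rfl⟩
    · exact ⟨0, zero_mem _, by rw [(Submodule.mem_bot _).mp hx, map_zero]⟩
  have htop : (expandSpan σ C).comap V'.mkQ = ⊤ := by
    refine hgen _ (fun g x hx => ?_) fun x hx => ?_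
    · rw [Submodule.mem_comap, Submodule.mem_comap, ← hσ]
      exact expandSpan_stable hC g hx
    · obtain ⟨c, hc, h1⟩ := hdec x hx
      rw [Submodule.mem_comap, h1]
      refine sum_mem fun r hr => ?_
      have h2 := opE_mem_expandSpan hC (i := 0) (by omega) (Finset.mem_range.mp hr) (hc r)
      rwa [opE_zero] at h2
  obtain ⟨w, hw, hlow, hx⟩ : V'.mkQ v ∈ expandSpan σ C := by
    rw [← Submodule.mem_comap, htop]; trivial
  obtain ⟨c, hc, h1⟩ := hdec _ h
  rw [map_sub, ← hσ, ← hx] at h1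
  have h2 := (expand_of_diff hC hw hlow hc h1).2
  -- In the quotient, v is the Weyl translate of vectors that lift to invariants of the lower
  -- unipotent group in V. The Weyl translate of the lift is fixed by `upper 1`, so subtracting it
  -- moves v into V' and leaves the difference unchanged.
  choose y hy hyw using fun r => hlift r _ (hw r r)
  have h3 : v - ρ (weyl _) (∑ r ∈ Finset.range p, y r) ∈ V' := by
    have h5 : V'.mkQ (∑ r ∈ Finset.range p, y r) = ∑ r ∈ Finset.range p, w r r := by
      rw [map_sum]
      exact Finset.sum_congr rfl fun r _ => hyw r
    rw [← Submodule.Quotient.mk_eq_zero, ← Submodule.mkQ_apply, map_sub, ← hx, h2, ← hσ, h5,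
      sub_self]
  have h4 : ρ (upper 1) v - v = ρ (upper 1) (v - ρ (weyl _) (∑ r ∈ Finset.range p, y r)) -
      (v - ρ (weyl _) (∑ r ∈ Finset.range p, y r)) := by
    rw [map_sub, upper_weyl ρ (sum_mem fun r _ => hy r)]
    abel
  rw [h4] at h ⊢
  exact eq_zero_of_diff_of_mem_expandSpan h3 h

end FiniteMain
end SL2Tree

namespace SL2Tree

/-! ### Homology of a rooted tree on which a cyclic group acts transitively on every level -/

/-- A set `S` of vertices which carries the structure of a `p`-ary rooted tree: its vertices of
level `n` are the translates of `x n` under the powers of `γ`, its edges are the translates of the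
edges `e n = {x n, x (n + 1)}`. -/
structure IsCyclicTree {p : ℕ} [Fact p.Prime] (S : Set (Vertex p)) (γ : G p) (x : ℕ → Vertex p)
    (e : ℕ → Edge p) : Prop where
  e_eq : ∀ n, (e n).1 = s(x n, x (n + 1))
  smul_mem : ∀ n (j : ℤ), γ ^ j • x n ∈ S
  exists_eq : ∀ y ∈ S, ∃ n, ∃ j : ℤ, γ ^ j • x n = y
  exists_edge : ∀ τ : CoeffSystem.EdgeIn S, ∃ n, ∃ j : ℤ, γ ^ j • e n = τ.1
  level_eq : ∀ {n m : ℕ} {i : ℤ}, γ ^ i • x n = x m → n = m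
  smul_eq_iff : ∀ (n : ℕ) (i : ℤ), γ ^ i • x n = x n ↔ ((p ^ n : ℕ) : ℤ) ∣ i

namespace IsCyclicTree

variable {p : ℕ} [Fact p.Prime] {S : Set (Vertex p)} {γ : G p} {x : ℕ → Vertex p} {e : ℕ → Edge p}

theorem level_eq' (h : IsCyclicTree S γ x e) {n m : ℕ} {i j : ℤ}
    (hij : γ ^ i • x n = γ ^ j • x m) : n = m := by
  refine h.level_eq (i := -j + i) ?_
  rw [zpow_add, mul_smul, hij, ← mul_smul, ← zpow_add, neg_add_cancel, zpow_zero, one_smul]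

theorem base_mem (h : IsCyclicTree S γ x e) (n : ℕ) : x n ∈ S := by
  simpa using h.smul_mem n 0

theorem mem_S (h : IsCyclicTree S γ x e) (j : ℤ) : ∀ y ∈ S, γ ^ j • y ∈ S := by
  intro y hy
  obtain ⟨n, i, rfl⟩ := h.exists_eq y hy
  rw [← mul_smul, ← zpow_add]
  exact h.smul_mem n _

theorem left_mem (h : IsCyclicTree S γ x e) (n : ℕ) : x n ∈ (e n).1 := by
  rw [h.e_eq]; exact Sym2.mem_mk_left _ _

theorem right_mem (h : IsCyclicTree S γ x e) (n : ℕ) : x (n + 1) ∈ (e n).1 := by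
  rw [h.e_eq]; exact Sym2.mem_mk_right _ _

theorem smul_e_eq (_h : IsCyclicTree S γ x e) (n : ℕ) (j : ℤ) :
    (γ ^ j • e n : Edge p).1 = s(γ ^ j • x n, γ ^ j • x (n + 1)) := by
  rw [coe_smul_edge, _h.e_eq]; rfl

theorem edge_mem (h : IsCyclicTree S γ x e) (n : ℕ) (j : ℤ) :
    ∀ y ∈ (γ ^ j • e n : Edge p).1, y ∈ S := by
  intro y hy
  rw [h.smul_e_eq] at hy
  rcases Sym2.mem_iff.mp hy with rfl | rfl <;> exact h.smul_mem _ _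

theorem fixes_left (h : IsCyclicTree S γ x e) {n : ℕ} {i : ℤ}
    (hi : γ ^ i • x (n + 1) = x (n + 1)) : γ ^ i • x n = x n := by
  rw [h.smul_eq_iff] at hi ⊢
  exact (Int.natCast_dvd_natCast.mpr (pow_dvd_pow p n.le_succ)).trans hi

theorem fixes_edge (h : IsCyclicTree S γ x e) {n : ℕ} {i : ℤ}
    (hi : γ ^ i • x (n + 1) = x (n + 1)) : γ ^ i • e n = e n := by
  apply Subtype.ext
  rw [h.smul_e_eq, h.e_eq, hi, h.fixes_left hi]

theorem edge_level_eq (h : IsCyclicTree S γ x e) {n m : ℕ} {i j : ℤ}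
    (hij : γ ^ i • e n = γ ^ j • e m) : n = m := by
  have h1 := congrArg Subtype.val hij
  rw [h.smul_e_eq, h.smul_e_eq, Sym2.eq_iff] at h1
  rcases h1 with h1 | h1
  · exact h.level_eq' h1.1
  · have h2 := h.level_eq' h1.1
    have h3 := h.level_eq' h1.2
    omega

end IsCyclicTree

/-! ### Chains of a coefficient system on a cyclic tree -/

namespace CoeffSystem

universe u v

variable {p : ℕ} [Fact p.Prime] {k : Type u} [Field k] (F : CoeffSystem.{u, v} p k)
variable {S : Set (Vertex p)} {γ : G p} {x : ℕ → Vertex p} {e : ℕ → Edge p}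
variable (h : IsCyclicTree S γ x e)

/-- The translate by `γ ^ j` of an element of `F (x n)`, as a `0`-chain. -/
noncomputable def chainV (n : ℕ) (j : ℤ) : F.onV (x n) →ₗ[k] F.C0 S :=
  F.ofV S ⟨γ ^ j • x n, h.smul_mem n j⟩ ∘ₗ F.actV (γ ^ j) rfl

open Classical in
/-- The translate by `γ ^ j` of an element of `F (e n)`, as a `1`-chain. -/
noncomputable def chainE (n : ℕ) (j : ℤ) : F.onE (e n) →ₗ[k] F.C1 S :=
  DirectSum.lof k (EdgeIn S) (fun τ => F.onE τ.1) ⟨γ ^ j • e n, h.edge_mem n j⟩ ∘ₗ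
    F.actE (γ ^ j) rfl

variable {F}

theorem actV_inv_actV (g : G p) {y z : Vertex p} (hyz : g • y = z) (hzy : g⁻¹ • z = y)
    (v : F.onV y) : F.actV g⁻¹ hzy (F.actV g hyz v) = v := by
  rw [F.actV_mul g⁻¹ g hyz hzy (by rw [inv_mul_cancel, one_smul])]
  have : ∀ (g' : G p) (_ : g' = 1) (h' : g' • y = y), F.actV g' h' v = v := by
    rintro _ rfl h'
    exact F.actV_one h' v
  exact this _ (inv_mul_cancel g) _

theorem actV_congr {g g' : G p} (hg : g = g') {y z : Vertex p} (h₁ : g • y = z) (h₂ : g' • y = z)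
    (v : F.onV y) : F.actV g h₁ v = F.actV g' h₂ v := by
  subst hg; rfl

theorem actE_congr {g g' : G p} (hg : g = g') {y z : Edge p} (h₁ : g • y = z) (h₂ : g' • y = z)
    (v : F.onE y) : F.actE g h₁ v = F.actE g' h₂ v := by
  subst hg; rfl

theorem chainV_hom_ext {M : Type*} [AddCommGroup M] [Module k M] {f f' : F.C0 S →ₗ[k] M}
    (hf : ∀ n j v, f (F.chainV h n j v) = f' (F.chainV h n j v)) : f = f' := by
  refine C0_hom_ext fun y v => ?_
  obtain ⟨y, hy⟩ := y
  obtain ⟨n, j, rfl⟩ := h.exists_eq y hy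
  have h1 := hf n j (F.actV (γ ^ j)⁻¹ (inv_smul_smul _ _) v)
  have h2 : F.actV (γ ^ j) rfl (F.actV (γ ^ j)⁻¹ (inv_smul_smul _ _) v) = v := by
    rw [F.actV_mul _ _ _ _ (by rw [mul_inv_cancel, one_smul])]
    rw [actV_congr (mul_inv_cancel _) _ (one_smul _ _), F.actV_one]
  rw [chainV, LinearMap.comp_apply, h2] at h1
  exact h1

theorem chainE_hom_ext {M : Type*} [AddCommGroup M] [Module k M] {f f' : F.C1 S →ₗ[k] M}
    (hf : ∀ n j v, f (F.chainE h n j v) = f' (F.chainE h n j v)) : f = f' := by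
  classical
  refine DirectSum.linearMap_ext k fun τ => LinearMap.ext fun v => ?_
  obtain ⟨τ, hτ⟩ := τ
  obtain ⟨n, j, hnj⟩ := h.exists_edge ⟨τ, hτ⟩
  change γ ^ j • e n = τ at hnj
  subst hnj
  have h1 := hf n j (F.actE (γ ^ j)⁻¹ (inv_smul_smul _ _) v)
  have h2 : F.actE (γ ^ j) rfl (F.actE (γ ^ j)⁻¹ (inv_smul_smul _ _) v) = v := by
    rw [F.actE_mul _ _ _ _ (by rw [mul_inv_cancel, one_smul])]
    rw [actE_congr (mul_inv_cancel _) _ (one_smul _ _), F.actE_one]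
  rw [chainE, LinearMap.comp_apply, h2] at h1
  simpa using h1

/-- A chain supported on one edge is a translate from the ray. The last clause transfers
nonvanishing to the ray; the equality is stated for every decidability instance so that it matches
any occurrence of `lof`. -/
theorem exists_chainE (τ : EdgeIn S) (v : F.onE τ.1) :
    ∃ n j b, (∀ [DecidableEq (EdgeIn S)],
      DirectSum.lof k (EdgeIn S) (fun τ => F.onE τ.1) τ v = F.chainE h n j b) ∧
      γ ^ j • e n = τ.1 ∧ (b = 0 → v = 0) := by
  obtain ⟨τ, hτ⟩ := τ
  obtain ⟨n, j, hnj⟩ := h.exists_edge ⟨τ, hτ⟩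
  change γ ^ j • e n = τ at hnj
  subst hnj
  have h2 : F.actE (γ ^ j) rfl (F.actE (γ ^ j)⁻¹ (inv_smul_smul _ _) v) = v := by
    rw [F.actE_mul _ _ _ _ (by rw [mul_inv_cancel, one_smul])]
    rw [actE_congr (mul_inv_cancel _) _ (one_smul _ _), F.actE_one]
  refine ⟨n, j, F.actE (γ ^ j)⁻¹ (inv_smul_smul _ _) v, ?_, rfl, fun h0 => ?_⟩
  · intro _
    rw [chainE, LinearMap.comp_apply, h2]
    congr!
  · rw [← h2, h0, map_zero]

theorem boundary_chainE (n : ℕ) (j : ℤ) (b : F.onE (e n)) :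
    F.boundary S (F.chainE h n j b) =
      F.chainV h n j (F.r (e n) (x n) (h.left_mem n) b) +
        F.chainV h (n + 1) j (F.r (e n) (x (n + 1)) (h.right_mem n) b) := by
  rw [chainE, LinearMap.comp_apply, boundary_lof _ _ (h.smul_e_eq n j),
    F.r_act (γ ^ j) rfl rfl (h.left_mem n), F.r_act (γ ^ j) rfl rfl (h.right_mem n)]
  rfl

theorem actC0_chainV (i : ℤ) (n : ℕ) (j : ℤ) (v : F.onV (x n)) :
    F.actC0 S (γ ^ i) (h.mem_S i) (F.chainV h n j v) = F.chainV h n (i + j) v := by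
  rw [chainV, LinearMap.comp_apply, actC0_ofV, chainV, LinearMap.comp_apply,
    F.actV_mul (γ ^ i) (γ ^ j) rfl rfl (mul_smul _ _ _)]
  have : ∀ (g g' : G p) (_ : g = g') (y : Vertex p) (hy : g • x n = y) (hyS : y ∈ S)
      (hS : g' • x n ∈ S), F.ofV S ⟨y, hyS⟩ (F.actV g hy v) =
      F.ofV S ⟨g' • x n, hS⟩ (F.actV g' rfl v) := by
    rintro g _ rfl y rfl _ _
    rfl
  exact this _ _ (zpow_add γ i j).symm _ _ _ _

/-- The component of a `0`-chain at a vertex. -/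
def comp (y : S) : F.C0 S →ₗ[k] F.onV y.1 := DirectSum.component k S (fun y => F.onV y.1) y

theorem comp_ofV_self (y : S) (v : F.onV y.1) : comp y (F.ofV S y v) = v := by
  classical
  rw [comp, ofV]
  exact DirectSum.component.lof_self (R := k) (M := fun y : S => F.onV y.1) (i := y) (b := v)

theorem comp_ofV_of_ne {y z : S} (hyz : z ≠ y) (v : F.onV z.1) : comp y (F.ofV S z v) = 0 := by
  classical
  rw [comp, ofV]
  exact DirectSum.of_eq_of_ne (β := fun y : S => F.onV y.1) z y v hyz.symm

theorem C0_ext {z z' : F.C0 S} (hz : ∀ y, comp y z = comp y z') : z = z' :=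
  DFinsupp.ext hz

theorem comp_actC0 (g : G p) (hg : ∀ y ∈ S, g • y ∈ S) (y : S) (z : F.C0 S) :
    comp ⟨g • y.1, hg _ y.2⟩ (F.actC0 S g hg z) = F.actV g rfl (comp y z) := by
  suffices comp ⟨g • y.1, hg _ y.2⟩ ∘ₗ F.actC0 S g hg = F.actV g rfl ∘ₗ comp y from
    LinearMap.congr_fun this z
  refine C0_hom_ext fun y' v => ?_
  rw [LinearMap.comp_apply, LinearMap.comp_apply, actC0_ofV]
  by_cases hy : y' = y
  · subst hy
    rw [comp_ofV_self, comp_ofV_self]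
  · rw [comp_ofV_of_ne hy, map_zero, comp_ofV_of_ne]
    intro h1
    exact hy (Subtype.ext (smul_left_cancel g (congrArg Subtype.val h1)))

/-- The conditions under which the homology of a cyclic tree can be computed. -/
structure IsTriangular (F : CoeffSystem.{u, v} p k) (h : IsCyclicTree S γ x e) : Prop where
  actE_eq : ∀ (n : ℕ) (i : ℤ) (hi : γ ^ i • e n = e n) (b : F.onE (e n)), F.actE (γ ^ i) hi b = b
  injective : ∀ n, Function.Injective (F.r (e n) (x (n + 1)) (h.right_mem n))
  mem_range : ∀ n (v : F.onV (x (n + 1))),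
    (∀ (i : ℤ) (hi : γ ^ i • x (n + 1) = x (n + 1)), F.actV (γ ^ i) hi v = v) →
    v ∈ LinearMap.range (F.r (e n) (x (n + 1)) (h.right_mem n))
  eq_zero : ∀ n (b : F.onE (e n)), F.r (e n) (x n) (h.left_mem n) b ∈
    Submodule.span k {z | ∃ (i : ℤ) (hi : γ ^ i • x n = x n) (v : F.onV (x n)),
      z = F.actV (γ ^ i) hi v - v} → b = 0

variable {h}

theorem IsTriangular.chainE_eq (hF : F.IsTriangular h) (n : ℕ) (j i : ℤ)
    (hi : γ ^ i • e n = e n) (b : F.onE (e n)) :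
    F.chainE h n (j + i) b = F.chainE h n j b := by
  classical
  conv_rhs => rw [← hF.actE_eq n i hi b]
  rw [chainE, LinearMap.comp_apply, chainE, LinearMap.comp_apply,
    F.actE_mul (γ ^ j) (γ ^ i) hi rfl (by rw [mul_smul, hi])]
  have : ∀ (g g' : G p) (_ : g = g') (y : Edge p) (hy : g • e n = y) (hyS : ∀ z ∈ y.1, z ∈ S)
      (hS : ∀ z ∈ (g' • e n : Edge p).1, z ∈ S),
      DirectSum.lof k (EdgeIn S) (fun τ => F.onE τ.1) ⟨y, hyS⟩ (F.actE g hy b) =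
      DirectSum.lof k (EdgeIn S) (fun τ => F.onE τ.1) ⟨g' • e n, hS⟩ (F.actE g' rfl b) := by
    rintro g _ rfl y rfl _ _
    rfl
  convert (this _ _ (zpow_add γ j i).symm _ _ _ _).symm

/-! #### The differential is injective -/

/-- If c ≠ 0, take an edge of maximal level in its support. Its outer vertex lies on no other edge
of the support, so the boundary has there the nonzero value given by the injective transition map,
whereas the right side lives at level 0. -/
theorem IsTriangular.boundary_injective (hF : F.IsTriangular h) (v : F.onV (x 0)) {c : F.C1 S}
    (hc : F.boundary S c = F.chainV h 0 0 v) : v = 0 := by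
  classical
  have h0 : ∀ {n : ℕ} {j : ℤ}, F.chainV h n j = F.ofV S ⟨γ ^ j • x n, h.smul_mem n j⟩ ∘ₗ
    F.actV (γ ^ j) rfl := rfl
  have hc0 : c = 0 := by
    by_contra hne
    choose! lev ex hlev using fun τ : EdgeIn S => h.exists_edge τ
    have hsupp : c.support.Nonempty := by
      rw [Finset.nonempty_iff_ne_empty, Ne, DFinsupp.support_eq_empty]
      exact hne
    obtain ⟨τ, hτ, hmax⟩ := Finset.exists_max_image c.support lev hsupp
    have hsum : c = ∑ τ ∈ c.support, DirectSum.lof k (EdgeIn S) (fun τ => F.onE τ.1) τ (c τ) :=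
      (DirectSum.sum_support_of c).symm
    obtain ⟨n, j, b, hb, hnj, hb0⟩ := exists_chainE h τ (c τ)
    have hn : lev τ = n := h.edge_level_eq ((hlev τ).trans hnj.symm)
    have key := congrArg (comp ⟨γ ^ j • x (n + 1), h.smul_mem (n + 1) j⟩) hc
    rw [h0, LinearMap.comp_apply, comp_ofV_of_ne (fun h1 => by
      have := h.level_eq' (congrArg Subtype.val h1); omega)] at key
    rw [hsum, map_sum, map_sum, Finset.sum_eq_single_of_mem τ hτ, hb, boundary_chainE, map_add,
      h0, h0, LinearMap.comp_apply, LinearMap.comp_apply, comp_ofV_of_ne (fun h1 => by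
      have := h.level_eq' (congrArg Subtype.val h1); omega), comp_ofV_self, zero_add] at key
    · have h1 := congrArg (F.actV (γ ^ j)⁻¹ (inv_smul_smul _ _)) key
      rw [actV_inv_actV, map_zero] at h1
      have h2 := hb0 (hF.injective n (by rw [h1, map_zero]))
      exact (DFinsupp.mem_support_iff.mp hτ) h2
    · intro τ' hτ' hne'
      obtain ⟨m, i, b', hb', hmi, -⟩ := exists_chainE h τ' (c τ')
      have hm : lev τ' = m := h.edge_level_eq ((hlev τ').trans hmi.symm)
      have hle := hmax τ' hτ'
      rw [hb', boundary_chainE, map_add, h0, h0, LinearMap.comp_apply, LinearMap.comp_apply,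
        comp_ofV_of_ne (fun h1 => by
          have := h.level_eq' (congrArg Subtype.val h1); omega), comp_ofV_of_ne, zero_add]
      intro h1
      have h2 := congrArg Subtype.val h1
      have h3 : m = n := by have := h.level_eq' h2; omega
      subst h3
      apply hne'
      apply Subtype.ext
      rw [← hmi, ← hnj]
      have h4 : γ ^ (-j + i) • x (m + 1) = x (m + 1) := by
        rw [zpow_add, mul_smul]
        change γ ^ i • x (m + 1) = γ ^ j • x (m + 1) at h2
        rw [h2, ← mul_smul, ← zpow_add, neg_add_cancel, zpow_zero, one_smul]
      have h5 := h.fixes_edge h4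
      conv_rhs => rw [← h5]
      rw [← mul_smul, ← zpow_add]
      congr 2
      omega
  rw [hc0, map_zero] at hc
  have h1 := congrArg (comp ⟨γ ^ (0 : ℤ) • x 0, h.smul_mem 0 0⟩) hc
  rw [h0, LinearMap.comp_apply, comp_ofV_self, map_zero] at h1
  have h2 := actV_inv_actV (F := F) (γ ^ (0 : ℤ)) rfl (inv_smul_smul _ _) v
  rw [← h1, map_zero] at h2
  exact h2.symm

end CoeffSystem
end SL2Tree

namespace SL2Tree

namespace CoeffSystem

universe u v

variable {p : ℕ} [Fact p.Prime] {k : Type u} [Field k] {F : CoeffSystem.{u, v} p k}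
variable {S : Set (Vertex p)} {γ : G p} {x : ℕ → Vertex p} {e : ℕ → Edge p}
variable {h : IsCyclicTree S γ x e}

theorem chainV_eq (n : ℕ) (j : ℤ) (v : F.onV (x n)) : F.chainV h n j v =
    F.ofV S ⟨γ ^ j • x n, h.smul_mem n j⟩ (F.actV (γ ^ j) rfl v) := rfl

theorem comp_chainV_self (n : ℕ) (j : ℤ) (v : F.onV (x n)) :
    comp ⟨γ ^ j • x n, h.smul_mem n j⟩ (F.chainV h n j v) = F.actV (γ ^ j) rfl v := by
  rw [chainV_eq, comp_ofV_self]

theorem comp_chainV_of_ne {n : ℕ} {j : ℤ} {y : S} (hy : γ ^ j • x n ≠ y.1) (v : F.onV (x n)) :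
    comp y (F.chainV h n j v) = 0 := by
  rw [chainV_eq, comp_ofV_of_ne]
  exact fun h1 => hy (congrArg Subtype.val h1)

/-! #### The coinvariants of the chains -/

/-- The submodule of `F (x n)` which is divided out in the coinvariants. -/
def coinvKer (F : CoeffSystem.{u, v} p k) (γ : G p) (y : Vertex p) : Submodule k (F.onV y) :=
  Submodule.span k {z | ∃ (i : ℤ) (hi : γ ^ i • y = y) (v : F.onV y), z = F.actV (γ ^ i) hi v - v}

open Classical in
variable (F) in
/-- The projection of the `0`-chains to the coinvariants of level `n`. -/
noncomputable def coinvV (S : Set (Vertex p)) (γ : G p) (x : ℕ → Vertex p) (n : ℕ) :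
    F.C0 S →ₗ[k] F.onV (x n) ⧸ coinvKer F γ (x n) :=
  DirectSum.toModule k S _ fun y =>
    if hy : ∃ j : ℤ, γ ^ j • x n = y.1 then
      (coinvKer F γ (x n)).mkQ ∘ₗ F.actV (γ ^ hy.choose)⁻¹ (by
        rw [inv_smul_eq_iff]; exact hy.choose_spec.symm)
    else 0

open Classical in
variable (F S) in
/-- The component of `coinvE` at an edge. -/
noncomputable def coinvEAux (γ : G p) (e : ℕ → Edge p) (n : ℕ) (τ : EdgeIn S) :
    F.onE τ.1 →ₗ[k] F.onE (e n) :=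
  if hy : ∃ j : ℤ, γ ^ j • e n = τ.1 then
    F.actE (γ ^ hy.choose)⁻¹ (by rw [inv_smul_eq_iff]; exact hy.choose_spec.symm)
  else 0

open Classical in
variable (F) in
/-- The projection of the `1`-chains to the coinvariants of level `n`. -/
noncomputable def coinvE (S : Set (Vertex p)) (γ : G p) (e : ℕ → Edge p) (n : ℕ) :
    F.C1 S →ₗ[k] F.onE (e n) :=
  DirectSum.toModule k (EdgeIn S) _ (coinvEAux F S γ e n)

theorem coinvV_ofV (n : ℕ) (y : S) (v : F.onV y.1) (hy : ∃ j : ℤ, γ ^ j • x n = y.1) :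
    coinvV F S γ x n (F.ofV S y v) = (coinvKer F γ (x n)).mkQ (F.actV (γ ^ hy.choose)⁻¹ (by
        rw [inv_smul_eq_iff]; exact hy.choose_spec.symm) v) := by
  classical
  rw [coinvV, ofV]
  erw [DirectSum.toModule_lof]
  rw [dif_pos hy]
  rfl

/-- The exponent selected by `choose` differs from j by an element of the stabilizer of `x n`, whose
action is trivial modulo `coinvKer`. -/
theorem coinvV_chainV_self (n : ℕ) (j : ℤ) (v : F.onV (x n)) :
    coinvV F S γ x n (F.chainV h n j v) = (coinvKer F γ (x n)).mkQ v := by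
  have hy : ∃ i : ℤ, γ ^ i • x n = (⟨γ ^ j • x n, h.smul_mem n j⟩ : S).1 := ⟨j, rfl⟩
  rw [chainV_eq, coinvV_ofV n _ _ hy]
  have aux : ∀ (i : ℤ) (h1 : γ ^ i • x n = γ ^ j • x n) (h3 : (γ ^ i)⁻¹ • γ ^ j • x n = x n),
      (coinvKer F γ (x n)).mkQ (F.actV (γ ^ i)⁻¹ h3 (F.actV (γ ^ j) rfl v)) =
        (coinvKer F γ (x n)).mkQ v := by
    intro i h1 h3
    have h2 : γ ^ (-i + j) • x n = x n := by
      rw [zpow_add, mul_smul, ← h1, ← mul_smul, ← zpow_add, neg_add_cancel, zpow_zero, one_smul]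
    rw [F.actV_mul _ _ _ _ (by rw [mul_smul, h3]),
      actV_congr (by rw [zpow_add, zpow_neg]) _ h2, ← sub_eq_zero, ← map_sub, Submodule.mkQ_apply,
      Submodule.Quotient.mk_eq_zero]
    exact Submodule.subset_span ⟨_, h2, v, rfl⟩
  exact aux _ hy.choose_spec _

theorem coinvV_chainV_of_ne {n m : ℕ} (hnm : m ≠ n) (j : ℤ) (v : F.onV (x m)) :
    coinvV F S γ x n (F.chainV h m j v) = 0 := by
  classical
  rw [chainV_eq, coinvV, ofV]
  erw [DirectSum.toModule_lof]
  rw [dif_neg]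
  · rfl
  · rintro ⟨i, hi⟩
    exact hnm (h.level_eq' hi).symm

open Classical in
theorem coinvE_lof (n : ℕ) (τ : EdgeIn S) (b : F.onE τ.1) :
    coinvE F S γ e n (DirectSum.lof k (EdgeIn S) (fun τ => F.onE τ.1) τ b) =
      coinvEAux F S γ e n τ b := by
  rw [coinvE]
  exact DirectSum.toModule_lof (M := fun τ : EdgeIn S => F.onE τ.1) k τ b

theorem coinvE_chainE_self (hF : F.IsTriangular h) (n : ℕ) (j : ℤ) (b : F.onE (e n)) :
    coinvE F S γ e n (F.chainE h n j b) = b := by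
  have hy : ∃ i : ℤ, γ ^ i • e n = (⟨γ ^ j • e n, h.edge_mem n j⟩ : EdgeIn S).1 := ⟨j, rfl⟩
  have aux : ∀ (i : ℤ) (h1 : γ ^ i • e n = γ ^ j • e n) (h3 : (γ ^ i)⁻¹ • γ ^ j • e n = e n),
      F.actE (γ ^ i)⁻¹ h3 (F.actE (γ ^ j) rfl b) = b := by
    intro i h1 h3
    have h2 : γ ^ (-i + j) • e n = e n := by
      rw [zpow_add, mul_smul, ← h1, ← mul_smul, ← zpow_add, neg_add_cancel, zpow_zero, one_smul]
    rw [F.actE_mul _ _ _ _ (by rw [mul_smul, h3]),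
      actE_congr (by rw [zpow_add, zpow_neg]) _ h2, hF.actE_eq]
  rw [chainE, LinearMap.comp_apply, coinvE_lof, coinvEAux, dif_pos hy]
  exact aux _ hy.choose_spec _

theorem coinvE_chainE_of_ne {n m : ℕ} (hnm : m ≠ n) (j : ℤ) (b : F.onE (e m)) :
    coinvE F S γ e n (F.chainE h m j b) = 0 := by
  rw [chainE, LinearMap.comp_apply, coinvE_lof, coinvEAux, dif_neg]
  · rfl
  · rintro ⟨i, hi⟩
    exact hnm (h.edge_level_eq hi).symm

theorem coinvV_actC0 (h : IsCyclicTree S γ x e) (n : ℕ) (i : ℤ) (z : F.C0 S) :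
    coinvV F S γ x n (F.actC0 S (γ ^ i) (h.mem_S i) z) = coinvV F S γ x n z := by
  suffices coinvV F S γ x n ∘ₗ F.actC0 S (γ ^ i) (h.mem_S i) = coinvV F S γ x n from
    LinearMap.congr_fun this z
  refine chainV_hom_ext h fun m j v => ?_
  rw [LinearMap.comp_apply, actC0_chainV]
  by_cases hm : m = n
  · subst hm
    rw [coinvV_chainV_self, coinvV_chainV_self]
  · rw [coinvV_chainV_of_ne hm, coinvV_chainV_of_ne hm]

theorem coinvV_zero_boundary (hF : F.IsTriangular h) (c : F.C1 S) :
    coinvV F S γ x 0 (F.boundary S c) =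
      (coinvKer F γ (x 0)).mkQ (F.r (e 0) (x 0) (h.left_mem 0) (coinvE F S γ e 0 c)) := by
  suffices coinvV F S γ x 0 ∘ₗ F.boundary S = (coinvKer F γ (x 0)).mkQ ∘ₗ
      F.r (e 0) (x 0) (h.left_mem 0) ∘ₗ coinvE F S γ e 0 from LinearMap.congr_fun this c
  refine chainE_hom_ext h fun m j b => ?_
  simp only [LinearMap.comp_apply]
  rw [boundary_chainE, map_add, coinvV_chainV_of_ne (Nat.succ_ne_zero m), add_zero]
  by_cases hm : m = 0
  · subst hm
    rw [coinvV_chainV_self, coinvE_chainE_self hF]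
  · rw [coinvV_chainV_of_ne hm, coinvE_chainE_of_ne hm, map_zero, map_zero]

/-- A vertex of level n + 1 lies on one edge towards the root, of level n, and on outgoing edges of
level n + 1; these give the two terms. At the root the second term is absent. -/
theorem coinvV_succ_boundary (hF : F.IsTriangular h) (n : ℕ) (c : F.C1 S) :
    coinvV F S γ x (n + 1) (F.boundary S c) =
      (coinvKer F γ (x (n + 1))).mkQ
        (F.r (e (n + 1)) (x (n + 1)) (h.left_mem (n + 1)) (coinvE F S γ e (n + 1) c) +
        F.r (e n) (x (n + 1)) (h.right_mem n) (coinvE F S γ e n c)) := by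
  suffices coinvV F S γ x (n + 1) ∘ₗ F.boundary S = (coinvKer F γ (x (n + 1))).mkQ ∘ₗ
      (F.r (e (n + 1)) (x (n + 1)) (h.left_mem (n + 1)) ∘ₗ coinvE F S γ e (n + 1) +
      F.r (e n) (x (n + 1)) (h.right_mem n) ∘ₗ coinvE F S γ e n) from LinearMap.congr_fun this c
  refine chainE_hom_ext h fun m j b => ?_
  simp only [LinearMap.comp_apply, LinearMap.add_apply]
  rw [boundary_chainE, map_add]
  by_cases hm : m = n + 1
  · subst hm
    rw [coinvV_chainV_self, coinvE_chainE_self hF, coinvE_chainE_of_ne (by omega),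
      coinvV_chainV_of_ne (by omega), map_zero, add_zero, add_zero]
  · rw [coinvV_chainV_of_ne hm, coinvE_chainE_of_ne hm, map_zero, zero_add, zero_add]
    by_cases hm' : m = n
    · subst hm'
      rw [coinvV_chainV_self, coinvE_chainE_self hF]
    · rw [coinvV_chainV_of_ne (by omega), coinvE_chainE_of_ne hm', map_zero, map_zero]

/-- The system of equations is triangular: the class at level n enters the equation of level n
together with the class of level n - 1 only. So it is solved outwards from the root, with
`IsTriangular.eq_zero` at each level. -/
theorem IsTriangular.coinvE_eq_zero (hF : F.IsTriangular h) {c : F.C1 S}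
    (hc : ∀ n, coinvV F S γ x n (F.boundary S c) = 0) (n : ℕ) : coinvE F S γ e n c = 0 := by
  induction n with
  | zero =>
    have h1 := hc 0
    rw [coinvV_zero_boundary hF, Submodule.mkQ_apply, Submodule.Quotient.mk_eq_zero] at h1
    exact hF.eq_zero 0 _ h1
  | succ n ih =>
    have h1 := hc (n + 1)
    rw [coinvV_succ_boundary hF, ih, map_zero, add_zero, Submodule.mkQ_apply,
      Submodule.Quotient.mk_eq_zero] at h1
    exact hF.eq_zero _ _ h1

variable (F h) in
/-- The differences of boundaries and their translates under `γ`. -/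
noncomputable def diffRange : Submodule k (F.C0 S) :=
  LinearMap.range ((F.actC0 S (γ ^ (1 : ℤ)) (h.mem_S 1) - LinearMap.id) ∘ₗ F.boundary S)

theorem boundary_chainE_sub_mem (n : ℕ) (j : ℤ) (b : F.onE (e n)) :
    F.boundary S (F.chainE h n j b) - F.boundary S (F.chainE h n 0 b) ∈ diffRange F h := by
  have step : ∀ i : ℤ, F.boundary S (F.chainE h n (1 + i) b) - F.boundary S (F.chainE h n i b) ∈
      diffRange F h := by
    intro i
    refine ⟨F.chainE h n i b, ?_⟩
    rw [LinearMap.comp_apply, LinearMap.sub_apply, LinearMap.id_apply, boundary_chainE, map_add,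
      actC0_chainV, actC0_chainV, boundary_chainE]
  induction j using Int.induction_on with
  | zero => rw [sub_self]; exact zero_mem _
  | succ i ih =>
    have := add_mem (step i) ih
    rwa [sub_add_sub_cancel, add_comm] at this
  | pred i ih =>
    have := sub_mem ih (step (-i - 1))
    rw [add_sub_cancel, sub_sub_sub_cancel_left, ] at this
    simpa using this

open Classical in
-- Modulo `diffRange` every translate may be moved back to the ray, where the contributions of one
-- level add up to the class of c in the coinvariants.
theorem IsTriangular.boundary_mem_diffRange (hF : F.IsTriangular h) {c : F.C1 S}
    (hc : ∀ n, coinvE F S γ e n c = 0) : F.boundary S c ∈ diffRange F h := by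
  -- A chain meets finitely many levels. Allowing every M ≥ N makes the statement stable under
  -- addition of chains.
  have key : ∀ c : F.C1 S, ∃ N, ∀ M ≥ N, F.boundary S c -
      ∑ m ∈ Finset.range M, F.boundary S (F.chainE h m 0 (coinvE F S γ e m c)) ∈ diffRange F h := by
    intro c
    induction c using DirectSum.induction_on with
    | zero => exact ⟨0, fun M _ => by simp⟩
    | add c d hc hd =>
      obtain ⟨N, hN⟩ := hc
      obtain ⟨N', hN'⟩ := hd
      refine ⟨max N N', fun M hM => ?_⟩
      have := add_mem (hN M (le_trans (le_max_left _ _) hM)) (hN' M (le_trans (le_max_right _ _) hM))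
      simp only [map_add, Finset.sum_add_distrib]
      rwa [add_sub_add_comm]
    | of τ v =>
      obtain ⟨m, j, b, hb, -, -⟩ := exists_chainE h τ v
      have hb' : DirectSum.of (fun τ : EdgeIn S => F.onE τ.1) τ v = F.chainE h m j b := hb
      refine ⟨m + 1, fun M hM => ?_⟩
      rw [hb', Finset.sum_eq_single_of_mem m (Finset.mem_range.mpr (by omega)),
        coinvE_chainE_self hF]
      · exact boundary_chainE_sub_mem m j b
      · intro m' _ hm'
        rw [coinvE_chainE_of_ne (Ne.symm hm'), map_zero, map_zero]
  obtain ⟨N, hN⟩ := key c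
  have := hN N le_rfl
  simpa [hc] using this

/-! #### Invariant chains -/

theorem invariant_zpow {z : F.C0 S}
    (hz : F.actC0 S (γ ^ (1 : ℤ)) (h.mem_S 1) z = z) (j : ℤ) :
    F.actC0 S (γ ^ j) (h.mem_S j) z = z := by
  have hcongr : ∀ (g g' : G p) (_ : g = g') (hg : ∀ y ∈ S, g • y ∈ S) (hg' : ∀ y ∈ S, g' • y ∈ S)
      (z : F.C0 S), F.actC0 S g hg z = F.actC0 S g' hg' z := by
    rintro g _ rfl _ _ _
    rfl
  have hadd : ∀ i j : ℤ, F.actC0 S (γ ^ (i + j)) (h.mem_S _) z =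
      F.actC0 S (γ ^ i) (h.mem_S i) (F.actC0 S (γ ^ j) (h.mem_S j) z) := by
    intro i j
    rw [← actC0_mul _ _ _ _ (by rw [← zpow_add]; exact h.mem_S _)]
    exact hcongr _ _ (zpow_add _ _ _) _ _ _
  have h0 : F.actC0 S (γ ^ (0 : ℤ)) (h.mem_S 0) z = z := by
    rw [hcongr _ 1 (zpow_zero γ) _ (by simp), actC0_one]
  induction j using Int.induction_on with
  | zero => exact h0
  | succ i ih => rw [hadd, hz, ih]
  | pred i ih =>
    have h1 := hadd (-i - 1) 1
    rw [hcongr _ _ (by rw [sub_add_cancel]) _ (h.mem_S (-i)), hz, ih] at h1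
    exact h1.symm

theorem comp_of_invariant (h : IsCyclicTree S γ x e) {z : F.C0 S}
    (hz : ∀ j : ℤ, F.actC0 S (γ ^ j) (h.mem_S j) z = z) (n : ℕ) (j : ℤ) :
    comp ⟨γ ^ j • x n, h.smul_mem n j⟩ z =
      F.actV (γ ^ j) rfl (comp ⟨x n, h.base_mem n⟩ z) := by
  conv_lhs => rw [← hz j]
  exact comp_actC0 (γ ^ j) (h.mem_S j) ⟨x n, h.base_mem n⟩ z

theorem comp_fixed (h : IsCyclicTree S γ x e) {z : F.C0 S} (hz : ∀ j : ℤ, F.actC0 S (γ ^ j) (h.mem_S j) z = z) (n : ℕ)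
    (i : ℤ) (hi : γ ^ i • x n = x n) :
    F.actV (γ ^ i) hi (comp ⟨x n, h.base_mem n⟩ z) =
      comp ⟨x n, h.base_mem n⟩ z := by
  have h1 := comp_of_invariant h hz n i
  have : ∀ (y : Vertex p) (hy : γ ^ i • x n = y) (hS : y ∈ S),
      comp ⟨y, hS⟩ z = F.actV (γ ^ i) hy (comp ⟨x n, h.base_mem n⟩ z) := by
    rintro y rfl hS
    exact h1
  exact (this _ hi _).symm

theorem exists_level_bound (h : IsCyclicTree S γ x e) (z : F.C0 S) :
    ∃ N, ∀ m > N, ∀ j : ℤ, comp ⟨γ ^ j • x m, h.smul_mem m j⟩ z = 0 := by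
  classical
  induction z using DirectSum.induction_on with
  | zero => exact ⟨0, fun m _ j => map_zero _⟩
  | add c d hc hd =>
    obtain ⟨N, hN⟩ := hc
    obtain ⟨N', hN'⟩ := hd
    refine ⟨max N N', fun m hm j => ?_⟩
    rw [map_add, hN m (lt_of_le_of_lt (le_max_left _ _) hm),
      hN' m (lt_of_le_of_lt (le_max_right _ _) hm), add_zero]
  | of y v =>
    obtain ⟨n, i, hn⟩ := h.exists_eq y.1 y.2
    refine ⟨n, fun m hm j => ?_⟩
    have := comp_ofV_of_ne (F := F) (y := ⟨γ ^ j • x m, h.smul_mem m j⟩) (z := y) (fun h1 => by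
      have := h.level_eq' (hn.trans (congrArg Subtype.val h1))
      omega) v
    exact this

theorem comp_chainV_base (n : ℕ) (v : F.onV (x n)) :
    comp ⟨x n, h.base_mem n⟩ (F.chainV h n 0 v) = v := by
  have : ∀ (g : G p) (_ : g = 1) (hS : g • x n ∈ S) (h₁ : x n ∈ S),
      comp ⟨x n, h₁⟩ (F.ofV S ⟨g • x n, hS⟩ (F.actV g rfl v)) = v := by
    rintro _ rfl hS h₁
    rw [ofV_actV_congr 1 (x n) rfl (one_smul _ _) hS h₁, comp_ofV_self, F.actV_one]
  exact this _ (zpow_zero γ) _ _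

/-- Induction on the outermost level. The value at the last ray vertex is fixed by its stabilizer,
hence comes from the edge leading to it; subtracting the boundary of the orbit sum of that edge
keeps z invariant and clears the level. -/
theorem IsTriangular.invariant_aux (hF : F.IsTriangular h) (n : ℕ) (z : F.C0 S)
    (hz : ∀ j : ℤ, F.actC0 S (γ ^ j) (h.mem_S j) z = z)
    (hn : ∀ m > n, ∀ j : ℤ, comp ⟨γ ^ j • x m, h.smul_mem m j⟩ z = 0) :
    ∃ v : F.onV (x 0), (∀ (i : ℤ) (hi : γ ^ i • x 0 = x 0), F.actV (γ ^ i) hi v = v) ∧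
      z - F.chainV h 0 0 v ∈ LinearMap.range (F.boundary S) := by
  induction n generalizing z with
  | zero =>
    refine ⟨_, comp_fixed h hz 0, ?_⟩
    rw [sub_eq_zero.mpr]
    · exact zero_mem _
    refine C0_ext fun y => ?_
    obtain ⟨y, hy⟩ := y
    obtain ⟨m, j, rfl⟩ := h.exists_eq y hy
    rcases Nat.eq_zero_or_pos m with rfl | hm
    · have h1 : γ ^ j • x 0 = γ ^ (0 : ℤ) • x 0 := by
        rw [zpow_zero, one_smul, h.smul_eq_iff]
        simp
      have : ∀ (y : Vertex p) (hy : y = γ ^ (0 : ℤ) • x 0) (hS : y ∈ S),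
          comp ⟨y, hS⟩ z = comp ⟨y, hS⟩ (F.chainV h 0 0
            (comp ⟨x 0, h.base_mem 0⟩ z)) := by
        rintro y rfl hS
        rw [comp_chainV_self, comp_of_invariant h hz]
      exact this _ h1 _
    · rw [hn m hm, comp_chainV_of_ne]
      intro h1
      have := h.level_eq' h1
      omega
  | succ n ih =>
    obtain ⟨b, hb⟩ := hF.mem_range n _ (comp_fixed h hz (n + 1))
    -- The sum over the orbit of `e n`, which has p ^ (n + 1) elements. Translation by γ telescopes,
    -- and the two ends agree since γ ^ p ^ (n + 1) fixes the edge and its values.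
    let c : F.C1 S := ∑ i ∈ Finset.range (p ^ (n + 1)), F.chainE h n (i : ℤ) b
    have hc : ∀ j : ℤ, F.actC0 S (γ ^ j) (h.mem_S j) (F.boundary S c) = F.boundary S c := by
      refine invariant_zpow (h := h) ?_
      have h2 : ∀ i : ℤ, F.actC0 S (γ ^ (1 : ℤ)) (h.mem_S 1) (F.boundary S (F.chainE h n i b)) =
          F.boundary S (F.chainE h n (i + 1) b) := by
        intro i
        rw [boundary_chainE, map_add, actC0_chainV, actC0_chainV, boundary_chainE, add_comm 1 i]
      simp only [c, map_sum, h2]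
      rw [← sub_eq_zero, ← Finset.sum_sub_distrib]
      have h3 := Finset.sum_range_sub (fun i : ℕ => F.boundary S (F.chainE h n (i : ℤ) b))
        (p ^ (n + 1))
      simp only [Nat.cast_add, Nat.cast_one, Nat.cast_zero] at h3
      rw [h3, sub_eq_zero]
      congr 1
      have h4 := hF.chainE_eq n 0 ((p ^ (n + 1) : ℕ) : ℤ)
        (h.fixes_edge ((h.smul_eq_iff _ _).mpr dvd_rfl)) b
      rwa [zero_add] at h4
    have hlev : ∀ m > n, ∀ j : ℤ,
        comp ⟨γ ^ j • x m, h.smul_mem m j⟩ (z - F.boundary S c) = 0 := by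
      intro m hm j
      rw [comp_of_invariant h (fun j => by rw [map_sub, hz, hc])]
      suffices comp ⟨x m, h.base_mem m⟩ (z - F.boundary S c) = 0 by
        rw [this, map_zero]
      have h0 : F.boundary S c = ∑ i ∈ Finset.range (p ^ (n + 1)),
          (F.chainV h n i (F.r (e n) (x n) (h.left_mem n) b) +
            F.chainV h (n + 1) i (comp ⟨x (n + 1), h.base_mem (n + 1)⟩ z)) := by
        simp only [c, map_sum, boundary_chainE, hb]
      rw [map_sub, h0, map_sum, sub_eq_zero]
      simp only [map_add]
      have h1 : ∀ i : ℕ, comp ⟨x m, h.base_mem m⟩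
          (F.chainV h n i (F.r (e n) (x n) (h.left_mem n) b)) = 0 := fun i =>
        comp_chainV_of_ne (fun h1 => by have := h.level_eq h1; omega) _
      simp only [h1, zero_add]
      rcases Nat.lt_or_ge (n + 1) m with hm' | hm'
      · rw [Finset.sum_eq_zero fun i _ =>
          comp_chainV_of_ne (fun h1 => by have := h.level_eq h1; omega) _]
        have h2 := hn m hm' 0
        rw [comp_of_invariant h hz] at h2
        have h3 := actV_inv_actV (F := F) (γ ^ (0 : ℤ)) rfl (inv_smul_smul _ _)
          (comp ⟨x m, h.base_mem m⟩ z)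
        rw [h2, map_zero] at h3
        exact h3.symm
      · obtain rfl : m = n + 1 := by omega
        rw [Finset.sum_eq_single_of_mem 0
          (Finset.mem_range.mpr (pow_pos (Fact.out : p.Prime).pos _))]
        · exact (comp_chainV_base (n + 1) _).symm
        · intro i hi hi0
          refine comp_chainV_of_ne (fun h1 => hi0 ?_) _
          have h2 := Int.natCast_dvd_natCast.mp ((h.smul_eq_iff _ _).mp h1)
          exact Nat.eq_zero_of_dvd_of_lt h2 (Finset.mem_range.mp hi)
    obtain ⟨v, hv, h1⟩ := ih (z - F.boundary S c) (fun j => by rw [map_sub, hz, hc]) hlev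
    refine ⟨v, hv, ?_⟩
    have := add_mem h1 ⟨c, rfl⟩
    rwa [sub_right_comm, sub_add_cancel] at this

/-- The boundary γz - z has zero coinvariants, so it equals (γ - 1)∂d for some d. Thus the invariant
class has the invariant representative z - ∂d, to which `invariant_aux` applies. -/
theorem IsTriangular.exists_of_invariant (hF : F.IsTriangular h) {z : F.C0 S}
    (hz : F.actC0 S (γ ^ (1 : ℤ)) (h.mem_S 1) z - z ∈ LinearMap.range (F.boundary S)) :
    ∃ v : F.onV (x 0), (∀ (i : ℤ) (hi : γ ^ i • x 0 = x 0), F.actV (γ ^ i) hi v = v) ∧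
      z - F.chainV h 0 0 v ∈ LinearMap.range (F.boundary S) := by
  obtain ⟨c, hc⟩ := hz
  obtain ⟨d, hd⟩ := hF.boundary_mem_diffRange (c := c) (hF.coinvE_eq_zero fun n => by
    rw [hc, map_sub, coinvV_actC0 h, sub_self])
  have h1 : F.actC0 S (γ ^ (1 : ℤ)) (h.mem_S 1) (z - F.boundary S d) = z - F.boundary S d := by
    rw [← sub_eq_zero, map_sub, sub_sub_sub_comm, ← hc, ← hd]
    simp
  obtain ⟨N, hN⟩ := exists_level_bound h (z - F.boundary S d)
  obtain ⟨v, hv, h2⟩ := hF.invariant_aux N _ (invariant_zpow (h := h) h1) hN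
  refine ⟨v, hv, ?_⟩
  have := add_mem h2 ⟨d, rfl⟩
  rwa [sub_right_comm, sub_add_cancel] at this

end CoeffSystem
end SL2Tree

namespace SL2Tree

noncomputable section

/-! ### Vertices of the tree as cosets in `GL₂(ℚ_p)` -/

section Frames

variable {p : ℕ} [Fact p.Prime]

/-- A basis of the plane, given by the columns of an invertible matrix. -/
abbrev Frame (p : ℕ) [Fact p.Prime] : Type := GL (Fin 2) ℚ_[p]

theorem frame_inv_mulVec (P : Frame p) (v : Plane p) :
    (P⁻¹ : Frame p).1.mulVec (P.1.mulVec v) = v := by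
  rw [Matrix.mulVec_mulVec, ← Units.val_mul, inv_mul_cancel, Units.val_one, Matrix.one_mulVec]

theorem frame_mulVec_inv (P : Frame p) (v : Plane p) :
    P.1.mulVec ((P⁻¹ : Frame p).1.mulVec v) = v := by
  rw [Matrix.mulVec_mulVec, ← Units.val_mul, mul_inv_cancel, Units.val_one, Matrix.one_mulVec]

theorem mulVec_eq_sum_col (A : Matrix (Fin 2) (Fin 2) ℚ_[p]) (v : Plane p) :
    A.mulVec v = ∑ i, v i • A.col i := by
  ext j
  simp [Matrix.mulVec, dotProduct, Matrix.col, mul_comm]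

theorem mem_span_col (P : Frame p) (v : Plane p) :
    v ∈ Submodule.span ℤ_[p] (Set.range P.1.col) ↔
      ∀ i, ‖(P⁻¹ : Frame p).1.mulVec v i‖ ≤ 1 := by
  rw [Submodule.mem_span_range_iff_exists_fun]
  constructor
  · rintro ⟨c, rfl⟩ i
    have h : ∑ i, c i • P.1.col i = P.1.mulVec (fun i => (c i : ℚ_[p])) := by
      rw [mulVec_eq_sum_col]; rfl
    rw [h, frame_inv_mulVec]
    exact (c i).2
  · intro h
    refine ⟨fun i => ⟨_, h i⟩, ?_⟩
    conv_rhs => rw [← frame_mulVec_inv P v, mulVec_eq_sum_col]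
    rfl

/-- The lattice spanned by a frame. -/
def lat (P : Frame p) : Lat p :=
  ⟨Submodule.span ℤ_[p] (Set.range P.1.col),
    { fg := Submodule.fg_span (Set.finite_range _)
      span_eq_top := by
        rw [eq_top_iff]
        intro v _
        rw [← frame_mulVec_inv P v, mulVec_eq_sum_col]
        exact sum_mem fun i _ => Submodule.smul_mem _ _
          (Submodule.subset_span (Submodule.subset_span ⟨i, rfl⟩)) }⟩

theorem mem_lat (P : Frame p) (v : Plane p) :
    v ∈ (lat P).1 ↔ ∀ i, ‖(P⁻¹ : Frame p).1.mulVec v i‖ ≤ 1 := mem_span_col P v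

/-- The vertex defined by a frame. -/
def vtx (P : Frame p) : Vertex p := cls (lat P)

theorem mem_units_smul (c : ℚ_[p]ˣ) (M : Submodule ℤ_[p] (Plane p)) (v : Plane p) :
    v ∈ c • M ↔ (c⁻¹ : ℚ_[p]ˣ) • v ∈ M := by
  constructor
  · rintro ⟨w, hw, rfl⟩
    change (c⁻¹ : ℚ_[p]ˣ) • c • w ∈ M
    rwa [inv_smul_smul]
  · intro h
    exact ⟨(c⁻¹ : ℚ_[p]ˣ) • v, h, smul_inv_smul c v⟩

theorem norm_add_le_of_le {x y : ℚ_[p]} {C : ℝ} (hx : ‖x‖ ≤ C) (hy : ‖y‖ ≤ C) : ‖x + y‖ ≤ C :=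
  (Padic.nonarchimedean x y).trans (max_le hx hy)

theorem norm_sub_le_of_le {x y : ℚ_[p]} {C : ℝ} (hx : ‖x‖ ≤ C) (hy : ‖y‖ ≤ C) : ‖x - y‖ ≤ C := by
  rw [sub_eq_add_neg]
  exact norm_add_le_of_le hx (by rwa [norm_neg])

theorem cls_eq_iff (M M' : Lat p) : cls M = cls M' ↔ ∃ c : ℚ_[p]ˣ, M'.1 = c • M.1 :=
  ⟨fun h => Quotient.exact (s := homothety p) h, fun h => Quotient.sound (s := homothety p) h⟩

theorem smul_vtx (g : G p) (P : Frame p) : g • vtx P = vtx (Matrix.SpecialLinearGroup.toGL g * P) := by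
  rw [vtx, smul_cls, vtx]
  congr 1
  apply Subtype.ext
  ext v
  change v ∈ g • (lat P).1 ↔ _
  rw [Submodule.mem_smul_pointwise_iff_exists]
  have h1 : ∀ w, w = g⁻¹ • v → ((Matrix.SpecialLinearGroup.toGL g * P)⁻¹ : Frame p).1.mulVec v =
      (P⁻¹ : Frame p).1.mulVec w := by
    rintro w rfl
    rw [mul_inv_rev, Units.val_mul, ← Matrix.mulVec_mulVec, ← map_inv]
    rfl
  rw [mem_lat]
  constructor
  · rintro ⟨w, hw, rfl⟩
    rw [h1 w (inv_smul_smul g w).symm]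
    exact (mem_lat P w).mp hw
  · intro h
    refine ⟨g⁻¹ • v, ?_, smul_inv_smul g v⟩
    rw [mem_lat, ← h1 _ rfl]
    exact h

/-- The coordinates `(x, y)` with respect to the frame `P`. -/
def vec (P : Frame p) (x y : ℚ_[p]) : Plane p := P.1.mulVec ![x, y]

theorem vec_surjective (P : Frame p) (v : Plane p) : ∃ x y, v = vec P x y := by
  refine ⟨(P⁻¹ : Frame p).1.mulVec v 0, (P⁻¹ : Frame p).1.mulVec v 1, ?_⟩
  rw [vec]
  conv_lhs => rw [← frame_mulVec_inv P v]
  congr 1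
  ext i
  fin_cases i <;> rfl

theorem vec_add (P : Frame p) (x y x' y' : ℚ_[p]) :
    vec P x y + vec P x' y' = vec P (x + x') (y + y') := by
  rw [vec, vec, vec, ← Matrix.mulVec_add]
  simp

theorem smul_vec (P : Frame p) (c x y : ℚ_[p]) : c • vec P x y = vec P (c * x) (c * y) := by
  rw [vec, vec, ← Matrix.mulVec_smul]
  simp

/-- The matrix `[[a, t], [0, 1]]`. -/
def aff (a : ℚ_[p]ˣ) (t : ℚ_[p]) : Frame p where
  val := !![(a : ℚ_[p]), t; 0, 1]
  inv := !![((a⁻¹ : ℚ_[p]ˣ) : ℚ_[p]), -((a⁻¹ : ℚ_[p]ˣ) : ℚ_[p]) * t; 0, 1]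
  val_inv := by
    rw [Matrix.mul_fin_two]
    ext i j
    fin_cases i <;> fin_cases j <;> simp
  inv_val := by
    rw [Matrix.mul_fin_two]
    ext i j
    fin_cases i <;> fin_cases j <;> simp

theorem aff_mul (a b : ℚ_[p]ˣ) (t s : ℚ_[p]) : aff a t * aff b s = aff (a * b) (a * s + t) := by
  apply Units.ext
  change !![(a : ℚ_[p]), t; 0, 1] * !![(b : ℚ_[p]), s; 0, 1] = _
  rw [Matrix.mul_fin_two]
  simp [aff]

theorem aff_one_zero : aff (1 : ℚ_[p]ˣ) 0 = 1 := by
  apply Units.ext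
  change !![((1 : ℚ_[p]ˣ) : ℚ_[p]), 0; 0, 1] = _
  rw [Units.val_one]
  exact Matrix.one_fin_two.symm

theorem vec_mul_aff (P : Frame p) (a : ℚ_[p]ˣ) (t x y : ℚ_[p]) :
    vec (P * aff a t) x y = vec P (a * x + t * y) y := by
  rw [vec, vec, Units.val_mul, ← Matrix.mulVec_mulVec]
  congr 1
  change !![(a : ℚ_[p]), t; 0, 1].mulVec ![x, y] = _
  ext i
  fin_cases i <;> simp [Matrix.mulVec, dotProduct]

theorem vec_mem_lat (P : Frame p) (x y : ℚ_[p]) :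
    vec P x y ∈ (lat P).1 ↔ ‖x‖ ≤ 1 ∧ ‖y‖ ≤ 1 := by
  rw [mem_lat, vec, frame_inv_mulVec, Fin.forall_fin_two]
  rfl

theorem vec_mem_lat_aff (P : Frame p) (a : ℚ_[p]ˣ) (t x y : ℚ_[p]) :
    vec P x y ∈ (lat (P * aff a t)).1 ↔ ‖x - t * y‖ ≤ ‖(a : ℚ_[p])‖ ∧ ‖y‖ ≤ 1 := by
  have h : vec P x y = vec (P * aff a t) (((a⁻¹ : ℚ_[p]ˣ) : ℚ_[p]) * (x - t * y)) y := by
    rw [vec_mul_aff, Units.mul_inv_cancel_left, sub_add_cancel]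
  rw [h, vec_mem_lat, norm_mul, Units.val_inv_eq_inv_val, norm_inv,
    inv_mul_le_one₀ (norm_pos_iff.mpr a.ne_zero)]

/-- Both lattices project onto ℤ_p in the second coordinate, so a homothety between them is by a
unit. Then the fibre over y = 0 compares a with b, and the fibre over y = 1 compares t with s. -/
theorem vtx_aff_eq_iff (P : Frame p) (a b : ℚ_[p]ˣ) (t s : ℚ_[p]) :
    vtx (P * aff a t) = vtx (P * aff b s) ↔
      ‖(a : ℚ_[p])‖ = ‖(b : ℚ_[p])‖ ∧ ‖t - s‖ ≤ ‖(a : ℚ_[p])‖ := by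
  rw [vtx, vtx, cls_eq_iff]
  constructor
  · rintro ⟨c, hc⟩
    have hpos : 0 < ‖(c : ℚ_[p])‖ := norm_pos_iff.mpr c.ne_zero
    have key : ∀ x y, (‖x - s * y‖ ≤ ‖(b : ℚ_[p])‖ ∧ ‖y‖ ≤ 1) ↔
        (‖x - t * y‖ ≤ ‖(c : ℚ_[p])‖ * ‖(a : ℚ_[p])‖ ∧ ‖y‖ ≤ ‖(c : ℚ_[p])‖) := by
      intro x y
      rw [← vec_mem_lat_aff P, hc, mem_units_smul, Units.smul_def, smul_vec, vec_mem_lat_aff,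
        ← mul_assoc, mul_comm t, mul_assoc, ← mul_sub, norm_mul, norm_mul,
        Units.val_inv_eq_inv_val, norm_inv, inv_mul_le_iff₀ hpos, inv_mul_le_iff₀ hpos, mul_one]
    have hc1 : ‖(c : ℚ_[p])‖ = 1 := by
      refine le_antisymm ?_ ?_
      · have := ((key (t * c) c).mpr (by simp)).2
        exact this
      · have := ((key s 1).mp (by simp)).2
        simpa using this
    rw [hc1, one_mul] at key
    have hab : ‖(a : ℚ_[p])‖ = ‖(b : ℚ_[p])‖ := by
      refine le_antisymm ?_ ?_
      · have := ((key a 0).mpr (by simp)).1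
        simpa using this
      · have := ((key b 0).mp (by simp)).1
        simpa using this
    refine ⟨hab, ?_⟩
    have := ((key s 1).mp (by simp)).1
    rwa [mul_one, norm_sub_rev] at this
  · rintro ⟨hab, hts⟩
    refine ⟨1, ?_⟩
    rw [one_smul]
    ext v
    obtain ⟨x, y, rfl⟩ := vec_surjective P v
    rw [vec_mem_lat_aff, vec_mem_lat_aff, ← hab]
    refine and_congr_left fun hy => ?_
    have h1 : ‖(t - s) * y‖ ≤ ‖(a : ℚ_[p])‖ := by
      rw [norm_mul]
      exact (mul_le_of_le_one_right (norm_nonneg _) hy).trans hts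
    constructor
    · intro h
      rw [show x - t * y = (x - s * y) - (t - s) * y by ring]
      exact norm_sub_le_of_le h h1
    · intro h
      rw [show x - s * y = (x - t * y) + (t - s) * y by ring]
      exact norm_add_le_of_le h h1

theorem norm_pUnit : ‖((pUnit p : ℚ_[p]ˣ) : ℚ_[p])‖ = (p : ℝ)⁻¹ := Padic.norm_p

theorem norm_pUnit_lt_one : ‖((pUnit p : ℚ_[p]ˣ) : ℚ_[p])‖ < 1 := Padic.norm_p_lt_one

theorem norm_lt_one_iff (x : ℚ_[p]) : ‖x‖ < 1 ↔ ‖x‖ ≤ ‖((pUnit p : ℚ_[p]ˣ) : ℚ_[p])‖ := by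
  have := Padic.norm_le_pow_iff_norm_lt_pow_add_one x (-1)
  rw [norm_pUnit]
  simpa using this.symm

theorem adj_aff (P : Frame p) (a : ℤ_[p]) :
    (tree p).Adj (vtx P) (vtx (P * aff (pUnit p) a)) := by
  refine ⟨lat P, lat (P * aff (pUnit p) a), rfl, rfl, ?_, ?_⟩
  · rw [SetLike.lt_iff_le_and_exists]
    constructor
    · intro v
      obtain ⟨x, y, rfl⟩ := vec_surjective P v
      rw [mem_units_smul, Units.smul_def, smul_vec, vec_mem_lat, vec_mem_lat_aff, norm_mul,
        norm_mul, Units.val_inv_eq_inv_val, norm_inv,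
        inv_mul_le_one₀ (norm_pos_iff.mpr (pUnit p).ne_zero),
        inv_mul_le_one₀ (norm_pos_iff.mpr (pUnit p).ne_zero)]
      rintro ⟨hx, hy⟩
      refine ⟨norm_sub_le_of_le hx ?_, hy.trans norm_pUnit_lt_one.le⟩
      rw [norm_mul]
      exact (mul_le_of_le_one_left (norm_nonneg _) a.2).trans hy
    · refine ⟨vec P a 1, ?_, ?_⟩
      · rw [vec_mem_lat_aff]
        simp
      · rw [mem_units_smul, Units.smul_def, smul_vec, vec_mem_lat, norm_mul, norm_mul,
          Units.val_inv_eq_inv_val, norm_inv,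
          inv_mul_le_one₀ (norm_pos_iff.mpr (pUnit p).ne_zero),
          inv_mul_le_one₀ (norm_pos_iff.mpr (pUnit p).ne_zero)]
        rintro ⟨-, h⟩
        rw [norm_one] at h
        exact absurd norm_pUnit_lt_one (not_lt.mpr h)
  · rw [SetLike.lt_iff_le_and_exists]
    constructor
    · intro v
      obtain ⟨x, y, rfl⟩ := vec_surjective P v
      rw [vec_mem_lat, vec_mem_lat_aff]
      rintro ⟨hx, hy⟩
      refine ⟨?_, hy⟩
      rw [show x = (x - a * y) + a * y by ring]
      refine norm_add_le_of_le (hx.trans norm_pUnit_lt_one.le) ?_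
      rw [norm_mul]
      exact mul_le_one₀ a.2 (norm_nonneg _) hy
    · refine ⟨vec P 1 0, ?_, ?_⟩
      · rw [vec_mem_lat]; simp
      · rw [vec_mem_lat_aff]
        rintro ⟨h, -⟩
        rw [mul_zero, sub_zero, norm_one] at h
        exact absurd norm_pUnit_lt_one (not_lt.mpr h)

/-- Neighbours correspond to lines in the reduction of the lattice modulo p. Either the line
contains a vector (a, 1), or it is spanned by (1, 0). -/
theorem eq_of_adj (P : Frame p) {y : Vertex p} (h : (tree p).Adj (vtx P) y) :
    y = vtx (P * aff (pUnit p)⁻¹ 0) ∨ ∃ a : ℤ_[p], y = vtx (P * aff (pUnit p) a) := by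
  obtain ⟨M, M', hM, rfl, h1, h2⟩ := h
  obtain ⟨c, hc⟩ := (cls_eq_iff _ _).mp hM
  -- Rescaling puts L strictly between p times the lattice of P and that lattice itself.
  obtain ⟨L, hM', hL⟩ : ∃ L : Lat p, cls M' = cls L ∧ L.1 = c • M'.1 := by
    have : Submodule.IsLattice ℚ_[p] (c • M'.1) := by have := M'.2; infer_instance
    exact ⟨⟨_, this⟩, (cls_eq_iff _ _).mpr ⟨c, rfl⟩, rfl⟩
  have h1' := smul_lt c h1
  have h2' := smul_lt c h2
  rw [← hc, ← hL] at h2'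
  rw [smul_comm, ← hc, ← hL] at h1'
  rw [hM']
  have hpp : 0 < ‖((pUnit p : ℚ_[p]ˣ) : ℚ_[p])‖ := norm_pos_iff.mpr (pUnit p).ne_zero
  have hsmall : ∀ x y, vec P x y ∈ pUnit p • (lat P).1 ↔ ‖x‖ < 1 ∧ ‖y‖ < 1 := by
    intro x y
    rw [mem_units_smul, Units.smul_def, smul_vec, vec_mem_lat, norm_mul, norm_mul,
      Units.val_inv_eq_inv_val, norm_inv, inv_mul_le_one₀ hpp, inv_mul_le_one₀ hpp,
      norm_lt_one_iff, norm_lt_one_iff]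
  have hint : ∀ x y, vec P x y ∈ L.1 → ‖x‖ ≤ 1 ∧ ‖y‖ ≤ 1 := fun x y hxy =>
    (vec_mem_lat P x y).mp (h2'.le hxy)
  have hadd : ∀ x y x' y', vec P x y ∈ L.1 → vec P x' y' ∈ L.1 → vec P (x + x') (y + y') ∈ L.1 :=
    fun x y x' y' hx hy => by rw [← vec_add]; exact add_mem hx hy
  have hsmul : ∀ c x y : ℚ_[p], ‖c‖ ≤ 1 → vec P x y ∈ L.1 → vec P (c * x) (c * y) ∈ L.1 :=
    fun c x y hc hx => by rw [← smul_vec]; exact L.1.smul_mem (⟨c, hc⟩ : ℤ_[p]) hx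
  have hp' : ∀ x y, ‖x‖ < 1 → ‖y‖ < 1 → vec P x y ∈ L.1 := fun x y hx hy =>
    h1'.le ((hsmall x y).mpr ⟨hx, hy⟩)
  by_cases hA : ∃ x y, vec P x y ∈ L.1 ∧ ‖y‖ = 1
  · right
    obtain ⟨x0, y0, hxy, hy0⟩ := hA
    have hy00 : y0 ≠ 0 := norm_pos_iff.mp (by rw [hy0]; exact one_pos)
    have ha : vec P (y0⁻¹ * x0) 1 ∈ L.1 := by
      have := hsmul y0⁻¹ x0 y0 (by rw [norm_inv, hy0, inv_one]) hxy
      rwa [inv_mul_cancel₀ hy00] at this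
    set a := y0⁻¹ * x0 with haa
    have hna : ‖a‖ ≤ 1 := (hint _ _ ha).1
    refine ⟨⟨a, hna⟩, ?_⟩
    rw [vtx]
    congr 1
    apply Subtype.ext
    ext v
    obtain ⟨x, y, rfl⟩ := vec_surjective P v
    rw [vec_mem_lat_aff, ← norm_lt_one_iff]
    change vec P x y ∈ L.1 ↔ ‖x - a * y‖ < 1 ∧ ‖y‖ ≤ 1
    constructor
    · intro hv
      have hy := (hint _ _ hv).2
      refine ⟨?_, hy⟩
      by_contra hcon
      have h3 : vec P (x - a * y) 0 ∈ L.1 := by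
        have := hadd _ _ _ _ hv (hsmul (-y) a 1 (by rwa [norm_neg]) ha)
        rwa [mul_one, add_neg_cancel, show x + -y * a = x - a * y by ring] at this
      have h4 : ‖x - a * y‖ = 1 := le_antisymm (hint _ _ h3).1 (not_lt.mp hcon)
      have h5 : vec P 1 0 ∈ L.1 := by
        have := hsmul (x - a * y)⁻¹ _ _ (by rw [norm_inv, h4, inv_one]) h3
        rwa [mul_zero, inv_mul_cancel₀ (norm_pos_iff.mp (by rw [h4]; exact one_pos))] at this
      refine not_le_of_gt h2' fun w hw => ?_
      obtain ⟨x', y', rfl⟩ := vec_surjective P w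
      obtain ⟨hx', hy'⟩ := (vec_mem_lat _ _ _).mp hw
      have h6 : ‖x' - y' * a‖ ≤ 1 := norm_sub_le_of_le hx' (by
        rw [norm_mul]; exact mul_le_one₀ hy' (norm_nonneg _) hna)
      have := hadd _ _ _ _ (hsmul _ _ _ hy' ha) (hsmul _ _ _ h6 h5)
      rwa [mul_one, mul_one, mul_zero, add_zero, add_sub_cancel] at this
    · rintro ⟨hx, hy⟩
      have := hadd _ _ _ _ (hsmul y a 1 hy ha) (hp' (x - a * y) 0 hx (by simp))
      rwa [mul_one, add_zero, mul_comm y, add_sub_cancel] at this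
  · left
    push Not at hA
    have hy1 : ∀ x y, vec P x y ∈ L.1 → ‖y‖ < 1 := fun x y hv =>
      lt_of_le_of_ne (hint _ _ hv).2 (hA x y hv)
    obtain ⟨w, hwN, hwp⟩ := (SetLike.lt_iff_le_and_exists.mp h1').2
    obtain ⟨x0, y0, rfl⟩ := vec_surjective P w
    have hx0 : ‖x0‖ = 1 := by
      refine le_antisymm (hint _ _ hwN).1 (not_lt.mp fun hlt => hwp ?_)
      exact (hsmall _ _).mpr ⟨hlt, hy1 _ _ hwN⟩
    have h5 : vec P 1 0 ∈ L.1 := by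
      have h3 := hadd _ _ _ _ hwN (hp' 0 (-y0) (by simp) (by rw [norm_neg]; exact hy1 _ _ hwN))
      rw [add_zero, add_neg_cancel] at h3
      have := hsmul x0⁻¹ _ _ (by rw [norm_inv, hx0, inv_one]) h3
      rwa [mul_zero, inv_mul_cancel₀ (norm_pos_iff.mp (by rw [hx0]; exact one_pos))] at this
    rw [vtx, eq_comm, cls_eq_iff]
    -- Here L is spanned by f₀ and p f₁, which is p times the lattice spanned by p⁻¹f₀ and f₁.
    refine ⟨pUnit p, ?_⟩
    ext v
    obtain ⟨x, y, rfl⟩ := vec_surjective P v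
    rw [mem_units_smul, Units.smul_def, smul_vec, vec_mem_lat_aff, zero_mul, sub_zero, norm_mul,
      norm_mul, Units.val_inv_eq_inv_val, norm_inv, inv_mul_le_one₀ hpp, ← norm_lt_one_iff,
      mul_le_iff_le_one_right (inv_pos.mpr hpp)]
    constructor
    · intro hv
      exact ⟨(hint _ _ hv).1, hy1 _ _ hv⟩
    · rintro ⟨hx, hy⟩
      have := hadd _ _ _ _ (hsmul x 1 0 hx h5) (hp' 0 y (by simp) hy)
      rwa [mul_one, mul_zero, add_zero, zero_add] at this

end Frames

end

end SL2Tree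

namespace SL2Tree

noncomputable section

/-! ### The half tree -/

section HalfTree

variable {p : ℕ} [Fact p.Prime]

/-- The element of `G` which acts in the frame `P` by the matrix `g`. -/
def conj (P : Frame p) : G p →* G p where
  toFun g := ⟨P.1 * g.1 * (P⁻¹ : Frame p).1, by
    rw [Matrix.det_mul, Matrix.det_mul, g.2, mul_one, ← Matrix.det_mul, ← Units.val_mul,
      mul_inv_cancel, Units.val_one, Matrix.det_one]⟩
  map_one' := by
    apply Subtype.ext
    change P.1 * 1 * (P⁻¹ : Frame p).1 = 1
    rw [mul_one, ← Units.val_mul, mul_inv_cancel, Units.val_one]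
  map_mul' g h := by
    apply Subtype.ext
    change P.1 * (g.1 * h.1) * (P⁻¹ : Frame p).1 =
      (P.1 * g.1 * (P⁻¹ : Frame p).1) * (P.1 * h.1 * (P⁻¹ : Frame p).1)
    have : (P⁻¹ : Frame p).1 * P.1 = 1 := by rw [← Units.val_mul, inv_mul_cancel, Units.val_one]
    rw [mul_assoc (P.1 * g.1), ← mul_assoc (P⁻¹ : Frame p).1, ← mul_assoc (P⁻¹ : Frame p).1, this,
      one_mul]
    simp only [mul_assoc]

theorem toGL_conj (P : Frame p) (g : G p) :
    Matrix.SpecialLinearGroup.toGL (conj P g) = P * Matrix.SpecialLinearGroup.toGL g * P⁻¹ :=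
  Units.ext rfl

theorem conj_smul_vtx (P : Frame p) (g : G p) (Q : Frame p) :
    conj P g • vtx (P * Q) = vtx (P * (Matrix.SpecialLinearGroup.toGL g * Q)) := by
  rw [smul_vtx, toGL_conj]
  congr 1
  group

theorem toGL_upper (t : ℚ_[p]) : Matrix.SpecialLinearGroup.toGL (upper t) = aff 1 t := by
  apply Units.ext
  change !![1, t; 0, 1] = !![((1 : ℚ_[p]ˣ) : ℚ_[p]), t; 0, 1]
  rw [Units.val_one]

theorem conj_upper_smul (P : Frame p) (u : ℚ_[p]) (a : ℚ_[p]ˣ) (t : ℚ_[p]) :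
    conj P (upper u) • vtx (P * aff a t) = vtx (P * aff a (t + u)) := by
  rw [conj_smul_vtx, toGL_upper, aff_mul, one_mul, Units.val_one, one_mul]

theorem upper_zpow {R : Type*} [CommRing R] (a : R) (j : ℤ) : upper a ^ j = upper (j * a) := by
  induction j using Int.induction_on with
  | zero => rw [zpow_zero, Int.cast_zero, zero_mul, upper_zero]
  | succ i ih => rw [zpow_add, ih, zpow_one, upper_mul]; congr 1; push_cast; ring
  | pred i ih =>
    rw [zpow_sub, ih, zpow_one, mul_inv_eq_iff_eq_mul, upper_mul]; congr 1; push_cast; ring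

/-- The vertex `[p ^ n f₀, f₁ + t f₀]` for the frame `(f₀, f₁)`. -/
def level (P : Frame p) (n : ℤ) (t : ℚ_[p]) : Vertex p := vtx (P * aff (pUnit p ^ n) t)

theorem norm_pUnit_zpow (n : ℤ) : ‖((pUnit p ^ n : ℚ_[p]ˣ) : ℚ_[p])‖ = (p : ℝ) ^ (-n) := by
  rw [Units.val_zpow_eq_zpow_val, norm_zpow, norm_pUnit, inv_zpow, zpow_neg]

theorem level_eq_iff (P : Frame p) (n m : ℤ) (t s : ℚ_[p]) :
    level P n t = level P m s ↔ n = m ∧ ‖t - s‖ ≤ (p : ℝ) ^ (-n) := by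
  have hp : (1 : ℝ) < p := by exact_mod_cast (Fact.out : p.Prime).one_lt
  rw [level, level, vtx_aff_eq_iff, norm_pUnit_zpow, norm_pUnit_zpow]
  refine and_congr_left fun _ => ?_
  rw [zpow_right_inj₀ (by positivity) hp.ne', neg_inj]

theorem adj_level (P : Frame p) (n : ℤ) (t : ℚ_[p]) (a : ℤ_[p]) :
    (tree p).Adj (level P n t) (level P (n + 1) (t + (pUnit p ^ n : ℚ_[p]ˣ) * a)) := by
  have := adj_aff (P * aff (pUnit p ^ n) t) a
  rw [mul_assoc, aff_mul, ← zpow_add_one, add_comm _ t] at this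
  exact this

theorem adj_level_self (P : Frame p) (n : ℤ) (t : ℚ_[p]) :
    (tree p).Adj (level P n t) (level P (n + 1) t) := by
  simpa using adj_level P n t 0

theorem eq_level_of_adj (P : Frame p) {n : ℤ} {t : ℚ_[p]} {y : Vertex p}
    (h : (tree p).Adj (level P n t) y) :
    y = level P (n - 1) t ∨ ∃ a : ℤ_[p], y = level P (n + 1) (t + (pUnit p ^ n : ℚ_[p]ˣ) * a) := by
  rcases eq_of_adj _ h with h | ⟨a, h⟩
  · left
    rw [h, mul_assoc, aff_mul, mul_zero, zero_add, ← zpow_sub_one]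
    rfl
  · right
    refine ⟨a, ?_⟩
    rw [h, mul_assoc, aff_mul, ← zpow_add_one, add_comm _ t]
    rfl

/-- A walk can leave the set on the right only through an edge from level 0 to level -1, and at
level -1 all t in ℤ_p give the same vertex, the excluded one. Conversely every level is reached by
increasing n with t fixed. -/
theorem mem_halfTree_iff (P : Frame p) (y : Vertex p) :
    y ∈ halfTree (level P 0 0) (level P (-1) 0) ↔ ∃ (n : ℕ) (t : ℤ_[p]), y = level P n t := by
  have hp : (1 : ℝ) ≤ p := by exact_mod_cast (Fact.out : p.Prime).one_lt.le
  have hroot : ∀ t : ℤ_[p], level P (-1) t = level P (-1) 0 := fun t => by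
    rw [level_eq_iff]
    refine ⟨rfl, ?_⟩
    rw [sub_zero, neg_neg, zpow_one]
    exact t.2.trans hp
  constructor
  · rintro ⟨w, hw⟩
    have key : ∀ (u v : Vertex p) (w : (tree p).Walk u v), level P (-1) 0 ∉ w.support →
        (∃ (n : ℕ) (t : ℤ_[p]), u = level P n t) → ∃ (n : ℕ) (t : ℤ_[p]), v = level P n t := by
      intro u v w
      induction w with
      | nil => exact fun _ h => h
      | cons hadj w ih =>
        rintro hsupp ⟨n, t, rfl⟩
        rw [SimpleGraph.Walk.support_cons, List.mem_cons, not_or] at hsupp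
        refine ih hsupp.2 ?_
        rcases eq_level_of_adj P hadj with h | ⟨a, h⟩
        · rcases Nat.eq_zero_or_pos n with rfl | hn
          · exfalso
            apply hsupp.2
            rw [Nat.cast_zero, zero_sub, hroot] at h
            rw [← h]
            exact w.start_mem_support
          · exact ⟨n - 1, t, by rw [h]; congr 1; omega⟩
        · refine ⟨n + 1, t + (p : ℤ_[p]) ^ n * a, ?_⟩
          rw [h]
          congr 1
    exact key _ _ w hw ⟨0, 0, rfl⟩
  · rintro ⟨n, t, rfl⟩
    induction n with
    | zero =>
      refine ⟨(SimpleGraph.Walk.nil : (tree p).Walk (level P 0 0) (level P 0 0)).copy rfl ?_, ?_⟩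
      · rw [level_eq_iff]
        refine ⟨rfl, ?_⟩
        rw [zero_sub, norm_neg, neg_zero, zpow_zero]
        exact t.2
      · rw [SimpleGraph.Walk.support_copy, SimpleGraph.Walk.support_nil, List.mem_singleton,
          level_eq_iff]
        rintro ⟨h, -⟩
        omega
    | succ n ih =>
      obtain ⟨w, hw⟩ := ih
      refine ⟨w.concat (by
        have := adj_level_self P n t
        rwa [Nat.cast_add, Nat.cast_one]), ?_⟩
      rw [SimpleGraph.Walk.support_concat, List.mem_append, not_or]
      refine ⟨hw, ?_⟩
      rw [List.mem_singleton, level_eq_iff]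
      rintro ⟨h, -⟩
      omega

/-- The edge of level `n` in the standard ray. -/
def rayEdge (P : Frame p) (n : ℕ) : Edge p :=
  ⟨s(level P n 0, level P (n + 1 : ℕ) 0), by
    have := adj_level_self P n 0
    rwa [← Nat.cast_one, ← Nat.cast_add] at this⟩

theorem conj_upper_zpow_smul (P : Frame p) (j n : ℤ) (t : ℚ_[p]) :
    conj P (upper 1) ^ j • level P n t = level P n (t + j) := by
  rw [← map_zpow, upper_zpow, mul_one, level, conj_upper_smul, level]

theorem exists_int_level (P : Frame p) (n : ℕ) (t : ℤ_[p]) :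
    ∃ j : ℤ, level P n t = level P n j := by
  refine ⟨t.appr n, ?_⟩
  rw [level_eq_iff]
  refine ⟨rfl, ?_⟩
  have h := (PadicInt.norm_le_pow_iff_mem_span_pow _ n).mpr (PadicInt.appr_spec n t)
  rw [PadicInt.norm_def] at h
  push_cast at h ⊢
  exact h

theorem isCyclicTree (P : Frame p) :
    IsCyclicTree (halfTree (level P 0 0) (level P (-1) 0)) (conj P (upper 1))
      (fun n => level P n 0) (rayEdge P) where
  e_eq n := rfl
  smul_mem n j := by
    rw [conj_upper_zpow_smul, mem_halfTree_iff]
    exact ⟨n, j, by rw [zero_add]; push_cast; rfl⟩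
  exists_eq y hy := by
    obtain ⟨n, t, rfl⟩ := (mem_halfTree_iff P y).mp hy
    obtain ⟨j, hj⟩ := exists_int_level P n t
    refine ⟨n, j, ?_⟩
    rw [hj, conj_upper_zpow_smul, zero_add]
  exists_edge := by
    rintro ⟨⟨τ, hτ⟩, hS⟩
    have key : ∀ u v, (tree p).Adj u v → u ∈ halfTree (level P 0 0) (level P (-1) 0) →
        v ∈ halfTree (level P 0 0) (level P (-1) 0) → ∃ (n : ℕ) (j : ℤ),
        s(level P n j, level P (n + 1 : ℕ) j) = s(u, v) := by
      intro u v huv hu hv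
      obtain ⟨n, t, rfl⟩ := (mem_halfTree_iff P u).mp hu
      rcases eq_level_of_adj P huv with h | ⟨a, h⟩
      · obtain ⟨j, hj⟩ := exists_int_level P n t
        obtain ⟨m, s, hm⟩ := (mem_halfTree_iff P v).mp hv
        rw [hj] at huv ⊢
        rcases eq_level_of_adj P huv with h' | ⟨a', h'⟩
        · rw [hm, level_eq_iff] at h
          refine ⟨m, j, ?_⟩
          rw [Sym2.eq_swap, h', show ((m + 1 : ℕ) : ℤ) = n by omega,
            show (m : ℤ) = n - 1 by omega]
        · rw [h, level_eq_iff] at h'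
          omega
      · obtain ⟨j, hj⟩ := exists_int_level P (n + 1) (t + (p : ℤ_[p]) ^ n * a)
        have h1 : v = level P (n + 1 : ℕ) j := by
          rw [h, ← hj]
          congr 1
        refine ⟨n, j, ?_⟩
        rw [h1]
        have hadj := adj_level_self P n j
        rw [← Nat.cast_one, ← Nat.cast_add, ← h1] at hadj
        -- An integer representing the outer vertex also represents the inner one, because
        -- congruence modulo p ^ (n + 1) implies congruence modulo p ^ n.
        have h2 : level P n j = level P n t := by
          rw [h1, Nat.cast_add, Nat.cast_one] at h
          rw [level_eq_iff] at h ⊢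
          refine ⟨rfl, ?_⟩
          have h3 := h.2
          have hp : (1 : ℝ) ≤ p := by exact_mod_cast (Fact.out : p.Prime).one_lt.le
          rw [show (j : ℚ_[p]) - t = (j - (t + (pUnit p ^ (n : ℤ) : ℚ_[p]ˣ) * a)) +
            (pUnit p ^ (n : ℤ) : ℚ_[p]ˣ) * a by ring]
          refine norm_add_le_of_le (h3.trans ?_) ?_
          · exact zpow_le_zpow_right₀ hp (by omega)
          · rw [norm_mul, norm_pUnit_zpow]
            exact mul_le_of_le_one_right (by positivity) a.2
        rw [h2]
    induction τ using Sym2.ind with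
    | _ u v =>
      obtain ⟨n, j, hnj⟩ := key u v hτ (hS u (Sym2.mem_mk_left u v)) (hS v (Sym2.mem_mk_right u v))
      refine ⟨n, j, Subtype.ext ?_⟩
      change s(conj P (upper 1) ^ j • level P n 0, conj P (upper 1) ^ j • level P (n + 1 : ℕ) 0) = _
      rw [conj_upper_zpow_smul, conj_upper_zpow_smul, zero_add, hnj]
  level_eq {n m i} h := by
    rw [conj_upper_zpow_smul, level_eq_iff] at h
    exact_mod_cast h.1
  smul_eq_iff n i := by
    rw [conj_upper_zpow_smul, level_eq_iff, zero_add, sub_zero, Padic.norm_int_le_pow_iff_dvd]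
    push_cast
    simp

end HalfTree

end

end SL2Tree

namespace SL2Tree

noncomputable section

/-! ### Stabilizers and pro-`p`-Iwahori subgroups -/

section Iwahori

variable {p : ℕ} [Fact p.Prime]

/-- The inclusion `SL₂(ℤ_p) → SL₂(ℚ_p)`. -/
def incl : Matrix.SpecialLinearGroup (Fin 2) ℤ_[p] →* G p :=
  Matrix.SpecialLinearGroup.map PadicInt.Coe.ringHom

/-- The reduction `SL₂(ℤ_p) → SL₂(𝔽_p)`. -/
def red : Matrix.SpecialLinearGroup (Fin 2) ℤ_[p] →* Matrix.SpecialLinearGroup (Fin 2) (ZMod p) :=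
  Matrix.SpecialLinearGroup.map PadicInt.toZMod

theorem incl_apply (A : Matrix.SpecialLinearGroup (Fin 2) ℤ_[p]) (i j : Fin 2) :
    incl A i j = (A i j : ℚ_[p]) := rfl

theorem red_apply (A : Matrix.SpecialLinearGroup (Fin 2) ℤ_[p]) (i j : Fin 2) :
    red A i j = PadicInt.toZMod (A i j) := rfl

theorem incl_injective : Function.Injective (incl (p := p)) := by
  intro A B h
  ext i j
  have := congrArg (fun g : G p => g i j) h
  exact Subtype.ext this

theorem map_upper {R S : Type*} [CommRing R] [CommRing S] (f : R →+* S) (a : R) :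
    Matrix.SpecialLinearGroup.map f (upper a) = upper (f a) :=
  sl_ext (map_one f) rfl (map_zero f) (map_one f)

theorem map_lower {R S : Type*} [CommRing R] [CommRing S] (f : R →+* S) (a : R) :
    Matrix.SpecialLinearGroup.map f (lower a) = lower (f a) :=
  sl_ext (map_one f) (map_zero f) rfl (map_one f)

theorem incl_upper (t : ℤ_[p]) : incl (upper t) = upper (t : ℚ_[p]) := map_upper _ t
theorem red_upper (t : ℤ_[p]) : red (upper t) = upper (PadicInt.toZMod t) := map_upper _ t
theorem red_lower (t : ℤ_[p]) : red (lower t) = lower (PadicInt.toZMod t) := map_lower _ t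

theorem red_surjective : Function.Surjective (red (p := p)) := by
  intro g
  obtain ⟨a, b, c, d, rfl⟩ := sl2_eq g
  have h := ZMod.ringHom_surjective (PadicInt.toZMod (p := p))
  obtain ⟨a, rfl⟩ := h a
  obtain ⟨b, rfl⟩ := h b
  obtain ⟨c, rfl⟩ := h c
  obtain ⟨d, rfl⟩ := h d
  refine ⟨lower a * (upper b * (lower c * upper d)), ?_⟩
  simp only [map_mul, red_upper, red_lower]

theorem exists_incl (g : G p) (h : ∀ i j, ‖g i j‖ ≤ 1) : ∃ A, incl A = g := by
  refine ⟨⟨Matrix.of fun i j => ⟨g i j, h i j⟩, ?_⟩, ?_⟩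
  · have hdet := g.2
    rw [Matrix.det_fin_two] at hdet ⊢
    exact Subtype.ext hdet
  · ext i j
    rfl

theorem conj_mul (P Q : Frame p) (g : G p) : conj (P * Q) g = conj P (conj Q g) := by
  apply Subtype.ext
  change (P * Q : Frame p).1 * g.1 * ((P * Q)⁻¹ : Frame p).1 =
    P.1 * (Q.1 * g.1 * (Q⁻¹ : Frame p).1) * (P⁻¹ : Frame p).1
  rw [mul_inv_rev, Units.val_mul, Units.val_mul]
  simp only [mul_assoc]

theorem conj_one (g : G p) : conj 1 g = g := by
  apply Subtype.ext
  change (1 : Frame p).1 * g.1 * ((1 : Frame p)⁻¹ : Frame p).1 = _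
  rw [inv_one, Units.val_one, one_mul, mul_one]

theorem conj_conj_inv (P : Frame p) (g : G p) : conj P (conj P⁻¹ g) = g := by
  rw [← conj_mul, mul_inv_cancel, conj_one]

theorem conj_inv_conj (P : Frame p) (g : G p) : conj P⁻¹ (conj P g) = g := by
  rw [← conj_mul, inv_mul_cancel, conj_one]

theorem conj_toGL (h g : G p) : conj (Matrix.SpecialLinearGroup.toGL h) g = h * g * h⁻¹ := by
  apply Subtype.ext
  rfl

theorem conj_mul_aff (P : Frame p) (a : ℚ_[p]ˣ) {g g' : G p} (h00 : g' 0 0 = g 0 0)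
    (h01 : g' 0 1 = a * g 0 1) (h10 : g 1 0 = a * g' 1 0) (h11 : g' 1 1 = g 1 1) :
    conj (P * aff a 0) g = conj P g' := by
  rw [conj_mul]
  congr 1
  apply Subtype.ext
  change (aff a 0).1 * g.1 * ((aff a 0)⁻¹ : Frame p).1 = g'.1
  have h : (aff a 0).1 * g.1 = g'.1 * (aff a 0).1 := by
    ext i j
    rw [Matrix.mul_apply, Matrix.mul_apply, Fin.sum_univ_two, Fin.sum_univ_two]
    change (!![(a : ℚ_[p]), 0; 0, 1]) i 0 * g 0 j + (!![(a : ℚ_[p]), 0; 0, 1]) i 1 * g 1 j =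
      g' i 0 * (!![(a : ℚ_[p]), 0; 0, 1]) 0 j + g' i 1 * (!![(a : ℚ_[p]), 0; 0, 1]) 1 j
    fin_cases i <;> fin_cases j <;> simp [h00, h01, h10, h11, mul_comm]
  rw [h, mul_assoc, ← Units.val_mul, mul_inv_cancel, Units.val_one, mul_one]

/-- The element of `G` which acts in the frame `P` by the integral matrix `A`. -/
def emb (P : Frame p) : Matrix.SpecialLinearGroup (Fin 2) ℤ_[p] →* G p := (conj P).comp incl

theorem emb_apply (P : Frame p) (A : Matrix.SpecialLinearGroup (Fin 2) ℤ_[p]) :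
    emb P A = conj P (incl A) := rfl

theorem emb_injective (P : Frame p) : Function.Injective (emb P) := by
  intro A B h
  apply incl_injective
  rw [← conj_inv_conj P (incl A), ← emb_apply, h, emb_apply, conj_inv_conj]

theorem vec_mul_toGL (P : Frame p) (g : G p) (x y : ℚ_[p]) :
    vec (P * Matrix.SpecialLinearGroup.toGL g) x y =
      vec P (g 0 0 * x + g 0 1 * y) (g 1 0 * x + g 1 1 * y) := by
  rw [vec, vec, Units.val_mul, ← Matrix.mulVec_mulVec]
  congr 1
  change g.1.mulVec ![x, y] = _
  ext i
  fin_cases i <;> simp [Matrix.mulVec, dotProduct]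

theorem det_eq {R : Type*} [CommRing R] (g : Matrix.SpecialLinearGroup (Fin 2) R) :
    g 0 0 * g 1 1 - g 0 1 * g 1 0 = 1 := by
  have := g.2
  rwa [Matrix.det_fin_two] at this

theorem vec_eq_vec_mul_toGL (P : Frame p) (g : G p) (x y : ℚ_[p]) :
    vec P x y = vec (P * Matrix.SpecialLinearGroup.toGL g) (g 1 1 * x - g 0 1 * y)
      (g 0 0 * y - g 1 0 * x) := by
  rw [vec_mul_toGL]
  have h := det_eq g
  congr 1
  · linear_combination (-x) * h
  · linear_combination (-y) * h

theorem vtx_mul_incl (P : Frame p) (A : Matrix.SpecialLinearGroup (Fin 2) ℤ_[p]) :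
    vtx (P * Matrix.SpecialLinearGroup.toGL (incl A)) = vtx P := by
  rw [vtx, vtx]
  congr 1
  apply Subtype.ext
  ext v
  have hA : ∀ i j (z : ℚ_[p]), ‖z‖ ≤ 1 → ‖incl A i j * z‖ ≤ 1 := fun i j z hz => by
    rw [norm_mul]
    exact mul_le_one₀ (A i j).2 (norm_nonneg _) hz
  constructor
  · obtain ⟨x, y, rfl⟩ := vec_surjective (P * Matrix.SpecialLinearGroup.toGL (incl A)) v
    rw [vec_mem_lat, vec_mul_toGL, vec_mem_lat]
    rintro ⟨hx, hy⟩
    exact ⟨norm_add_le_of_le (hA _ _ _ hx) (hA _ _ _ hy),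
      norm_add_le_of_le (hA _ _ _ hx) (hA _ _ _ hy)⟩
  · obtain ⟨x, y, rfl⟩ := vec_surjective P v
    rw [vec_mem_lat, vec_eq_vec_mul_toGL P (incl A), vec_mem_lat]
    rintro ⟨hx, hy⟩
    exact ⟨norm_sub_le_of_le (hA _ _ _ hx) (hA _ _ _ hy),
      norm_sub_le_of_le (hA _ _ _ hy) (hA _ _ _ hx)⟩

theorem emb_smul_vtx (P : Frame p) (A : Matrix.SpecialLinearGroup (Fin 2) ℤ_[p]) :
    emb P A • vtx P = vtx P := by
  have := conj_smul_vtx P (incl A) 1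
  rw [mul_one, mul_one, vtx_mul_incl] at this
  exact this

/-- Fixing the class gives a homothety factor c. The inclusions of the two lattices yield ‖g i j‖ ≤
‖c‖ and ‖g i j‖ ‖c‖ ≤ 1, which together make g integral. -/
theorem exists_emb (P : Frame p) {g : G p} (hg : g • vtx P = vtx P) : ∃ A, emb P A = g := by
  obtain ⟨g, rfl⟩ : ∃ g', conj P g' = g := ⟨_, conj_conj_inv P g⟩
  suffices h : ∀ i j, ‖g i j‖ ≤ 1 by
    obtain ⟨A, rfl⟩ := exists_incl g h
    exact ⟨A, rfl⟩
  have := conj_smul_vtx P g 1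
  rw [mul_one, mul_one, hg, vtx, vtx, cls_eq_iff] at this
  obtain ⟨c, hc⟩ := this
  have hpos : 0 < ‖(c : ℚ_[p])‖ := norm_pos_iff.mpr c.ne_zero
  have key : ∀ x y, (‖g 1 1 * x - g 0 1 * y‖ ≤ 1 ∧ ‖g 0 0 * y - g 1 0 * x‖ ≤ 1) ↔
      (‖x‖ ≤ ‖(c : ℚ_[p])‖ ∧ ‖y‖ ≤ ‖(c : ℚ_[p])‖) := by
    intro x y
    rw [← vec_mem_lat (P * Matrix.SpecialLinearGroup.toGL g), ← vec_eq_vec_mul_toGL, hc,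
      mem_units_smul, Units.smul_def, smul_vec, vec_mem_lat, norm_mul, norm_mul,
      Units.val_inv_eq_inv_val, norm_inv, inv_mul_le_one₀ hpos, inv_mul_le_one₀ hpos]
  have hdet := det_eq g
  have h1 := (key (g 0 0) (g 1 0)).mp (by
    rw [show g 1 1 * g 0 0 - g 0 1 * g 1 0 = 1 by linear_combination hdet, mul_comm, sub_self]
    simp)
  have h2 := (key (g 0 1) (g 1 1)).mp (by
    rw [show g 0 0 * g 1 1 - g 1 0 * g 0 1 = 1 by linear_combination hdet, mul_comm, sub_self]
    simp)
  have h3 := (key c 0).mpr (by simp)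
  have h4 := (key 0 c).mpr (by simp)
  simp only [mul_zero, sub_zero, zero_sub, norm_neg, norm_mul] at h3 h4
  have hmin : ∀ z : ℚ_[p], ‖z‖ ≤ ‖(c : ℚ_[p])‖ → ‖z‖ * ‖(c : ℚ_[p])‖ ≤ 1 → ‖z‖ ≤ 1 := by
    intro z hz hz'
    by_contra hlt
    nlinarith [norm_nonneg z]
  intro i j
  fin_cases i <;> fin_cases j
  · exact hmin _ h1.1 h4.2
  · exact hmin _ h2.1 h4.1
  · exact hmin _ h1.2 h3.2
  · exact hmin _ h2.2 h3.1

/-- Upper triangular unipotent matrices over `𝔽_p`. -/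
def upperSubgroup (p : ℕ) [Fact p.Prime] : Subgroup (Matrix.SpecialLinearGroup (Fin 2) (ZMod p)) where
  carrier := Set.range upper
  one_mem' := ⟨0, upper_zero⟩
  mul_mem' := by
    rintro _ _ ⟨a, rfl⟩ ⟨b, rfl⟩
    exact ⟨a + b, (upper_mul a b).symm⟩
  inv_mem' := by
    rintro _ ⟨a, rfl⟩
    exact ⟨-a, by rw [eq_inv_iff_mul_eq_one, upper_mul, neg_add_cancel, upper_zero]⟩

/-- The pro-`p`-Iwahori subgroup of the frame `P`. -/
def iwahori (P : Frame p) : Subgroup (G p) := ((upperSubgroup p).comap red).map (emb P)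

theorem toZMod_eq_zero_iff (x : ℤ_[p]) : PadicInt.toZMod x = 0 ↔ (p : ℤ_[p]) ∣ x := by
  rw [← RingHom.mem_ker, PadicInt.ker_toZMod, PadicInt.maximalIdeal_eq_span_p,
    Ideal.mem_span_singleton]

/-- Passing to the frame (p⁻¹f₀, f₁) divides the lower left entry by p and multiplies the upper
right one by p. So divisibility by p of the lower left entry makes the element integral in both
frames of the edge. -/
theorem emb_eq_emb_mul_aff (P : Frame p) (A : Matrix.SpecialLinearGroup (Fin 2) ℤ_[p]) {c : ℤ_[p]}
    (hc : A 1 0 = p * c) : ∃ A' : Matrix.SpecialLinearGroup (Fin 2) ℤ_[p],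
      A' 0 0 = A 0 0 ∧ A' 0 1 = p * A 0 1 ∧ A' 1 0 = c ∧ A' 1 1 = A 1 1 ∧
      emb P A = emb (P * aff (pUnit p)⁻¹ 0) A' := by
  refine ⟨⟨!![A 0 0, p * A 0 1; c, A 1 1], ?_⟩, rfl, rfl, rfl, rfl, ?_⟩
  · rw [Matrix.det_fin_two_of]
    have h := det_eq A
    rw [hc] at h
    linear_combination h
  · have hp : (pUnit p : ℚ_[p]) = (p : ℚ_[p]) := rfl
    refine (conj_mul_aff P (pUnit p)⁻¹ ?_ ?_ ?_ ?_).symm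
    · rfl
    · rw [Units.eq_inv_mul_iff_mul_eq]
      change (p : ℚ_[p]) * (A 0 1 : ℚ_[p]) = ((p * A 0 1 : ℤ_[p]) : ℚ_[p])
      push_cast
      rfl
    · rw [Units.eq_inv_mul_iff_mul_eq]
      change (p : ℚ_[p]) * (c : ℚ_[p]) = (A 1 0 : ℚ_[p])
      rw [hc]
      push_cast
      rfl
    · rfl

theorem dvd_of_emb_smul (P : Frame p) (A : Matrix.SpecialLinearGroup (Fin 2) ℤ_[p])
    (h : emb P A • vtx (P * aff (pUnit p)⁻¹ 0) = vtx (P * aff (pUnit p)⁻¹ 0)) :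
    (p : ℤ_[p]) ∣ A 1 0 := by
  obtain ⟨A', hA'⟩ := exists_emb _ h
  have h1 : emb (P * aff (pUnit p)⁻¹ 0) A' = emb P A := hA'
  have h2 : conj (aff (pUnit p)⁻¹ 0) (incl A') = incl A := by
    rw [emb_apply, emb_apply, conj_mul] at h1
    have := congrArg (conj P⁻¹) h1
    rwa [conj_inv_conj, conj_inv_conj] at this
  have h3 : (aff (pUnit p)⁻¹ 0).1 * (incl A').1 = (incl A).1 * (aff (pUnit p)⁻¹ 0).1 := by
    rw [← h2]
    change _ = ((aff (pUnit p)⁻¹ 0).1 * (incl A').1 * ((aff (pUnit p)⁻¹ 0)⁻¹ : Frame p).1) * _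
    rw [mul_assoc _ _ (aff (pUnit p)⁻¹ 0).1, ← Units.val_mul, inv_mul_cancel, Units.val_one, mul_one]
  have h4 := congrFun (congrFun h3 1) 0
  rw [Matrix.mul_apply, Matrix.mul_apply, Fin.sum_univ_two, Fin.sum_univ_two] at h4
  have h5 : (A' 1 0 : ℚ_[p]) = (A 1 0 : ℚ_[p]) * ((pUnit p)⁻¹ : ℚ_[p]ˣ) := by
    simpa [aff, incl_apply] using h4
  refine ⟨A' 1 0, Subtype.ext ?_⟩
  rw [Units.eq_mul_inv_iff_mul_eq] at h5
  change (A 1 0 : ℚ_[p]) = ((p * A' 1 0 : ℤ_[p]) : ℚ_[p])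
  rw [← h5]
  push_cast
  exact mul_comm _ _

end Iwahori

end

end SL2Tree

namespace SL2Tree

noncomputable section

/-! ### The maximal pro-`p`-subgroup fixing an edge -/

section ProP

variable {p : ℕ} [Fact p.Prime]

/-- In the binomial expansion the middle terms gain a factor p, and the last one carries p ^ ((n +
1) p) with (n + 1) p ≥ n + 2. -/
theorem exists_one_add_pow_prime {R : Type*} [Ring R] (n : ℕ) (C : R) :
    ∃ D, (1 + (p : R) ^ (n + 1) * C) ^ p = 1 + (p : R) ^ (n + 1 + 1) * D := by
  have hp := (Fact.out : p.Prime)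
  obtain ⟨r, hr⟩ := (Commute.one_left ((p : R) ^ (n + 1) * C)).exists_add_pow_prime_eq hp
  obtain ⟨m, hm⟩ : ∃ m, (n + 1) * p = n + 1 + 1 + m :=
    ⟨(n + 1) * p - (n + 1 + 1), by
      have : (n + 1) * 2 ≤ (n + 1) * p := Nat.mul_le_mul_left _ hp.two_le
      omega⟩
  refine ⟨(p : R) ^ m * C ^ p + C * r, ?_⟩
  rw [hr, ((Nat.cast_commute p C).pow_left (n + 1)).mul_pow, ← pow_mul, hm, one_pow, mul_one,
    mul_add, pow_add _ (n + 1 + 1), add_assoc, pow_succ' _ (n + 1)]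
  simp only [mul_assoc]

theorem exists_pow_eq_one_add {A : Matrix.SpecialLinearGroup (Fin 2) ℤ_[p]} (hA : red A ^ p = 1)
    (n : ℕ) : ∃ C : Matrix (Fin 2) (Fin 2) ℤ_[p],
      (A ^ p ^ (n + 1)).1 = 1 + (p : Matrix (Fin 2) (Fin 2) ℤ_[p]) ^ (n + 1) * C := by
  induction n with
  | zero =>
    have h : ∀ i j, (p : ℤ_[p]) ∣ (A ^ p) i j - (1 : Matrix (Fin 2) (Fin 2) ℤ_[p]) i j := by
      intro i j
      rw [← toZMod_eq_zero_iff, map_sub, ← red_apply, map_pow, hA, sub_eq_zero]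
      fin_cases i <;> fin_cases j <;> simp
    choose C hC using h
    refine ⟨Matrix.of C, ?_⟩
    ext i j
    rw [zero_add, pow_one, pow_one, Matrix.add_apply, ← nsmul_eq_mul, Matrix.smul_apply,
      nsmul_eq_mul, Matrix.of_apply, ← hC]
    ring
  | succ n ih =>
    obtain ⟨C, hC⟩ := ih
    obtain ⟨D, hD⟩ := exists_one_add_pow_prime (p := p) n C
    exact ⟨D, by rw [pow_succ p, pow_mul, Matrix.SpecialLinearGroup.coe_pow, hC, hD]⟩

theorem tendsto_pow_prime_pow {A : Matrix.SpecialLinearGroup (Fin 2) ℤ_[p]} (hA : red A ^ p = 1) :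
    Filter.Tendsto (fun n : ℕ => A ^ p ^ (n + 1)) Filter.atTop (nhds 1) := by
  choose C hC using exists_pow_eq_one_add hA
  refine Topology.IsInducing.subtypeVal.tendsto_nhds_iff.mpr ?_
  change Filter.Tendsto (fun n : ℕ => (A ^ p ^ (n + 1)).1) _
    (nhds (1 : Matrix (Fin 2) (Fin 2) ℤ_[p]))
  simp only [hC]
  refine tendsto_pi_nhds.mpr fun i => tendsto_pi_nhds.mpr fun j => ?_
  have h0 : Filter.Tendsto (fun n : ℕ => (p : ℤ_[p]) ^ (n + 1) * C n i j) Filter.atTop (nhds 0) := by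
    refine squeeze_zero_norm (a := fun n : ℕ => ((p : ℝ)⁻¹) ^ (n + 1)) (fun n => ?_) ?_
    · rw [norm_mul, norm_pow, PadicInt.norm_p]
      exact mul_le_of_le_one_right (by positivity) (PadicInt.norm_le_one _)
    · refine (Filter.tendsto_add_atTop_iff_nat 1).mpr (tendsto_pow_atTop_nhds_zero_of_lt_one
        (by positivity) ?_)
      exact inv_lt_one_of_one_lt₀ (by exact_mod_cast (Fact.out : p.Prime).one_lt)
  have h1 := h0.const_add ((1 : Matrix (Fin 2) (Fin 2) ℤ_[p]) i j)
  rw [add_zero] at h1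
  refine h1.congr fun n => ?_
  rw [← Nat.cast_pow, ← Nat.cast_pow, Matrix.add_apply, ← nsmul_eq_mul, ← nsmul_eq_mul,
    Matrix.smul_apply]

theorem continuous_emb (P : Frame p) : Continuous (emb P) := by
  refine Continuous.subtype_mk (f := fun A : Matrix.SpecialLinearGroup (Fin 2) ℤ_[p] =>
    P.1 * A.1.map ((↑) : ℤ_[p] → ℚ_[p]) * (P⁻¹ : Frame p).1) ?_ _
  have h : Continuous fun A : Matrix.SpecialLinearGroup (Fin 2) ℤ_[p] =>
    A.1.map ((↑) : ℤ_[p] → ℚ_[p]) := continuous_subtype_val.matrix_map continuous_subtype_val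
  exact (continuous_const.mul h).mul continuous_const

theorem compactSpace_sl : CompactSpace (Matrix.SpecialLinearGroup (Fin 2) ℤ_[p]) := by
  have : CompactSpace (Matrix (Fin 2) (Fin 2) ℤ_[p]) :=
    inferInstanceAs (CompactSpace (Fin 2 → Fin 2 → ℤ_[p]))
  have h : IsClosed {A : Matrix (Fin 2) (Fin 2) ℤ_[p] | A.det = 1} :=
    isClosed_eq (Continuous.matrix_det continuous_id) continuous_const
  exact isCompact_iff_compactSpace.mp h.isCompact

theorem totallyDisconnectedSpace_G : TotallyDisconnectedSpace (G p) := by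
  have : TotallyDisconnectedSpace (Matrix (Fin 2) (Fin 2) ℚ_[p]) :=
    inferInstanceAs (TotallyDisconnectedSpace (Fin 2 → Fin 2 → ℚ_[p]))
  exact inferInstanceAs (TotallyDisconnectedSpace
    {A : Matrix (Fin 2) (Fin 2) ℚ_[p] // A.det = 1})

theorem isLocallyConstant_red : IsLocallyConstant (red (p := p)) := by
  rw [IsLocallyConstant.iff_eventually_eq]
  intro A
  have h : ∀ i j, ∀ᶠ B : Matrix.SpecialLinearGroup (Fin 2) ℤ_[p] in nhds A,
      red B i j = red A i j := by
    intro i j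
    have hc : Continuous fun B : Matrix.SpecialLinearGroup (Fin 2) ℤ_[p] => B i j :=
      continuous_subtype_val.matrix_elem i j
    filter_upwards [hc.continuousAt.eventually (Metric.ball_mem_nhds (A i j) one_pos)] with B hB
    rw [red_apply, red_apply, ← sub_eq_zero, ← map_sub, toZMod_eq_zero_iff,
      ← PadicInt.norm_lt_one_iff_dvd, ← dist_eq_norm]
    exact hB
  filter_upwards [h 0 0, h 0 1, h 1 0, h 1 1] with B h00 h01 h10 h11
  exact sl_ext h00 h01 h10 h11

theorem upper_pow (a : ZMod p) (n : ℕ) : upper a ^ n = upper (n * a) := by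
  have := upper_zpow a n
  rwa [zpow_natCast, Int.cast_natCast] at this

/-- The group is the image of a closed subset of a compact group. For an element A of it, `red A`
has order dividing p, so the powers A ^ p ^ (n + 1) tend to 1 and eventually lie in any given open
normal subgroup. -/
theorem isProP_iwahori (P : Frame p) : IsProP (iwahori P) := by
  refine ⟨?_, ?_, ?_⟩
  · have := compactSpace_sl (p := p)
    have h : IsClosed (red ⁻¹' (upperSubgroup p : Set (Matrix.SpecialLinearGroup (Fin 2) (ZMod p)))) := by
      rw [← isOpen_compl_iff]
      exact isLocallyConstant_red (upperSubgroup p : Set (Matrix.SpecialLinearGroup (Fin 2) (ZMod p)))ᶜ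
    exact isCompact_iff_compactSpace.mp (h.isCompact.image (continuous_emb P))
  · have := totallyDisconnectedSpace_G (p := p)
    infer_instance
  · intro V g
    obtain ⟨⟨g, A, hA, rfl⟩, rfl⟩ := QuotientGroup.mk_surjective g
    have hA1 : red A ^ p = 1 := by
      obtain ⟨a, ha⟩ := hA
      rw [← ha, upper_pow, CharP.cast_eq_zero, zero_mul, upper_zero]
    have h1 := ((continuous_emb P).tendsto 1).comp (tendsto_pow_prime_pow hA1)
    rw [map_one] at h1
    have h2 : Filter.Tendsto (fun n : ℕ => (⟨emb P A, A, hA, rfl⟩ : iwahori P) ^ p ^ (n + 1))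
        Filter.atTop (nhds 1) := by
      rw [tendsto_subtype_rng]
      refine h1.congr fun n => ?_
      rw [Function.comp_apply, map_pow]
      rfl
    obtain ⟨n, hn⟩ := (h2.eventually (V.toOpenSubgroup.mem_nhds_one)).exists
    refine ⟨n + 1, ?_⟩
    rw [← QuotientGroup.mk_pow, QuotientGroup.eq_one_iff]
    exact hn

/-- The edge which joins the vertices of the frames `(f₀, f₁)` and `(p⁻¹ f₀, f₁)`. -/
def edgeUp (P : Frame p) : Edge p :=
  ⟨s(vtx P, vtx (P * aff (pUnit p)⁻¹ 0)), by
    have := adj_aff (P * aff (pUnit p)⁻¹ 0) 0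
    rw [mul_assoc, aff_mul, inv_mul_cancel, PadicInt.coe_zero, mul_zero, add_zero, aff_one_zero,
      mul_one] at this
    exact this.symm⟩

theorem iwahori_le (P : Frame p) {x : Vertex p} (hx : x ∈ (edgeUp P).1) : iwahori P ≤ K x := by
  rintro _ ⟨A, ⟨a, ha⟩, rfl⟩
  rw [K, MulAction.mem_stabilizer_iff]
  rcases Sym2.mem_iff.mp hx with rfl | rfl
  · exact emb_smul_vtx P A
  · obtain ⟨c, hc⟩ : (p : ℤ_[p]) ∣ A 1 0 := by
      rw [← toZMod_eq_zero_iff, ← red_apply, ← ha, upper_10]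
    obtain ⟨A', -, -, -, -, h⟩ := emb_eq_emb_mul_aff P A hc
    rw [h, emb_smul_vtx]

/-- The first congruence subgroup of the stabilizer of the vertex of `P`. -/
def congruenceSubgroup (P : Frame p) : Subgroup (G p) := (red.ker).map (emb P)

theorem isOpen_congruenceSubgroup (P : Frame p) : IsOpen (congruenceSubgroup P : Set (G p)) := by
  have hset : (congruenceSubgroup P : Set (G p)) =
      {g | ∀ i j, ‖conj P⁻¹ g i j - (1 : G p) i j‖ < 1} := by
    ext g
    constructor
    · rintro ⟨A, hA, rfl⟩ i j
      have hA' : red A = 1 := hA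
      rw [emb_apply, conj_inv_conj, incl_apply]
      have h1 : (1 : G p) i j =
          (((1 : Matrix.SpecialLinearGroup (Fin 2) ℤ_[p]) i j : ℤ_[p]) : ℚ_[p]) := by
        rw [← incl_apply, map_one]
      rw [h1, ← PadicInt.coe_sub, ← PadicInt.norm_def, PadicInt.norm_lt_one_iff_dvd,
        ← toZMod_eq_zero_iff, map_sub, ← red_apply, ← red_apply, hA', map_one, sub_self]
    · intro h
      have h1 : ∀ i j, (1 : G p) i j =
          (((1 : Matrix.SpecialLinearGroup (Fin 2) ℤ_[p]) i j : ℤ_[p]) : ℚ_[p]) := fun i j => by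
        rw [← incl_apply, map_one]
      obtain ⟨A, hA⟩ := exists_incl (conj P⁻¹ g) fun i j => by
        rw [show conj P⁻¹ g i j = (conj P⁻¹ g i j - (1 : G p) i j) + (1 : G p) i j by ring]
        refine norm_add_le_of_le (h i j).le ?_
        rw [h1]
        exact PadicInt.norm_le_one _
      refine ⟨A, ?_, by rw [emb_apply, hA, conj_conj_inv]⟩
      have hij : ∀ i j, red A i j = (1 : Matrix.SpecialLinearGroup (Fin 2) (ZMod p)) i j := by
        intro i j
        have := h i j
        rw [← hA, h1, incl_apply, ← PadicInt.coe_sub, ← PadicInt.norm_def,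
          PadicInt.norm_lt_one_iff_dvd, ← toZMod_eq_zero_iff, map_sub, ← red_apply, ← red_apply,
          map_one, sub_eq_zero] at this
        exact this
      exact sl_ext (hij 0 0) (hij 0 1) (hij 1 0) (hij 1 1)
  rw [hset]
  simp only [Set.ofPred_forall]
  refine isOpen_iInter_of_finite fun i => isOpen_iInter_of_finite fun j => ?_
  have hc : Continuous fun g : G p => conj P⁻¹ g := by
    refine Continuous.subtype_mk (f := fun g : G p =>
      (P⁻¹ : Frame p).1 * g.1 * ((P⁻¹)⁻¹ : Frame p).1) ?_ _
    exact (continuous_const.mul continuous_subtype_val).mul continuous_const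
  exact isOpen_lt ((((continuous_subtype_val.comp hc).matrix_elem i j).sub
    continuous_const).norm) continuous_const

/-- Fixing both ends makes the reduction of an element upper triangular. The congruence subgroup is
open and normal in H, so the reduction has p-power order, and a diagonal entry a with a ^ p ^ n = 1
equals 1 because a ^ p ^ n = a in 𝔽_p. -/
theorem le_iwahori (P : Frame p) {H : Subgroup (G p)} (hH : IsProP H)
    (hK : ∀ x ∈ (edgeUp P).1, H ≤ K x) : H ≤ iwahori P := by
  have hfix := hK _ (Sym2.mem_mk_left _ _)
  have hfix' := hK _ (Sym2.mem_mk_right _ _)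
  let V : OpenNormalSubgroup H :=
    { toSubgroup := (congruenceSubgroup P).subgroupOf H
      isOpen' := (isOpen_congruenceSubgroup P).preimage continuous_subtype_val
      isNormal' := by
        constructor
        rintro ⟨_, hn⟩ ⟨B, hB, rfl⟩ ⟨g, hg⟩
        obtain ⟨A, rfl⟩ := exists_emb P (MulAction.mem_stabilizer_iff.mp (hfix hg))
        refine ⟨A * B * A⁻¹, ?_, ?_⟩
        · exact (MonoidHom.normal_ker _).conj_mem B hB A
        · rw [map_mul, map_mul, map_inv]
          rfl }
  have := V.isNormal'
  intro g hg
  obtain ⟨A, rfl⟩ := exists_emb P (MulAction.mem_stabilizer_iff.mp (hfix hg))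
  obtain ⟨n, hn⟩ := hH.2.2 V (QuotientGroup.mk ⟨emb P A, hg⟩)
  rw [← QuotientGroup.mk_pow, QuotientGroup.eq_one_iff] at hn
  obtain ⟨B, hB, hBA⟩ : emb P A ^ p ^ n ∈ congruenceSubgroup P := hn
  rw [← map_pow] at hBA
  have hA : red A ^ p ^ n = 1 := by
    rw [← map_pow, ← emb_injective P hBA]
    exact hB
  have h10 : red A 1 0 = 0 := by
    rw [red_apply, toZMod_eq_zero_iff]
    exact dvd_of_emb_smul P A (MulAction.mem_stabilizer_iff.mp (hfix' hg))
  have hpow : ∀ m : ℕ, (red A ^ m) 1 0 = 0 ∧ (red A ^ m) 0 0 = red A 0 0 ^ m := by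
    intro m
    induction m with
    | zero => simp
    | succ m ih =>
      rw [pow_succ, sl_mul_apply, sl_mul_apply, ih.1, ih.2, h10, pow_succ]
      simp
  have h00 : red A 0 0 = 1 := by
    have := (hpow (p ^ n)).2
    rwa [hA, ZMod.pow_card_pow, eq_comm] at this
  have hdet := det_eq (red A)
  rw [h00, h10, one_mul, mul_zero, sub_zero] at hdet
  have hred : red A = upper (red A 0 1) := sl_ext h00 rfl h10 hdet
  exact ⟨A, ⟨_, hred.symm⟩, rfl⟩

theorem U_edgeUp (P : Frame p) : U (edgeUp P) = iwahori P := by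
  refine le_antisymm (sSup_le fun H hH => le_iwahori P hH.1 hH.2) (le_sSup ⟨isProP_iwahori P, ?_⟩)
  exact fun x hx => iwahori_le P hx

end ProP

end

end SL2Tree

namespace SL2Tree

noncomputable section

/-! ### The representations at the vertices -/

section VertexRepresentation

universe u v

variable {p : ℕ} [Fact p.Prime]

/-- Every `upper a` is a power of `upper 1`, so the span of all differences is the image of `ρ
(upper 1) - 1`, and the 𝔽_p-linear result applies after restriction of scalars. Generation is asked
for additive subgroups since these are the 𝔽_p-subspaces. -/
theorem eq_zero_of_mem_span_diff {k V : Type*} [Field k] [CharP k p] [AddCommGroup V] [Module k V]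
    (ρ : Representation k (Matrix.SpecialLinearGroup (Fin 2) (ZMod p)) V)
    (hgen : ∀ C : AddSubgroup V, (∀ g, ∀ v ∈ C, ρ g v ∈ C) →
      (∀ w, (∀ b, ρ (lower b) w = w) → w ∈ C) → C = ⊤)
    {w : V} (hw : ∀ b, ρ (lower b) w = w)
    (hspan : w ∈ Submodule.span k {z | ∃ a v, z = ρ (upper a) v - v}) : w = 0 := by
  have hle : Submodule.span k {z | ∃ a v, z = ρ (upper a) v - v} ≤
      LinearMap.range (ρ (upper 1) - 1) := by
    rw [Submodule.span_le]
    rintro _ ⟨a, v, rfl⟩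
    have h1 : ρ (upper a) - 1 = (ρ (upper 1) - 1) * ∑ i ∈ Finset.range a.val, ρ (upper 1) ^ i := by
      rw [mul_geom_sum, ← map_pow, upper_pow, ZMod.natCast_zmod_val, mul_one]
    exact ⟨_, (LinearMap.congr_fun h1 v).symm⟩
  obtain ⟨v, rfl⟩ := hle hspan
  let _ : Module (ZMod p) V := Module.compHom V (ZMod.castHom (dvd_refl p) k)
  let σ : Representation (ZMod p) (Matrix.SpecialLinearGroup (Fin 2) (ZMod p)) V :=
    { toFun := fun g =>
        { toFun := ρ g
          map_add' := map_add (ρ g)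
          map_smul' := fun c => (ρ g).map_smul (ZMod.castHom (dvd_refl p) k c) }
      map_one' := by
        ext v
        exact LinearMap.congr_fun (map_one ρ) v
      map_mul' := fun g h => by
        ext v
        exact LinearMap.congr_fun (map_mul ρ g h) v }
  refine eq_zero_of_diff_mem_lowerInv (ρ := σ) (fun C hC hlow => ?_) (v := v) fun b => hw b
  have h := hgen C.toAddSubgroup (fun g v hv => hC g hv) fun w hw => hlow fun b => hw b
  rw [eq_top_iff]
  intro v _
  have : v ∈ C.toAddSubgroup := by rw [h]; trivial
  exact this

theorem emb_mul_aff_one (P : Frame p) (a : ℤ_[p])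
    (A : Matrix.SpecialLinearGroup (Fin 2) ℤ_[p]) :
    emb (P * aff 1 a) A = emb P (upper a * A * (upper a)⁻¹) := by
  rw [← toGL_upper, ← incl_upper, emb_apply, conj_mul, conj_toGL, ← map_inv, ← map_mul, ← map_mul,
    emb_apply]

theorem vtx_mul_aff_one (P : Frame p) (a : ℤ_[p]) : vtx (P * aff 1 a) = vtx P := by
  rw [← toGL_upper, ← incl_upper, vtx_mul_incl]

theorem eq_edgeUp_of_mem (P : Frame p) {τ : Edge p} (h : vtx P ∈ τ.1) :
    τ = edgeUp P ∨ ∃ a : ℤ_[p], τ = edgeUp (P * aff (pUnit p) a) := by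
  obtain ⟨τ, hτ⟩ := τ
  obtain ⟨y, rfl⟩ := Sym2.mem_iff_exists.mp h
  rcases eq_of_adj P hτ with rfl | ⟨a, rfl⟩
  · exact Or.inl rfl
  · refine Or.inr ⟨a, Subtype.ext ?_⟩
    change s(vtx P, vtx (P * aff (pUnit p) a)) =
      s(vtx (P * aff (pUnit p) a), vtx (P * aff (pUnit p) a * aff (pUnit p)⁻¹ 0))
    rw [mul_assoc, aff_mul, mul_inv_cancel, mul_zero, zero_add, vtx_mul_aff_one, Sym2.eq_swap]

theorem emb_mem_U_edgeUp (P : Frame p) {A : Matrix.SpecialLinearGroup (Fin 2) ℤ_[p]} {a : ZMod p}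
    (hA : red A = upper a) : emb P A ∈ U (edgeUp P) := by
  rw [U_edgeUp]
  exact ⟨A, ⟨a, hA.symm⟩, rfl⟩

/-- In the frame (p f₀, f₁) the upper right entry is divided by p and the lower left one multiplied
by p, so a matrix with lower unipotent reduction becomes one with upper unipotent reduction. -/
theorem emb_mem_U_edgeUp_aff_zero (P : Frame p) {A : Matrix.SpecialLinearGroup (Fin 2) ℤ_[p]}
    {b : ZMod p} (hA : red A = lower b) : emb P A ∈ U (edgeUp (P * aff (pUnit p) 0)) := by
  have h00 : red A 0 0 = 1 := by rw [hA, lower_00]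
  have h11 : red A 1 1 = 1 := by rw [hA, lower_11]
  obtain ⟨d, hd⟩ : (p : ℤ_[p]) ∣ A 0 1 := by
    rw [← toZMod_eq_zero_iff, ← red_apply, hA, lower_01]
  have hdet := det_eq A
  let B : Matrix.SpecialLinearGroup (Fin 2) ℤ_[p] := ⟨!![A 0 0, d; p * A 1 0, A 1 1], by
    rw [Matrix.det_fin_two_of]
    rw [hd] at hdet
    linear_combination hdet⟩
  obtain ⟨A', h1, h2, h3, h4, h5⟩ := emb_eq_emb_mul_aff (P * aff (pUnit p) 0) B
    (c := A 1 0) rfl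
  have hAA : A' = A := sl_ext h1 (h2.trans hd.symm) h3 h4
  rw [mul_assoc, aff_mul, mul_inv_cancel, mul_zero, add_zero, aff_one_zero, mul_one, hAA] at h5
  rw [← h5]
  refine emb_mem_U_edgeUp _ (a := PadicInt.toZMod d) (sl_ext h00 rfl ?_ h11)
  change PadicInt.toZMod ((p : ℤ_[p]) * A 1 0) = 0
  rw [toZMod_eq_zero_iff]
  exact dvd_mul_right _ _

theorem emb_mem_U_edgeUp_aff (P : Frame p) (a : ℤ_[p])
    {A : Matrix.SpecialLinearGroup (Fin 2) ℤ_[p]} {b : ZMod p} (hA : red A = lower b) :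
    emb P (upper a * A * (upper a)⁻¹) ∈ U (edgeUp (P * aff (pUnit p) a)) := by
  have := emb_mem_U_edgeUp_aff_zero (P * aff 1 a) hA
  rwa [emb_mul_aff_one, mul_assoc, aff_mul, one_mul, mul_zero, zero_add] at this

/-! ### Values at vertices as representations of SL₂(𝔽_p) -/

namespace CoeffSystem

variable {k : Type u} [Field k] (F : CoeffSystem.{u, v} p k)

/-- The action of the stabilizer of a vertex. -/
def stabRep (P : Frame p) :
    Representation k (Matrix.SpecialLinearGroup (Fin 2) ℤ_[p]) (F.onV (vtx P)) where
  toFun A := F.actV (emb P A) (emb_smul_vtx P A)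
  map_one' := LinearMap.ext fun v =>
    (F.actV_congr (map_one _) _ (one_smul _ _) v).trans (F.actV_one _ v)
  map_mul' A B := LinearMap.ext fun v =>
    ((F.actV_mul _ _ _ _ (by rw [mul_smul, emb_smul_vtx, emb_smul_vtx]) v).trans
      (F.actV_congr (map_mul _ A B).symm _ _ v)).symm

variable {F}

theorem InC.stabRep_r (hF : F.InC) (P : Frame p) {τ : Edge p} (h : vtx P ∈ τ.1)
    {A : Matrix.SpecialLinearGroup (Fin 2) ℤ_[p]} (hA : emb P A ∈ U τ) (y : F.onE τ) :
    F.stabRep P A (F.r τ (vtx P) h y) = F.r τ (vtx P) h y :=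
  (hF.range_eq τ (vtx P) h _).mp ⟨y, rfl⟩ _ hA _

/-- The congruence subgroup lies in `U τ` for every edge τ at the vertex, hence fixes all images of
the transition maps, and these span the value at the vertex by condition (c). -/
theorem InC.stabRep_eq_one (hF : F.InC) (P : Frame p)
    {A : Matrix.SpecialLinearGroup (Fin 2) ℤ_[p]} (hA : red A = 1) : F.stabRep P A = 1 := by
  have htop : ⊤ ≤ LinearMap.eqLocus (F.stabRep P A) 1 := by
    rw [← hF.generated (vtx P)]
    refine iSup₂_le fun τ h => ?_
    rintro _ ⟨y, rfl⟩
    refine hF.stabRep_r P h ?_ y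
    rcases eq_edgeUp_of_mem P h with rfl | ⟨a, rfl⟩
    · exact emb_mem_U_edgeUp P (a := 0) (by rw [hA, upper_zero])
    · have := emb_mem_U_edgeUp_aff P a (A := (upper a)⁻¹ * A * upper a) (b := 0) (by
        rw [map_mul, map_mul, hA, mul_one, ← map_mul, inv_mul_cancel, map_one, lower_zero])
      rwa [mul_assoc, mul_inv_cancel_right, mul_inv_cancel_left] at this
  exact LinearMap.ext fun v => htop trivial

theorem InC.stabRep_congr (hF : F.InC) (P : Frame p)
    {A B : Matrix.SpecialLinearGroup (Fin 2) ℤ_[p]} (h : red A = red B) :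
    F.stabRep P A = F.stabRep P B := by
  have h1 : F.stabRep P (B⁻¹ * A) = 1 :=
    hF.stabRep_eq_one P (by rw [map_mul, map_inv, h, inv_mul_cancel])
  rw [← mul_inv_cancel_left B A, map_mul, h1, mul_one]

/-- The representation of `SL₂(𝔽_p)` on the value at a vertex. -/
def InC.vertexRep (hF : F.InC) (P : Frame p) :
    Representation k (Matrix.SpecialLinearGroup (Fin 2) (ZMod p)) (F.onV (vtx P)) where
  toFun g := F.stabRep P (Function.surjInv red_surjective g)
  map_one' := hF.stabRep_eq_one P (Function.surjInv_eq red_surjective 1)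
  map_mul' g h := by
    rw [← map_mul]
    refine hF.stabRep_congr P ?_
    simp only [map_mul, Function.surjInv_eq red_surjective]

theorem InC.vertexRep_red (hF : F.InC) (P : Frame p)
    (A : Matrix.SpecialLinearGroup (Fin 2) ℤ_[p]) :
    hF.vertexRep P (red A) = F.stabRep P A :=
  hF.stabRep_congr P (Function.surjInv_eq red_surjective _)

theorem InC.vertexRep_upper (hF : F.InC) (P : Frame p) (a : ZMod p) :
    hF.vertexRep P (upper a) = F.stabRep P (upper ((a.val : ℤ) : ℤ_[p])) := by
  rw [← hF.vertexRep_red, red_upper, map_intCast, Int.cast_natCast, ZMod.natCast_zmod_val]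

/-- The values at the edges of the vertex span by (c). Each is fixed by a conjugate of the lower
unipotent group, and the Weyl element or `upper (-a)` moves it into the invariants of that group. -/
theorem InC.vertexRep_generated (hF : F.InC) (P : Frame p) (C : AddSubgroup (F.onV (vtx P)))
    (hC : ∀ g, ∀ v ∈ C, hF.vertexRep P g v ∈ C)
    (hlow : ∀ w, (∀ b, hF.vertexRep P (lower b) w = w) → w ∈ C) : C = ⊤ := by
  have hsurj := ZMod.ringHom_surjective (PadicInt.toZMod (p := p))
  have key : ∀ g w, (∀ b, hF.vertexRep P (lower b) (hF.vertexRep P g w) = hF.vertexRep P g w) →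
      w ∈ C := by
    intro g w h
    have h1 := hC g⁻¹ _ (hlow _ h)
    rwa [← Module.End.mul_apply, ← map_mul, inv_mul_cancel, map_one] at h1
  rw [eq_top_iff]
  intro v _
  have hv : v ∈ ⨆ (τ : Edge p) (h : vtx P ∈ τ.1), LinearMap.range (F.r τ (vtx P) h) := by
    rw [hF.generated]; trivial
  refine Submodule.iSup_induction _ (motive := fun v => v ∈ C) hv (fun τ v hv => ?_)
    (zero_mem C) fun x y => add_mem
  refine Submodule.iSup_induction _ (motive := fun v => v ∈ C) hv (fun h v hv => ?_)
    (zero_mem C) fun x y => add_mem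
  obtain ⟨y, rfl⟩ := hv
  rcases eq_edgeUp_of_mem P h with rfl | ⟨a, rfl⟩
  · refine key (weyl _) _ fun b => ?_
    obtain ⟨c, hc⟩ := hsurj (-b)
    have h1 := hF.stabRep_r P h (emb_mem_U_edgeUp P (red_upper c)) y
    rw [← hF.vertexRep_red, red_upper, hc] at h1
    rw [← Module.End.mul_apply, ← map_mul, ← neg_neg b, ← weyl_mul_upper, map_mul,
      Module.End.mul_apply, h1]
  · refine key (red (upper a)⁻¹) _ fun b => ?_
    obtain ⟨c, hc⟩ := hsurj b
    have h1 := hF.stabRep_r P h (emb_mem_U_edgeUp_aff P a (red_lower c)) y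
    rw [hF.vertexRep_red]
    rw [← hc, ← red_lower, hF.vertexRep_red, ← Module.End.mul_apply, ← map_mul]
    nth_rewrite 2 [← h1]
    rw [← Module.End.mul_apply, ← map_mul, mul_assoc (upper a), inv_mul_cancel_left]

/-- For an outgoing edge, `U τ` contains the lifts of the lower unipotent group while the stabilizer
along the ray acts through the upper one; so the result on SL₂(𝔽_p) gives injectivity into the
coinvariants. -/
theorem InC.eq_zero_of_mem_span [CharP k p] (hF : F.InC) (P : Frame p) {τ : Edge p}
    (hτ : τ = edgeUp (P * aff (pUnit p) 0)) (h : vtx P ∈ τ.1) (y : F.onE τ)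
    (hy : F.r τ (vtx P) h y ∈
      Submodule.span k {z | ∃ (m : ℤ) (v : F.onV (vtx P)), z = F.stabRep P (upper (m : ℤ_[p])) v - v}) :
    y = 0 := by
  refine hF.injective τ (vtx P) h ?_
  rw [map_zero]
  refine eq_zero_of_mem_span_diff (hF.vertexRep P) (hF.vertexRep_generated P) (fun b => ?_)
    (Submodule.span_mono ?_ hy)
  · obtain ⟨c, rfl⟩ := ZMod.ringHom_surjective (PadicInt.toZMod (p := p)) b
    subst hτ
    rw [← red_lower, hF.vertexRep_red]
    exact hF.stabRep_r P h (emb_mem_U_edgeUp_aff_zero P (red_lower c)) y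
  · rintro _ ⟨m, v, rfl⟩
    exact ⟨_, v, by rw [← hF.vertexRep_red, red_upper]⟩

/-- On the value at the vertex, the group `U τ` acts through the upper unipotent matrices over 𝔽_p,
all of which are reductions of integral ones; condition (b) concludes. -/
theorem InC.mem_range_of_fixed (hF : F.InC) (P : Frame p) {τ : Edge p} (hτ : τ = edgeUp P)
    (h : vtx P ∈ τ.1) {v : F.onV (vtx P)}
    (hv : ∀ m : ℤ, F.stabRep P (upper (m : ℤ_[p])) v = v) :
    v ∈ LinearMap.range (F.r τ (vtx P) h) := by
  rw [hF.range_eq]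
  intro g hg hgz
  rw [hτ, U_edgeUp] at hg
  obtain ⟨A, ⟨a, ha⟩, rfl⟩ := hg
  change F.stabRep P A v = v
  rw [← hF.vertexRep_red, ← ha, hF.vertexRep_upper]
  exact hv _

end CoeffSystem

end VertexRepresentation

end

end SL2Tree

namespace SL2Tree

noncomputable section

/-! ### Invariants of the homology of the half tree -/

section Homology

universe u v

variable {p : ℕ} [Fact p.Prime]

/-- Conjugation by diag(pⁿ, 1) multiplies the upper right entry by pⁿ. Hence the stabilizer of the
n-th ray vertex acts in the frame of that vertex by the integral unipotents `upper m`. -/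
theorem conj_upper_zpow_eq_emb (P : Frame p) (n : ℕ) (m : ℤ) :
    conj P (upper 1) ^ (((p ^ n : ℕ) : ℤ) * m) =
      emb (P * aff (pUnit p ^ (n : ℤ)) 0) (upper (m : ℤ_[p])) := by
  rw [← map_zpow, upper_zpow, mul_one, emb_apply, incl_upper]
  refine (conj_mul_aff P _ ?_ ?_ ?_ ?_).symm
  · rw [upper_00, upper_00]
  · rw [upper_01, upper_01, zpow_natCast, Units.val_pow_eq_pow_val]
    push_cast
    rfl
  · rw [upper_10, upper_10, mul_zero]
  · rw [upper_11, upper_11]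

theorem rayEdge_eq_succ (P : Frame p) (n : ℕ) :
    rayEdge P n = edgeUp (P * aff (pUnit p ^ ((n + 1 : ℕ) : ℤ)) 0) := by
  apply Subtype.ext
  change s(vtx _, vtx _) = s(vtx _, vtx _)
  rw [Sym2.eq_swap, mul_assoc, aff_mul, mul_zero, zero_add, ← zpow_sub_one, Nat.cast_add,
    Nat.cast_one, add_sub_cancel_right]

theorem rayEdge_eq (P : Frame p) (n : ℕ) :
    rayEdge P n = edgeUp (P * aff (pUnit p ^ (n : ℤ)) 0 * aff (pUnit p) 0) := by
  rw [rayEdge_eq_succ, mul_assoc, aff_mul, mul_zero, zero_add, ← zpow_add_one, Nat.cast_add,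
    Nat.cast_one]

namespace CoeffSystem

variable {k : Type u} [Field k] {F : CoeffSystem.{u, v} p k}

theorem InC.mem_range_of_fixed_zpow (hF : F.InC) (P : Frame p) (n : ℕ) {τ : Edge p}
    (hτ : τ = edgeUp (P * aff (pUnit p ^ (n : ℤ)) 0)) (h : level P n 0 ∈ τ.1)
    {v : F.onV (level P n 0)}
    (hv : ∀ (i : ℤ) (hi : conj P (upper 1) ^ i • level P n 0 = level P n 0),
      F.actV (conj P (upper 1) ^ i) hi v = v) :
    v ∈ LinearMap.range (F.r τ (level P n 0) h) := by
  refine hF.mem_range_of_fixed (P * aff (pUnit p ^ (n : ℤ)) 0) hτ h fun m => ?_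
  change F.actV (emb _ _) (emb_smul_vtx _ _) v = v
  have hm := conj_upper_zpow_eq_emb P n m
  exact (F.actV_congr hm.symm _ (by rw [hm]; exact emb_smul_vtx _ _) v).trans (hv _ _)

theorem InC.isTriangular [CharP k p] (hF : F.InC) (P : Frame p) : F.IsTriangular (isCyclicTree P) where
  actE_eq n i hi b := by
    refine hF.trivial_edge _ _ ?_ hi b
    -- The two ends of the edge have different levels, so they cannot be interchanged.
    have h1 : conj P (upper 1) ^ i • level P (n + 1 : ℕ) 0 = level P (n + 1 : ℕ) 0 := by
      have h2 := congrArg Subtype.val hi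
      rw [(isCyclicTree P).smul_e_eq] at h2
      rcases Sym2.eq_iff.mp h2 with h3 | h3
      · exact h3.2
      · exact absurd ((isCyclicTree P).level_eq h3.1) (by omega)
    obtain ⟨m, rfl⟩ := ((isCyclicTree P).smul_eq_iff (n + 1) i).mp h1
    rw [conj_upper_zpow_eq_emb, rayEdge_eq_succ]
    exact emb_mem_U_edgeUp _ (red_upper _)
  injective n := hF.injective _ _ _
  mem_range n v hv := hF.mem_range_of_fixed_zpow P (n + 1) (rayEdge_eq_succ P n) _ hv
  eq_zero n b hb := by
    refine hF.eq_zero_of_mem_span (P * aff (pUnit p ^ (n : ℤ)) 0) (rayEdge_eq P n)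
      ((isCyclicTree P).left_mem n) b (Submodule.span_mono ?_ hb)
    rintro _ ⟨i, hi, v, rfl⟩
    obtain ⟨m, rfl⟩ := ((isCyclicTree P).smul_eq_iff n i).mp hi
    refine ⟨m, v, ?_⟩
    congr 1
    exact F.actV_congr (conj_upper_zpow_eq_emb P n m) _ _ v

theorem chainV_zero_zero {S : Set (Vertex p)} {γ : G p} {x : ℕ → Vertex p} {e : ℕ → Edge p}
    (h : IsCyclicTree S γ x e) (v : F.onV (x 0)) :
    F.chainV h 0 0 v = F.ofV S ⟨x 0, h.base_mem 0⟩ v := by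
  rw [chainV_eq, ofV_actV_congr _ (x 0) rfl (by rw [zpow_zero, one_smul]) _ (h.base_mem 0),
    F.actV_congr (zpow_zero γ) _ (one_smul _ _), F.actV_one]

theorem actC0_congr {S : Set (Vertex p)} {g g' : G p} (h : g = g') (hg : ∀ x ∈ S, g • x ∈ S)
    (hg' : ∀ x ∈ S, g' • x ∈ S) : F.actC0 S g hg = F.actC0 S g' hg' := by
  subst h; rfl

/-- The image is invariant because N₀ lies in `U σ`, which fixes the image of F(σ) in F(x₊).
Surjectivity uses invariance under the single element γ only. -/
theorem InC.bijOn_naturalMap [CharP k p] (hF : F.InC) (P : Frame p)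
    (b : Module.Basis (Fin 2) ℚ_[p] (Plane p))
    (hadj : (tree p).Adj (level P 0 0) (level P (-1) 0))
    (hfix : ∀ g ∈ N0 b (level P 0 0), g • level P (-1) 0 = level P (-1) 0)
    (hU : N0 b (level P 0 0) ≤ U ⟨s(level P 0 0, level P (-1) 0), hadj⟩)
    (hγ : conj P (upper 1) ∈ N0 b (level P 0 0)) :
    Set.BijOn (F.naturalMap hadj) Set.univ
      ((F.repN0 b hfix).invariants : Set (F.H0 (halfTree (level P 0 0) (level P (-1) 0)))) := by
  have hnat : ∀ y, F.naturalMap hadj y = (LinearMap.range (F.boundary _)).mkQ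
      (F.chainV (isCyclicTree P) 0 0 (F.r ⟨s(level P 0 0, level P (-1) 0), hadj⟩ (level P 0 0)
        (Sym2.mem_mk_left _ _) y)) := fun y => by
    rw [chainV_zero_zero]
    rfl
  have hrep : ∀ (g : N0 b (level P 0 0)) (z : F.C0 (halfTree (level P 0 0) (level P (-1) 0))),
      F.repN0 b hfix g ((LinearMap.range (F.boundary _)).mkQ z) =
        (LinearMap.range (F.boundary _)).mkQ (F.actC0 _ g.1 (fun _ hx =>
          smul_mem_halfTree g.1 (MulAction.mem_stabilizer_iff.mp g.2.1) (hfix g.1 g.2) hx) z) :=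
    fun g z => rfl
  refine ⟨fun y _ => ?_, fun y _ y' _ hy => ?_, fun ξ hξ => ?_⟩
  · rw [SetLike.mem_coe, Representation.mem_invariants]
    intro g
    have hg : g.1 • level P 0 0 = level P 0 0 := MulAction.mem_stabilizer_iff.mp g.2.1
    change F.repN0 b hfix g ((LinearMap.range (F.boundary _)).mkQ (F.ofV _ _ _)) =
      (LinearMap.range (F.boundary _)).mkQ (F.ofV _ _ _)
    rw [hrep, actC0_ofV, ofV_actV_congr g.1 (level P 0 0) rfl hg _ (mem_halfTree hadj)]
    congr 2
    exact (hF.range_eq _ _ _ _).mp ⟨y, rfl⟩ g.1 (hU g.2) hg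
  · rw [← sub_eq_zero, ← map_sub, hnat, Submodule.mkQ_apply, Submodule.Quotient.mk_eq_zero] at hy
    obtain ⟨c, hc⟩ := hy
    have h1 := (hF.isTriangular P).boundary_injective _ hc
    exact sub_eq_zero.mp (hF.injective _ _ _ (h1.trans (map_zero _).symm))
  · obtain ⟨z, rfl⟩ := Submodule.mkQ_surjective _ ξ
    have h1 := (Representation.mem_invariants _ _).mp hξ ⟨conj P (upper 1), hγ⟩
    rw [hrep, ← sub_eq_zero, ← map_sub, Submodule.mkQ_apply, Submodule.Quotient.mk_eq_zero] at h1
    have h2 : F.actC0 _ (conj P (upper 1) ^ (1 : ℤ)) ((isCyclicTree P).mem_S 1) z - z ∈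
        LinearMap.range (F.boundary _) := by
      rwa [F.actC0_congr (zpow_one _)]
    obtain ⟨v, hv, hz⟩ := (hF.isTriangular P).exists_of_invariant h2
    have hσ : (⟨s(level P 0 0, level P (-1) 0), hadj⟩ : Edge p) =
        edgeUp (P * aff (pUnit p ^ ((0 : ℕ) : ℤ)) 0) := by
      apply Subtype.ext
      change s(vtx _, vtx _) = s(vtx _, vtx _)
      rw [mul_assoc, aff_mul, mul_zero, zero_add, ← zpow_sub_one]
      rfl
    obtain ⟨y, rfl⟩ := hF.mem_range_of_fixed_zpow P 0 hσ (Sym2.mem_mk_left _ _) hv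
    refine ⟨y, trivial, ?_⟩
    rw [hnat, eq_comm, ← sub_eq_zero, ← map_sub, Submodule.mkQ_apply,
      Submodule.Quotient.mk_eq_zero]
    exact hz

end CoeffSystem

end Homology

/-! ### Frames adapted to a torus -/

section Adapted

variable {p : ℕ} [Fact p.Prime]

/-- The frame which consists of the vectors of a basis. -/
def frameOfBasis (b : Module.Basis (Fin 2) ℚ_[p] (Plane p)) : Frame p where
  val := (Pi.basisFun ℚ_[p] (Fin 2)).toMatrix b
  inv := b.toMatrix (Pi.basisFun ℚ_[p] (Fin 2))
  val_inv := Module.Basis.toMatrix_mul_toMatrix_flip _ _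
  inv_val := Module.Basis.toMatrix_mul_toMatrix_flip _ _

theorem col_frameOfBasis (b : Module.Basis (Fin 2) ℚ_[p] (Plane p)) (i : Fin 2) :
    (frameOfBasis b).1.col i = b i := by
  ext j
  change (Pi.basisFun ℚ_[p] (Fin 2)).toMatrix b j i = b i j
  rw [Module.Basis.toMatrix_apply, Pi.basisFun_repr]

theorem exists_frame_of_mem_apartment {b : Module.Basis (Fin 2) ℚ_[p] (Plane p)} {x : Vertex p}
    (hx : x ∈ apartment b) : ∃ (P : Frame p) (c : ℚ_[p]ˣ), x = vtx P ∧ P.1.col 0 = (c : ℚ_[p]) • b 0 := by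
  obtain ⟨M, c, rfl, hM⟩ := hx
  refine ⟨frameOfBasis (b.unitsSMul c), c 0, ?_, ?_⟩
  · rw [vtx]
    congr 1
    apply Subtype.ext
    rw [hM]
    change _ = Submodule.span ℤ_[p] (Set.range (frameOfBasis (b.unitsSMul c)).1.col)
    congr 2
    funext i
    rw [col_frameOfBasis, Module.Basis.unitsSMul_apply]
    rfl
  · rw [col_frameOfBasis, Module.Basis.unitsSMul_apply]
    rfl

theorem mem_N_conj_iff {b : Module.Basis (Fin 2) ℚ_[p] (Plane p)} {P : Frame p} {c : ℚ_[p]ˣ}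
    (hc : P.1.col 0 = (c : ℚ_[p]) • b 0) (g : G p) :
    conj P g ∈ N b ↔ g 0 0 = 1 ∧ g 1 0 = 0 := by
  have h0 : P.1.mulVec ![1, 0] = (c : ℚ_[p]) • b 0 := by
    rw [mulVec_eq_sum_col, Fin.sum_univ_two, hc]
    simp
  have h1 : P.1.mulVec (![g 0 0, g 1 0]) = (c : ℚ_[p]) • (conj P g • b 0) := by
    rw [← smul_comm, ← h0]
    change _ = (P.1 * g.1 * (P⁻¹ : Frame p).1).mulVec (P.1.mulVec ![1, 0])
    rw [← Matrix.mulVec_mulVec, frame_inv_mulVec, ← Matrix.mulVec_mulVec]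
    congr 1
    ext i
    fin_cases i <;> simp [Matrix.mulVec, dotProduct]
  rw [N, MulAction.mem_stabilizer_iff]
  constructor
  · intro h
    rw [h, ← h0] at h1
    have h2 := congrArg (P⁻¹ : Frame p).1.mulVec h1
    rw [frame_inv_mulVec, frame_inv_mulVec] at h2
    exact ⟨congrFun h2 0, congrFun h2 1⟩
  · rintro ⟨h2, h3⟩
    rw [h2, h3, h0] at h1
    exact (smul_right_injective _ c.ne_zero h1).symm

theorem N0_le_U {b : Module.Basis (Fin 2) ℚ_[p] (Plane p)} {P : Frame p} {c : ℚ_[p]ˣ}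
    (hc : P.1.col 0 = (c : ℚ_[p]) • b 0) : N0 b (vtx P) ≤ U (edgeUp P) := by
  rintro g ⟨hg, hN⟩
  obtain ⟨A, rfl⟩ := exists_emb P (MulAction.mem_stabilizer_iff.mp hg)
  obtain ⟨h00, h10⟩ := (mem_N_conj_iff hc _).mp hN
  have h00' : A 0 0 = 1 := Subtype.ext h00
  have h10' : A 1 0 = 0 := Subtype.ext h10
  have hdet := det_eq A
  rw [h00', h10', one_mul, mul_zero, sub_zero] at hdet
  have hA : A = upper (A 0 1) := sl_ext h00' rfl h10' hdet
  rw [hA]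
  exact emb_mem_U_edgeUp P (red_upper _)

theorem conj_upper_mem_N0 {b : Module.Basis (Fin 2) ℚ_[p] (Plane p)} {P : Frame p} {c : ℚ_[p]ˣ}
    (hc : P.1.col 0 = (c : ℚ_[p]) • b 0) : conj P (upper 1) ∈ N0 b (vtx P) := by
  refine ⟨?_, (mem_N_conj_iff hc _).mpr ⟨upper_00 1, upper_10 1⟩⟩
  have := emb_smul_vtx P (upper 1)
  rw [emb_apply, incl_upper, PadicInt.coe_one] at this
  exact MulAction.mem_stabilizer_iff.mpr this

/-- The outer neighbours are indexed by a modulo p and γ sends a to a + 1, so it fixes none of them.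
-/
theorem eq_of_adj_of_fixed (P : Frame p) {y : Vertex p} (hadj : (tree p).Adj (vtx P) y)
    (hfix : conj P (upper 1) • y = y) : y = vtx (P * aff (pUnit p)⁻¹ 0) := by
  rcases eq_of_adj P hadj with h | ⟨a, rfl⟩
  · exact h
  · rw [conj_upper_smul, vtx_aff_eq_iff, add_sub_cancel_left, norm_one] at hfix
    exact absurd hfix.2 (not_le.mpr norm_pUnit_lt_one)

end Adapted

end

end SL2Tree

/-! ### The theorem, by reduction to a frame adapted to the torus -/

theorem mainTheorem3 (p : ℕ) [Fact p.Prime] (k : Type*) [Field k] [CharP k p]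
    (b : Module.Basis (Fin 2) ℚ_[p] (SL2Tree.Plane p))
    (xp xm : SL2Tree.Vertex p) (hadj : (SL2Tree.tree p).Adj xp xm)
    (hxp : xp ∈ SL2Tree.apartment b) (hxm : xm ∈ SL2Tree.apartment b)
    (hfix : ∀ g ∈ SL2Tree.N0 b xp, g • xm = xm)
    (F : SL2Tree.CoeffSystem p k) (hF : F.InC) :
    Set.BijOn (F.naturalMap hadj) Set.univ
      ((F.repN0 b hfix).invariants : Set (F.H0 (SL2Tree.halfTree xp xm))) := by
  obtain ⟨P, c, hP, hc⟩ := SL2Tree.exists_frame_of_mem_apartment hxp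
  have hγ : SL2Tree.conj P (SL2Tree.upper 1) ∈ SL2Tree.N0 b xp := by
    rw [hP]
    exact SL2Tree.conj_upper_mem_N0 hc
  -- The vertex x₋ is determined as the only neighbour of x₊ which is fixed by the element γ of N₀.
  have hxm' : xm = SL2Tree.level P (-1) 0 := by
    rw [SL2Tree.level, zpow_neg_one]
    exact SL2Tree.eq_of_adj_of_fixed P (hP ▸ hadj) (hfix _ hγ)
  have hxp' : xp = SL2Tree.level P 0 0 := by
    rw [SL2Tree.level, zpow_zero, SL2Tree.aff_one_zero, mul_one, hP]
  have hU : SL2Tree.N0 b xp ≤ SL2Tree.U ⟨s(xp, xm), hadj⟩ := by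
    have h1 : (⟨s(xp, xm), hadj⟩ : SL2Tree.Edge p) = SL2Tree.edgeUp P := by
      apply Subtype.ext
      change s(xp, xm) = s(SL2Tree.vtx P, SL2Tree.vtx (P * SL2Tree.aff (SL2Tree.pUnit p)⁻¹ 0))
      rw [hP, hxm', SL2Tree.level, zpow_neg_one]
    rw [h1, hP]
    exact SL2Tree.N0_le_U hc
  clear hP
  subst hxp' hxm'
  exact hF.bijOn_naturalMap P b hadj hfix hU hγ
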